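/- **Theorem (Harris–Lutz type).** Let $n\ge 2$, $t_0\in\mathbb R$, $a_0,\dots,a_{n-1}\in\mathbb C$, $a_n=1$, and suppose that $P(a;x)=x^n+\sum_{i<n}a_ix^i$ has $n$ roots $\lambda,\lambda_1,\dots,\lambda_{n-1}$ with pairwise distinct real parts, where $\lambda$ is any fixed one of them. Let $m\ge 2$ be an integer, $p\in(m,m+1]$, and let $r_0,\dots,r_{n-1}\in L^p[t_0,\infty)$ be complex valued; put $P(r(t);x)=\sum_{i<n}r_i(t)x^i$. *Notation.* Let $\gamma_j=\lambda_j-\lambda$, $\Gamma_j=\prod_{k\ne j}(\gamma_j-\gamma_k)$ $(1\le j,k\le n-1)$, and $$G[f](t)=\sum_{j=1}^{n-1}\frac1{\Gamma_j}\int_{t_0}^\infty g_{\gamma_j}(t,s)f(s)\,ds,$$ where $g_\omega(t,s)=-\operatorname{sgn}(\Re\omega)\,e^{\omega(t-s)}$ if $\operatorname{sgn}(\Re\omega)(t-s)<0$, and $g_\omega(t,s)=0$ otherwise. Put $$\tilde a_i=\frac1{i!}\frac{\partial^iP(a;x)}{\partial x^i}\Big|_{x=\lambda},\qquad \tilde r_i(t)=\frac1{i!}\frac{\partial^iP(r(t);x)}{\partial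 x^i}\Big|_{x=\lambda},\qquad \mathcal L(t,z)=\sum_{k=1}^{n-1}\tilde r_k(t)z^{(k-1)}(t).$$ Let $B_i$ be the complete Bell polynomials, $B_0=1$, $B_{i+1}=\sum_{j=0}^i\binom ij B_{i-j}\,x_{j+1}$, and let $h_{k,i}(x_1,\dots,x_i)$ be the homogeneous component of degree $k\ge2$ of $B_{i+1}(x_1,\dots,x_{i+1})-x_{i+1}$. Functions $\theta_1,\theta_2,\dots$ on $[t_0,\infty)$ are defined recursively by $\theta_1=-G[P(r;\lambda)]$ and, for $l\ge2$, $\theta_l=-G[S_l]$ with $$S_l=\mathcal L(\cdot,\theta_{l-1})+\sum_{k=2}^n\sum_{i=k}^n\Big(\tilde a_i\,[\varepsilon^l]+\tilde r_i\,[\varepsilon^{l-1}]\Big)\,h_{k,i-1}\big(\varphi_l,\varphi_l',\dots,\varphi_l^{(i-2)}\big),\qquad \varphi_l=\sum_{q=1}^{l-1}\varepsilon^q\theta_q,$$ where $[\varepsilon^c]$ denotes the coefficient of $\varepsilon^c$ in a polynomial in the formal variable $\varepsilon$ and primes denote derivatives in $t$. Thus $S_l$ depends on $\theta_1,\dots,\theta_{l-1}$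 only; put also $S_1=P(r;\lambda)$. *Conclusion.* For $1\le l\le m$ the integrals defining $\theta_l=-G[S_l]$ converge absolutely for all $t\ge t_0$, $\theta_l$ is of class $C^{n-2}$ on $[t_0,\infty)$, and $\theta_l\in L^{p/l}[t_0,\infty)$. There is a solution $y_\lambda$ on $[t_0,\infty)$ of $$y^{(n)}+\sum_{i=0}^{n-1}(a_i+r_i(t))\,y^{(i)}=0$$ (in the Carathéodory sense: $y_\lambda\in C^{n-1}[t_0,\infty)$, $y_\lambda^{(n-1)}$ is locally absolutely continuous, and the equation holds for almost every $t$) such that $$\lim_{t\to\infty}\frac{y_\lambda^{(i)}(t)}{y_\lambda(t)}=\lambda^i\qquad(i=1,\dots,n-1)$$ and, as $t\to\infty$, $$y_\lambda(t)=(1+o(1))\,e^{\lambda(t-t_0)}\exp\Big(\int_{t_0}^t[\theta_1(s)+\cdots+\theta_m(s)]\,ds\Big).$$ -/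

import Mathlib

open Set Filter Topology MeasureTheory

namespace PoincarePerron

noncomputable section

/-- The characteristic polynomial `P(a; x) = x ^ n + ∑_{i < n} a_i x ^ i`. -/
def charPoly {n : ℕ} (a : Fin n → ℂ) : Polynomial ℂ :=
  Polynomial.X ^ n + ∑ i : Fin n, Polynomial.C (a i) * Polynomial.X ^ (i : ℕ)

/-- The polynomial `P(r(t); x) = ∑_{i < n} r_i(t) x ^ i`. -/
def pertPoly {n : ℕ} (r : Fin n → ℝ → ℂ) (t : ℝ) : Polynomial ℂ :=
  ∑ i : Fin n, Polynomial.C (r i t) * Polynomial.X ^ (i : ℕ)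

/-- `y` solves `y^(n) + ∑_{i < n} (a_i + r_i(t)) y^(i) = 0` on `[t₀, ∞)` in the Carathéodory sense:
`y` is of class `C^(n-1)` on `[t₀, ∞)`, its derivative of order `n - 1` is locally absolutely
continuous there, and the equation holds almost everywhere. -/
def IsSolution {n : ℕ} (a : Fin n → ℂ) (r : Fin n → ℝ → ℂ) (t₀ : ℝ) (y : ℝ → ℂ) : Prop :=
  ContDiffOn ℝ ((n - 1 : ℕ) : WithTop ℕ∞) y (Ici t₀) ∧
  (∀ T, t₀ ≤ T →
    AbsolutelyContinuousOnInterval (iteratedDerivWithin (n - 1) y (Ici t₀)) t₀ T) ∧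
  ∀ᵐ t ∂(volume.restrict (Ici t₀)),
    iteratedDerivWithin n y (Ici t₀) t
      + ∑ i : Fin n, (a i + r i t) * iteratedDerivWithin (i : ℕ) y (Ici t₀) t = 0

/-- The scalar Green kernel `g_ω(t, s)`. -/
def greenKernel (ω : ℂ) (t s : ℝ) : ℂ :=
  if Real.sign ω.re * (t - s) < 0 then
    -(Real.sign ω.re : ℂ) * Complex.exp (ω * ((t : ℂ) - (s : ℂ)))
  else 0

/-- `G_ω[f](t) = ∫_{t₀}^∞ g_ω(t, s) f(s) ds`. -/
def scalarGreen (t₀ : ℝ) (ω : ℂ) (f : ℝ → ℂ) (t : ℝ) : ℂ :=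
  ∫ s in Ici t₀, greenKernel ω t s * f s

/-- `Γ_j = ∏_{k ≠ j} (γ_j - γ_k)`, where `γ_j = root j - root i₀` and `j, k` range over the indices
other than `i₀` (so that `γ_j - γ_k = root j - root k`). -/
def greenGamma {n : ℕ} (root : Fin n → ℂ) (i₀ j : Fin n) : ℂ :=
  ∏ k ∈ (Finset.univ.erase i₀).erase j, (root j - root k)

/-- The Green operator `G[f] = ∑_{j ≠ i₀} (1 / Γ_j) G_{γ_j}[f]`, `γ_j = root j - root i₀`. -/
def greenOp {n : ℕ} (t₀ : ℝ) (root : Fin n → ℂ) (i₀ : Fin n) (f : ℝ → ℂ) (t : ℝ) : ℂ :=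
  ∑ j ∈ Finset.univ.erase i₀,
    (1 / greenGamma root i₀ j) * scalarGreen t₀ (root j - root i₀) f t

/-- The complete Bell polynomials. The variable `X j` stands for `x_{j+1}`. -/
def bell : ℕ → MvPolynomial ℕ ℂ
  | 0 => 1
  | i + 1 => ∑ j : Fin (i + 1),
      MvPolynomial.C ((i.choose j : ℕ) : ℂ) * bell (i - j) * MvPolynomial.X (j : ℕ)
  decreasing_by omega

/-- `h_{k,i}`: the part of degree `k` of `f_i = B_{i+1}(x_1, …, x_{i+1}) - x_{i+1}`. -/
def bellPart (k i : ℕ) : MvPolynomial ℕ ℂ :=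
  MvPolynomial.homogeneousComponent k (bell (i + 1) - MvPolynomial.X i)

/-- `ã_i = ∑_{j=0}^{n-i} (i+j choose j) a_{i+j} λ^j` (with `a_n = 1`), that is,
`(1/i!) ∂^i P(a; x)/∂x^i` at `x = λ`. -/
def aTilde {n : ℕ} (a : Fin n → ℂ) (lam : ℂ) (i : ℕ) : ℂ :=
  (Polynomial.hasseDeriv i (charPoly a)).eval lam

/-- `r̃_i(t) = ∑_{j=0}^{n-1-i} (i+j choose j) r_{i+j}(t) λ^j`, that is,
`(1/i!) ∂^i P(r(t); x)/∂x^i` at `x = λ`. -/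
def rTilde {n : ℕ} (r : Fin n → ℝ → ℂ) (lam : ℂ) (i : ℕ) (t : ℝ) : ℂ :=
  (Polynomial.hasseDeriv i (pertPoly r t)).eval lam

/-- The linear part `L(t, z) = ∑_{k=1}^{n-1} (1/k!) ∂^k P(r(t); x)/∂x^k |_{x=λ} z^(k-1)(t)`, with
derivatives on `[t₀, ∞)`. -/
def linPart {n : ℕ} (r : Fin n → ℝ → ℂ) (t₀ : ℝ) (lam : ℂ) (z : ℝ → ℂ) (t : ℝ) : ℂ :=
  ∑ k ∈ Finset.Icc 1 (n - 1), rTilde r lam k t * iteratedDerivWithin (k - 1) z (Ici t₀) t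

/-- The polynomial `∑_{q < l} θ_q^(j)(t) ε^q` in the bookkeeping variable `ε`. -/
def jet (t₀ : ℝ) (θ : ℕ → ℝ → ℂ) (l : ℕ) (t : ℝ) (j : ℕ) : Polynomial ℂ :=
  ∑ q ∈ Finset.range l, Polynomial.monomial q (iteratedDerivWithin j (θ q) (Ici t₀) t)

/-- `bellCoeff t₀ θ l k i c t` is the coefficient of `ε^c` in `h_{k,i}(φ, φ', …)(t)` for
`φ = ∑_{q < l} ε^q θ_q`, that is, the sum of all those products of `k` derivatives of
`θ_{q_1}, …, θ_{q_k}` in the expansion of `h_{k,i}` for which `q_1 + ⋯ + q_k = c`. -/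
def bellCoeff (t₀ : ℝ) (θ : ℕ → ℝ → ℂ) (l k i c : ℕ) (t : ℝ) : ℂ :=
  (MvPolynomial.aeval (jet t₀ θ l t) (bellPart k i)).coeff c

/-- The function `S_l` for which `θ_l = -G[S_l]`. It uses `θ_q` only for `q < l`. It is
the part of order `l` of `P(r; λ) + L(·, φ) + F(·, φ, φ', …)`, where `φ = ∑_q θ_q`, where `θ_q` and
its derivatives have order `q`, the `r_i` have order `1`, constants have order `0`, and where
`F = ∑_{k=2}^n ∑_{i=k}^n (ã_i + r̃_i(t)) h_{k,i-1}(φ, φ', …, φ^(i-2))`. -/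
def source {n : ℕ} (a : Fin n → ℂ) (r : Fin n → ℝ → ℂ) (t₀ : ℝ) (lam : ℂ) (θ : ℕ → ℝ → ℂ) :
    ℕ → ℝ → ℂ
  | 0, _ => 0
  | 1, t => (pertPoly r t).eval lam
  | l + 2, t => linPart r t₀ lam (θ (l + 1)) t
      + ∑ k ∈ Finset.Icc 2 n, ∑ i ∈ Finset.Icc k n,
          (aTilde a lam i * bellCoeff t₀ θ (l + 2) k (i - 1) (l + 2) t
            + rTilde r lam i t * bellCoeff t₀ θ (l + 2) k (i - 1) (l + 1) t)

/-- The functions `θ_1, θ_2, …` attached to the root `λ = root i₀` (and `θ_0 = 0`); by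
`theta_eq` below they are given by the recurrence `θ_l = -G[S_l]`. -/
def theta {n : ℕ} (a : Fin n → ℂ) (r : Fin n → ℝ → ℂ) (t₀ : ℝ) (root : Fin n → ℂ) (i₀ : Fin n)
    (l : ℕ) : ℝ → ℂ :=
  fun t => -greenOp t₀ root i₀
    (source a r t₀ (root i₀) (fun q => if _h : q < l then theta a r t₀ root i₀ q else 0) l) t
  termination_by l

theorem source_congr {n : ℕ} (a : Fin n → ℂ) (r : Fin n → ℝ → ℂ) (t₀ : ℝ) (lam : ℂ)
    (θ θ' : ℕ → ℝ → ℂ) (l : ℕ) (h : ∀ q < l, θ q = θ' q) :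
    source a r t₀ lam θ l = source a r t₀ lam θ' l := by
  match l with
  | 0 => rfl
  | 1 => rfl
  | l + 2 =>
    have hj : ∀ t, jet t₀ θ (l + 2) t = jet t₀ θ' (l + 2) t := by
      intro t
      funext j
      exact Finset.sum_congr rfl fun q hq => by rw [h q (Finset.mem_range.1 hq)]
    funext t
    simp only [source, bellCoeff, hj, h (l + 1) (by omega)]

/-- The recurrence: `θ_l = -G[S_l]`, where `S_l` depends on `θ_1, …, θ_{l-1}` only. -/
theorem theta_eq {n : ℕ} (a : Fin n → ℂ) (r : Fin n → ℝ → ℂ) (t₀ : ℝ) (root : Fin n → ℂ)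
    (i₀ : Fin n) (l : ℕ) (t : ℝ) :
    theta a r t₀ root i₀ l t =
      -greenOp t₀ root i₀ (source a r t₀ (root i₀) (theta a r t₀ root i₀) l) t := by
  rw [theta]
  congr 2
  exact source_congr _ _ _ _ _ _ _ fun q hq => by simp [hq]

/-- `θ_1 = -G[P(r; λ)]`. -/
theorem theta_one {n : ℕ} (a : Fin n → ℂ) (r : Fin n → ℝ → ℂ) (t₀ : ℝ) (root : Fin n → ℂ)
    (i₀ : Fin n) (t : ℝ) :
    theta a r t₀ root i₀ 1 t =
      -greenOp t₀ root i₀ (fun s => (pertPoly r s).eval (root i₀)) t := by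
  rw [theta_eq]
  rfl

end

end PoincarePerron

/-! Write `y = v · exp (λ (t - t₀) + ∫ φ)` with `φ = θ_1 + ⋯ + θ_m`. The Taylor shift of the
equation at `λ` and the Bell polynomials, which express the derivatives of `exp (∫ φ)`, turn the
equation for `y` into a linear equation `∑ conjCoeff_k v^(k) = 0`. It suffices to find a solution
with `v → 1` and `v^(k) → 0` for `1 ≤ k ≤ n - 1`.

The coefficient of `v` itself is `residual`, and `φ` is designed to make it integrable. Call a
function of order `c` if it is bounded and lies in `L^(p/c)`; Hölder makes orders additive under
products. The Green operator, dominated by convolution with `exp (-δ|x|)`, maps `L^q` to `L^q ∩ L^∞`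
for `q ≥ 1`, so induction gives `θ_l` and its derivatives up to `n - 2` order `l`
(`memLp_source_and_isOrder`); this is where `l ≤ m < p` enters. The recurrence cancels all
contributions to `residual` of order at most `m` (`residual_eq`). Only order `m + 1 ≥ p` and higher
is left, which lies in `L¹` by interpolation with the bound (`integrable_residual`). For `1 ≤ k < n`
the coefficient of `v^(k)` differs from `ã_k` by a function in `L^p` only (`memLp_conjCoeff_sub`).

This is enough. The unperturbed operator has the exponents `γ_j = λ_j - λ`; the exponent `0` belongs
to the constant solution, and the others have nonzero real part. Put `v = 1 - ∑ c_j G_{γ_j} f`, with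
`c_j` from the divided difference at all `n` roots. The equation becomes an integral equation for `f
∈ L¹`, in which the Green integral at exponent `0` meets the integrable coefficient only, since its
derivatives carry the factor `0 ^ k`. The `L^p` coefficients meet only exponentially decaying
kernels. Taking the base point `T` of the Green kernels large makes the operator small on `[T, ∞)`;
before `T` it is a backward Volterra operator, which an exponential weight tames. A Neumann series
in weighted `L¹` then gives `f` on all of `[t₀, ∞)` (`exists_integrable_perturbed`,
`exists_amplitude`). -/

namespace PoincarePerron

/-! ### Convolution with the two-sided exponential on `L^q`. -/

open scoped ENNReal

/-- The two-sided exponential `exp (-δ |x|)` as an extended nonnegative real. -/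
noncomputable def expKer (δ x : ℝ) : ℝ≥0∞ := ENNReal.ofReal (Real.exp (-δ * |x|))

theorem continuous_expKer (δ : ℝ) : Continuous (expKer δ) := by
  exact ENNReal.continuous_ofReal.comp (by fun_prop)

@[fun_prop]
theorem measurable_expKer (δ : ℝ) : Measurable (expKer δ) := (continuous_expKer δ).measurable

theorem expKer_le_one {δ : ℝ} (hδ : 0 ≤ δ) (x : ℝ) : expKer δ x ≤ 1 := by
  unfold expKer
  rw [← ENNReal.ofReal_one]
  exact ENNReal.ofReal_le_ofReal (Real.exp_le_one_iff.2 (by nlinarith [abs_nonneg x]))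

theorem expKer_neg (δ x : ℝ) : expKer δ (-x) = expKer δ x := by simp [expKer]

theorem expKer_ne_top (δ x : ℝ) : expKer δ x ≠ ∞ := by simp [expKer]

theorem tendsto_expKer {δ : ℝ} (hδ : 0 < δ) (s : ℝ) :
    Tendsto (fun t => expKer δ (t - s)) atTop (𝓝 0) := by
  unfold expKer
  rw [← ENNReal.ofReal_zero]
  refine ENNReal.tendsto_ofReal (Real.tendsto_exp_atBot.comp ?_)
  have h1 : Tendsto (fun t : ℝ => |t - s|) atTop atTop :=
    tendsto_abs_atTop_atTop.comp (tendsto_atTop_add_const_right _ (-s) tendsto_id)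
  exact h1.const_mul_atTop_of_neg (by linarith)

theorem lintegral_expKer_lt_top {δ : ℝ} (hδ : 0 < δ) : ∫⁻ x, expKer δ x < ∞ := by
  have h : Integrable (fun x : ℝ => Real.exp (-δ * |x|)) := by
    rw [← integrableOn_univ, ← Iic_union_Ioi (a := (0 : ℝ))]
    refine IntegrableOn.union ?_ ?_
    · refine (integrableOn_exp_mul_Iic hδ 0).congr_fun (fun x hx => ?_) measurableSet_Iic
      simp [abs_of_nonpos (mem_Iic.1 hx)]
    · refine (integrableOn_exp_mul_Ioi (a := -δ) (by linarith) 0).congr_fun (fun x hx => ?_)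
        measurableSet_Ioi
      simp [abs_of_pos (mem_Ioi.1 hx)]
  have := h.2
  rw [hasFiniteIntegral_iff_ofReal (Eventually.of_forall fun x => (Real.exp_pos _).le)] at this
  exact this

theorem lintegral_expKer_sub_right (δ t : ℝ) :
    ∫⁻ s, expKer δ (t - s) = ∫⁻ x, expKer δ x :=
  lintegral_sub_left_eq_self (expKer δ) t

theorem lintegral_expKer_sub_left (δ s : ℝ) :
    ∫⁻ t, expKer δ (t - s) = ∫⁻ x, expKer δ x :=
  lintegral_sub_right_eq_self (expKer δ) s

/-- Hölder's inequality for the exponential kernel. -/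
theorem lintegral_expKer_mul_rpow_le (δ t : ℝ) {q : ℝ} (hq : 1 ≤ q) (S : Set ℝ) {g : ℝ → ℝ≥0∞}
    (hg : AEMeasurable g (volume.restrict S)) :
    (∫⁻ s in S, expKer δ (t - s) * g s) ^ q ≤
      (∫⁻ x, expKer δ x) ^ (q - 1) * ∫⁻ s in S, expKer δ (t - s) * g s ^ q := by
  have hq0 : 0 < q := by linarith
  have hk : AEMeasurable (fun s => expKer δ (t - s)) (volume.restrict S) := by fun_prop
  -- Split `k g = k^(1 - 1/q) (k g^q)^(1/q)`, where `k` is the kernel; this form of Hölder also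
  -- covers `q = 1`.
  have h := ENNReal.lintegral_mul_norm_pow_le hk (hk.mul (hg.pow_const q))
    (p := 1 - 1 / q) (q := 1 / q) (by rw [sub_nonneg, div_le_one hq0]; exact hq) (by positivity)
    (by ring)
  have e : ∀ s, expKer δ (t - s) ^ (1 - 1 / q) *
      ((fun s => expKer δ (t - s)) * fun s => g s ^ q) s ^ (1 / q) = expKer δ (t - s) * g s := by
    intro s
    have hp : expKer δ (t - s) ≠ 0 := by simp [expKer, Real.exp_pos]
    simp only [Pi.mul_apply]
    rw [ENNReal.mul_rpow_of_nonneg _ _ (by positivity), ← mul_assoc,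
      ← ENNReal.rpow_add _ _ hp (expKer_ne_top _ _), ← ENNReal.rpow_mul,
      mul_one_div_cancel hq0.ne']
    simp
  simp only [e] at h
  have h2 := ENNReal.rpow_le_rpow h hq0.le
  rw [ENNReal.mul_rpow_of_nonneg _ _ hq0.le, ← ENNReal.rpow_mul, ← ENNReal.rpow_mul,
    one_div_mul_cancel hq0.ne', ENNReal.rpow_one] at h2
  refine h2.trans ?_
  have e2 : (1 - 1 / q) * q = q - 1 := by field_simp
  rw [e2]
  refine mul_le_mul' (ENNReal.rpow_le_rpow ?_ (by linarith)) le_rfl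
  rw [← lintegral_expKer_sub_right δ t]
  exact setLIntegral_le_lintegral _ _

/-- After Tonelli the kernel is integrated in `t`, and its mass does not depend on `s`. Together
with the Hölder bound this is Young's inequality. -/
theorem lintegral_lintegral_expKer_mul_le (δ : ℝ) {S : Set ℝ}
    {h : ℝ → ℝ≥0∞} (hh : AEMeasurable h (volume.restrict S)) (S' : Set ℝ) :
    ∫⁻ t in S', ∫⁻ s in S, expKer δ (t - s) * h s ≤
      (∫⁻ x, expKer δ x) * ∫⁻ s in S, h s := by
  have hm : AEMeasurable (fun z : ℝ × ℝ => expKer δ (z.1 - z.2) * h z.2)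
      ((volume.restrict S').prod (volume.restrict S)) := by
    refine AEMeasurable.mul (by fun_prop) ?_
    exact hh.comp_snd
  rw [lintegral_lintegral_swap hm]
  calc ∫⁻ s in S, ∫⁻ t in S', expKer δ (t - s) * h s
      ≤ ∫⁻ s in S, (∫⁻ x, expKer δ x) * h s := by
        refine lintegral_mono fun s => ?_
        rw [lintegral_mul_const _ (by fun_prop)]
        refine mul_le_mul' ?_ le_rfl
        rw [← lintegral_expKer_sub_left δ s]
        exact setLIntegral_le_lintegral _ _
    _ = _ := lintegral_const_mul'' _ hh

theorem tendsto_lintegral_expKer_mul {δ : ℝ} (hδ : 0 < δ) {S : Set ℝ}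
    {h : ℝ → ℝ≥0∞} (hh : AEMeasurable h (volume.restrict S)) (hfin : ∫⁻ s in S, h s ≠ ∞) :
    Tendsto (fun t => ∫⁻ s in S, expKer δ (t - s) * h s) atTop (𝓝 0) := by
  have := tendsto_lintegral_filter_of_dominated_convergence' (l := atTop)
    (μ := volume.restrict S) (F := fun t s => expKer δ (t - s) * h s) (f := fun _ => 0) h
    (Eventually.of_forall fun t => AEMeasurable.mul (by fun_prop) hh)
    (Eventually.of_forall fun t => Eventually.of_forall fun s => by
      simpa using mul_le_mul' (expKer_le_one hδ.le (t - s)) (le_refl (h s)))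
    hfin ?_
  · simpa using this
  · filter_upwards [ae_lt_top' hh hfin] with s hs
    simpa using ENNReal.Tendsto.mul_const (tendsto_expKer hδ s) (Or.inr hs.ne)

variable {f : ℝ → ℂ} {S : Set ℝ} {q δ : ℝ}

theorem lintegral_enorm_rpow_ne_top (hq : 1 ≤ q)
    (hf : MemLp f (ENNReal.ofReal q) (volume.restrict S)) :
    ∫⁻ s in S, ‖f s‖ₑ ^ q ≠ ∞ := by
  have h := hf.2
  have hq0 : 0 < q := by linarith
  rw [eLpNorm_lt_top_iff_lintegral_rpow_enorm_lt_top (by simpa using hq0) (by simp),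
    ENNReal.toReal_ofReal hq0.le] at h
  exact h.ne

/-- The Hölder bound reduces the claim to the integrable function `‖f‖ ^ q`, for which dominated
convergence applies because the kernel is at most `1` and decays pointwise. -/
theorem tendsto_lintegral_expKer_mul_enorm (hδ : 0 < δ) (hq : 1 ≤ q)
    (hf : MemLp f (ENNReal.ofReal q) (volume.restrict S)) :
    Tendsto (fun t => ∫⁻ s in S, expKer δ (t - s) * ‖f s‖ₑ) atTop (𝓝 0) := by
  have hq0 : 0 < q := by linarith
  have h1 := tendsto_lintegral_expKer_mul hδ (hf.1.enorm.pow_const q)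
    (lintegral_enorm_rpow_ne_top hq hf)
  have hC : (∫⁻ x, expKer δ x) ^ (q - 1) ≠ ∞ :=
    ENNReal.rpow_ne_top_of_nonneg (by linarith) (lintegral_expKer_lt_top hδ).ne
  have h2 := ENNReal.Tendsto.const_mul h1 (Or.inr hC)
  rw [mul_zero] at h2
  have h3 : Tendsto (fun t => (∫⁻ s in S, expKer δ (t - s) * ‖f s‖ₑ) ^ q) atTop (𝓝 0) :=
    tendsto_of_tendsto_of_tendsto_of_le_of_le tendsto_const_nhds h2 (fun _ => zero_le)
      fun t => lintegral_expKer_mul_rpow_le δ t hq S hf.1.enorm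
  have h4 := h3.ennrpow_const (1 / q)
  rw [ENNReal.zero_rpow_of_pos (by positivity)] at h4
  refine h4.congr fun t => ?_
  rw [← ENNReal.rpow_mul, mul_one_div_cancel hq0.ne', ENNReal.rpow_one]

theorem exists_lintegral_expKer_mul_enorm_le (hδ : 0 < δ) (hq : 1 ≤ q)
    (hf : MemLp f (ENNReal.ofReal q) (volume.restrict S)) :
    ∃ M : ℝ≥0∞, M ≠ ∞ ∧ ∀ t, ∫⁻ s in S, expKer δ (t - s) * ‖f s‖ₑ ≤ M := by
  have hq0 : 0 < q := by linarith
  refine ⟨((∫⁻ x, expKer δ x) ^ (q - 1) * ∫⁻ s in S, ‖f s‖ₑ ^ q) ^ (1 / q), ?_, fun t => ?_⟩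
  · exact ENNReal.rpow_ne_top_of_nonneg (by positivity) (ENNReal.mul_ne_top
      (ENNReal.rpow_ne_top_of_nonneg (by linarith) (lintegral_expKer_lt_top hδ).ne)
      (lintegral_enorm_rpow_ne_top hq hf))
  · rw [one_div, ENNReal.le_rpow_inv_iff hq0]
    refine (lintegral_expKer_mul_rpow_le δ t hq S hf.1.enorm).trans ?_
    refine mul_le_mul' le_rfl (lintegral_mono fun s => ?_)
    simpa using mul_le_mul' (expKer_le_one hδ.le (t - s)) (le_refl (‖f s‖ₑ ^ q))

theorem lintegral_rpow_lintegral_expKer_ne_top (hδ : 0 < δ) (hq : 1 ≤ q)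
    (hf : MemLp f (ENNReal.ofReal q) (volume.restrict S)) :
    ∫⁻ t in S, (∫⁻ s in S, expKer δ (t - s) * ‖f s‖ₑ) ^ q ≠ ∞ := by
  have hC : (∫⁻ x, expKer δ x) ^ (q - 1) ≠ ∞ :=
    ENNReal.rpow_ne_top_of_nonneg (by linarith) (lintegral_expKer_lt_top hδ).ne
  refine ne_top_of_le_ne_top ?_ (lintegral_mono fun t =>
    lintegral_expKer_mul_rpow_le δ t hq S hf.1.enorm)
  rw [lintegral_const_mul' _ _ hC]
  refine ENNReal.mul_ne_top hC (ne_top_of_le_ne_top ?_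
    (lintegral_lintegral_expKer_mul_le δ (hf.1.enorm.pow_const q) S))
  exact ENNReal.mul_ne_top (lintegral_expKer_lt_top hδ).ne (lintegral_enorm_rpow_ne_top hq hf)

end PoincarePerron

/-! ### Absolute continuity and sequences of derivatives. -/

namespace PoincarePerron

variable {t₀ : ℝ}

theorem _root_.AbsolutelyContinuousOnInterval.congr {f g : ℝ → ℂ} {a b : ℝ}
    (hf : AbsolutelyContinuousOnInterval f a b) (h : EqOn f g (uIcc a b)) :
    AbsolutelyContinuousOnInterval g a b := by
  rw [absolutelyContinuousOnInterval_iff] at hf ⊢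
  intro ε hε
  obtain ⟨δ, hδ, H⟩ := hf ε hε
  refine ⟨δ, hδ, fun E hE hE' => ?_⟩
  have := H E hE hE'
  refine lt_of_eq_of_lt (Finset.sum_congr rfl fun i hi => ?_) this
  rw [h (hE.1 i hi).1, h (hE.1 i hi).2]

theorem _root_.AbsolutelyContinuousOnInterval.ofReal_comp {f : ℝ → ℝ} {a b : ℝ}
    (hf : AbsolutelyContinuousOnInterval f a b) :
    AbsolutelyContinuousOnInterval (fun t => (f t : ℂ)) a b := by
  rw [absolutelyContinuousOnInterval_iff] at hf ⊢
  intro ε hε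
  obtain ⟨δ, hδ, H⟩ := hf ε hε
  refine ⟨δ, hδ, fun E hE hE' => ?_⟩
  simpa only [Complex.isometry_ofReal.dist_eq] using H E hE hE'

theorem absolutelyContinuousOnInterval_const (c : ℂ) (a b : ℝ) :
    AbsolutelyContinuousOnInterval (fun _ : ℝ => c) a b :=
  (contDiff_const.contDiffOn (n := 1)).absolutelyContinuousOnInterval

theorem _root_.AbsolutelyContinuousOnInterval.complex_mul {f g : ℝ → ℂ} {a b : ℝ}
    (hf : AbsolutelyContinuousOnInterval f a b) (hg : AbsolutelyContinuousOnInterval g a b) :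
    AbsolutelyContinuousOnInterval (fun t => f t * g t) a b :=
  hf.smul hg

theorem absolutelyContinuousOnInterval_sum {ι : Type*} (s : Finset ι) {F : ι → ℝ → ℂ} {a b : ℝ}
    (hF : ∀ i ∈ s, AbsolutelyContinuousOnInterval (F i) a b) :
    AbsolutelyContinuousOnInterval (fun t => ∑ i ∈ s, F i t) a b := by
  classical
  induction s using Finset.induction_on with
  | empty => simpa using absolutelyContinuousOnInterval_const 0 a b
  | insert i s hi ih =>
    simp only [Finset.sum_insert hi]
    exact (hF i (by simp)).add (ih fun j hj => hF j (by simp [hj]))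

theorem absolutelyContinuousOnInterval_integral {g : ℝ → ℂ} {a b : ℝ}
    (hg : IntervalIntegrable g volume a b) :
    AbsolutelyContinuousOnInterval (fun x => ∫ s in a..x, g s) a b := by
  have hre : IntervalIntegrable (fun s => (g s).re) volume a b := ⟨hg.1.re, hg.2.re⟩
  have him : IntervalIntegrable (fun s => (g s).im) volume a b := ⟨hg.1.im, hg.2.im⟩
  have h1 := (hre.absolutelyContinuousOnInterval_intervalIntegral (c := a) (by simp)).ofReal_comp
  have h2 := (him.absolutelyContinuousOnInterval_intervalIntegral (c := a) (by simp)).ofReal_comp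
  have h3 := h1.add ((absolutelyContinuousOnInterval_const Complex.I a b).complex_mul h2)
  refine h3.congr fun x hx => ?_
  have hx' : IntervalIntegrable g volume a x := hg.mono_set (uIcc_subset_uIcc_left hx)
  have hre : IntervalIntegrable (fun s => ((g s).re : ℂ)) volume a x :=
    ⟨hx'.1.re.ofReal, hx'.2.re.ofReal⟩
  have him : IntervalIntegrable (fun s => ((g s).im : ℂ)) volume a x :=
    ⟨hx'.1.im.ofReal, hx'.2.im.ofReal⟩
  change ((∫ s in a..x, (g s).re : ℝ) : ℂ) + Complex.I * ((∫ s in a..x, (g s).im : ℝ) : ℂ) = _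
  rw [← intervalIntegral.integral_ofReal, ← intervalIntegral.integral_ofReal,
    ← intervalIntegral.integral_const_mul,
    ← intervalIntegral.integral_add hre (him.const_mul Complex.I)]
  refine intervalIntegral.integral_congr fun s _ => ?_
  rw [mul_comm, Complex.re_add_im]

theorem ae_restrict_Ici_of_forall_Icc {p : ℝ → Prop}
    (h : ∀ b, t₀ ≤ b → ∀ᵐ t, t ∈ uIcc t₀ b → p t) :
    ∀ᵐ t ∂volume.restrict (Ici t₀), p t := by
  rw [ae_restrict_iff' measurableSet_Ici]
  have h' : ∀ᵐ t, ∀ k : ℕ, t ∈ uIcc t₀ (t₀ + k) → p t :=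
    ae_all_iff.2 fun k => h _ (by linarith [(Nat.cast_nonneg k : (0 : ℝ) ≤ k)])
  filter_upwards [h'] with t ht hmem
  obtain ⟨k, hk⟩ := exists_nat_ge (t - t₀)
  refine ht k ?_
  rw [uIcc_of_le (by linarith [(Nat.cast_nonneg k : (0 : ℝ) ≤ k)])]
  exact ⟨hmem, by linarith⟩

theorem ae_hasDerivAt_integral {g : ℝ → ℂ}
    (hg : ∀ b, t₀ ≤ b → IntervalIntegrable g volume t₀ b) :
    ∀ᵐ t ∂volume.restrict (Ici t₀), HasDerivAt (fun x => ∫ s in t₀..x, g s) (g t) t := by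
  refine ae_restrict_Ici_of_forall_Icc fun b hb => ?_
  filter_upwards [(hg b hb).ae_hasDerivAt_integral] with t ht hmem
  exact ht hmem t₀ (by simp)

/-- The fundamental theorem of calculus for absolutely continuous complex functions. -/
theorem eq_add_integral_of_ac {F g : ℝ → ℂ}
    (hF : ∀ b, t₀ ≤ b → AbsolutelyContinuousOnInterval F t₀ b)
    (hg : ∀ b, t₀ ≤ b → IntervalIntegrable g volume t₀ b)
    (hd : ∀ᵐ t ∂volume.restrict (Ici t₀), HasDerivWithinAt F (g t) (Ici t₀) t)
    {t : ℝ} (ht : t₀ ≤ t) : F t = F t₀ + ∫ s in t₀..t, g s := by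
  have hac := (hF t ht).sub (absolutelyContinuousOnInterval_integral (hg t ht))
  have hd' := ae_hasDerivAt_integral hg
  rw [ae_restrict_iff' measurableSet_Ici] at hd hd'
  obtain ⟨C, hC⟩ := hac.const_of_ae_hasDerivAt_zero (by
    have hne : ∀ᵐ x : ℝ, x ≠ t₀ := by simp [ae_iff, measure_singleton]
    filter_upwards [hd, hd', hne] with x h1 h2 h3 hx
    rw [uIcc_of_le ht] at hx
    have h4 := (h1 hx.1).hasDerivAt (Ici_mem_nhds (lt_of_le_of_ne hx.1 h3.symm))
    simpa using h4.sub (h2 hx.1))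
  have e1 := hC t₀ (by simp)
  have e2 := hC t (by simp)
  simp only [Pi.sub_apply, intervalIntegral.integral_same, sub_zero] at e1 e2
  rw [e1, ← e2]
  ring

/-- An almost everywhere derivative that is continuous is a classical one, since `F` is its
integral. Green integrals are differentiated in this way below the top order. -/
theorem hasDerivWithinAt_of_ac {F g : ℝ → ℂ}
    (hF : ∀ b, t₀ ≤ b → AbsolutelyContinuousOnInterval F t₀ b)
    (hg : ContinuousOn g (Ici t₀))
    (hd : ∀ᵐ t ∂volume.restrict (Ici t₀), HasDerivWithinAt F (g t) (Ici t₀) t)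
    {t : ℝ} (ht : t₀ ≤ t) : HasDerivWithinAt F (g t) (Ici t₀) t := by
  -- Extending `g` by a constant to the left of `t₀` allows the two-sided fundamental theorem at
  -- `t₀` as well.
  set G : ℝ → ℂ := fun s => g (max t₀ s) with hG
  have hGc : Continuous G :=
    hg.comp_continuous (by fun_prop) fun s => mem_Ici.2 (le_max_left _ _)
  have hGe : ∀ s, t₀ ≤ s → G s = g s := fun s hs => by simp [hG, max_eq_right hs]
  have hint : ∀ b, t₀ ≤ b → IntervalIntegrable g volume t₀ b := fun b hb =>
    (hg.mono (by rw [uIcc_of_le hb]; exact Icc_subset_Ici_self)).intervalIntegrable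
  have e : ∀ x ∈ Ici t₀, F x = F t₀ + ∫ s in t₀..x, G s := fun x hx => by
    rw [eq_add_integral_of_ac hF hint hd hx]
    congr 1
    refine intervalIntegral.integral_congr fun s hs => ?_
    rw [uIcc_of_le hx] at hs
    exact (hGe s hs.1).symm
  have h1 : HasDerivAt (fun x => F t₀ + ∫ s in t₀..x, G s) (G t) t :=
    (intervalIntegral.integral_hasDerivAt_right (hGc.intervalIntegrable _ _)
      (hGc.stronglyMeasurableAtFilter _ _) hGc.continuousAt).const_add _
  rw [← hGe t ht]
  exact h1.hasDerivWithinAt.congr e (e t ht)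

theorem continuousOn_Ici_of_ac {F : ℝ → ℂ}
    (hF : ∀ b, t₀ ≤ b → AbsolutelyContinuousOnInterval F t₀ b) : ContinuousOn F (Ici t₀) := by
  intro t ht
  have h := (hF (t + 1) (by linarith [mem_Ici.1 ht])).continuousOn
  rw [uIcc_of_le (by linarith [mem_Ici.1 ht])] at h
  refine (h t ⟨ht, by linarith⟩).mono_of_mem_nhdsWithin ?_
  rw [← Ici_inter_Iic]
  exact inter_mem_nhdsWithin _ (Iic_mem_nhds (by linarith))

/-- `F 0, …, F N, F (N + 1)` are the successive derivatives on `[t₀, ∞)` of a function of class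
`C ^ N` whose `N`-th derivative is locally absolutely continuous; the last derivative exists
almost everywhere. -/
structure IsJet (t₀ : ℝ) (N : ℕ) (F : ℕ → ℝ → ℂ) : Prop where
  deriv : ∀ i < N, ∀ t, t₀ ≤ t → HasDerivWithinAt (F i) (F (i + 1) t) (Ici t₀) t
  ac : ∀ i ≤ N, ∀ b, t₀ ≤ b → AbsolutelyContinuousOnInterval (F i) t₀ b
  ae_deriv : ∀ᵐ t ∂volume.restrict (Ici t₀), HasDerivWithinAt (F N) (F (N + 1) t) (Ici t₀) t

namespace IsJet

variable {N : ℕ} {F G : ℕ → ℝ → ℂ}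

theorem continuousOn (hF : IsJet t₀ N F) {i : ℕ} (hi : i ≤ N) : ContinuousOn (F i) (Ici t₀) :=
  continuousOn_Ici_of_ac (hF.ac i hi)

theorem iteratedDerivWithin_eq (hF : IsJet t₀ N F) {i : ℕ} (hi : i ≤ N) :
    EqOn (iteratedDerivWithin i (F 0) (Ici t₀)) (F i) (Ici t₀) := by
  induction i with
  | zero => intro t _; simp
  | succ i ih =>
    intro t ht
    rw [iteratedDerivWithin_succ, derivWithin_congr (ih (by omega)) (ih (by omega) ht)]
    exact (hF.deriv i (by omega) t ht).derivWithin (uniqueDiffOn_Ici t₀ t ht)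

theorem contDiffOn (hF : IsJet t₀ N F) :
    ContDiffOn ℝ (N : WithTop ℕ∞) (F 0) (Ici t₀) := by
  have : ContDiffOn ℝ ((N : ℕ∞) : WithTop ℕ∞) (F 0) (Ici t₀) := by
    refine contDiffOn_of_continuousOn_differentiableOn_deriv ?_ ?_
    · intro i hi
      have hi' : i ≤ N := by exact_mod_cast hi
      exact (hF.continuousOn hi').congr (hF.iteratedDerivWithin_eq hi')
    · intro i hi
      have hi' : i < N := by exact_mod_cast hi
      refine DifferentiableOn.congr (f := F i) (fun t ht => ?_)
        (hF.iteratedDerivWithin_eq hi'.le)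
      exact (hF.deriv i hi' t ht).differentiableWithinAt
  simpa using this

theorem ae_iteratedDerivWithin_succ_eq (hF : IsJet t₀ N F) :
    ∀ᵐ t ∂volume.restrict (Ici t₀),
      iteratedDerivWithin (N + 1) (F 0) (Ici t₀) t = F (N + 1) t := by
  filter_upwards [hF.ae_deriv, ae_restrict_mem measurableSet_Ici] with t h ht
  rw [iteratedDerivWithin_succ, derivWithin_congr (hF.iteratedDerivWithin_eq le_rfl)
    (hF.iteratedDerivWithin_eq le_rfl ht)]
  exact h.derivWithin (uniqueDiffOn_Ici t₀ t ht)

theorem sum {ι : Type*} (s : Finset ι) {F : ι → ℕ → ℝ → ℂ} (hF : ∀ q ∈ s, IsJet t₀ N (F q)) :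
    IsJet t₀ N (fun i t => ∑ q ∈ s, F q i t) where
  deriv i hi t ht := HasDerivWithinAt.fun_sum fun q hq => (hF q hq).deriv i hi t ht
  ac i hi b hb := absolutelyContinuousOnInterval_sum s fun q hq => (hF q hq).ac i hi b hb
  ae_deriv := by
    have h : ∀ᵐ t ∂volume.restrict (Ici t₀), ∀ q ∈ s,
        HasDerivWithinAt (F q N) (F q (N + 1) t) (Ici t₀) t :=
      (ae_ball_iff s.countable_toSet).2 fun q hq => (hF q hq).ae_deriv
    filter_upwards [h] with t ht
    exact HasDerivWithinAt.fun_sum fun q hq => ht q hq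

end IsJet

/-- The Leibniz product of two sequences of derivatives. -/
noncomputable def leibniz (F G : ℕ → ℝ → ℂ) (i : ℕ) (t : ℝ) : ℂ :=
  ∑ p ∈ Finset.HasAntidiagonal.antidiagonal i, (i.choose p.1 : ℂ) * (F p.1 t * G p.2 t)

/-- Pascal's rule merges the two halves of the product rule. The hypotheses concern the single point
`t`, so the lemma serves both everywhere and almost everywhere. -/
theorem hasDerivWithinAt_leibniz {F G : ℕ → ℝ → ℂ} {i : ℕ} {s : Set ℝ} {t : ℝ}
    (hF : ∀ k ≤ i, HasDerivWithinAt (F k) (F (k + 1) t) s t)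
    (hG : ∀ k ≤ i, HasDerivWithinAt (G k) (G (k + 1) t) s t) :
    HasDerivWithinAt (leibniz F G i) (leibniz F G (i + 1) t) s t := by
  have h : HasDerivWithinAt (leibniz F G i)
      (∑ p ∈ Finset.HasAntidiagonal.antidiagonal i, (i.choose p.1 : ℂ) *
        (F (p.1 + 1) t * G p.2 t + F p.1 t * G (p.2 + 1) t)) s t := by
    refine HasDerivWithinAt.fun_sum fun p hp => ?_
    rw [Finset.HasAntidiagonal.mem_antidiagonal] at hp
    exact ((hF p.1 (by omega)).mul (hG p.2 (by omega))).const_mul _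
  convert h using 1
  rw [leibniz, Finset.sum_antidiagonal_choose_succ_mul (fun a b => F a t * G b t) i,
    ← Finset.sum_add_distrib]
  refine Finset.sum_congr rfl fun p hp => ?_
  rw [Finset.HasAntidiagonal.mem_antidiagonal] at hp
  rw [show i.choose p.2 = i.choose p.1 by rw [← hp, Nat.choose_symm_add]]
  ring

theorem IsJet.leibniz {N : ℕ} {F G : ℕ → ℝ → ℂ} (hF : IsJet t₀ N F) (hG : IsJet t₀ N G) :
    IsJet t₀ N (leibniz F G) where
  deriv i hi t ht := hasDerivWithinAt_leibniz (fun k hk => hF.deriv k (by omega) t ht)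
    (fun k hk => hG.deriv k (by omega) t ht)
  ac i hi b hb := by
    refine absolutelyContinuousOnInterval_sum _ fun p hp => ?_
    rw [Finset.HasAntidiagonal.mem_antidiagonal] at hp
    exact (absolutelyContinuousOnInterval_const _ _ _).complex_mul
      ((hF.ac _ (by omega) b hb).complex_mul (hG.ac _ (by omega) b hb))
  ae_deriv := by
    filter_upwards [hF.ae_deriv, hG.ae_deriv, ae_restrict_mem measurableSet_Ici] with t h1 h2 ht
    refine hasDerivWithinAt_leibniz (fun k hk => ?_) (fun k hk => ?_)
    · rcases hk.lt_or_eq with hk | rfl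
      exacts [hF.deriv k hk t ht, h1]
    · rcases hk.lt_or_eq with hk | rfl
      exacts [hG.deriv k hk t ht, h2]

end PoincarePerron

/-! ### Green integrals: right inverses of `d/dt - γ`. -/

namespace PoincarePerron

open scoped ENNReal

variable {t₀ T δ q : ℝ} {γ : ℂ} {f : ℝ → ℂ}

/-- The kernel of a right inverse of `d/dt - γ`. For `Re γ < 0` it integrates from the base point
`T`, otherwise from infinity. -/
noncomputable def baseKer (T : ℝ) (γ : ℂ) (t s : ℝ) : ℂ :=
  if γ.re < 0 then
    if T < s ∧ s ≤ t then Complex.exp (γ * ((t : ℂ) - s))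
    else if t < s ∧ s ≤ T then -Complex.exp (γ * ((t : ℂ) - s)) else 0
  else if t < s then -Complex.exp (γ * ((t : ℂ) - s)) else 0

/-- The right inverse of `d/dt - γ` with kernel `baseKer`. -/
noncomputable def greenInt (t₀ T : ℝ) (γ : ℂ) (f : ℝ → ℂ) (t : ℝ) : ℂ :=
  ∫ s in Ici t₀, baseKer T γ t s * f s

theorem measurable_baseKer (T : ℝ) (γ : ℂ) :
    Measurable fun z : ℝ × ℝ => baseKer T γ z.1 z.2 := by
  have he : Measurable fun z : ℝ × ℝ => Complex.exp (γ * ((z.1 : ℂ) - z.2)) := by fun_prop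
  have hlt : MeasurableSet {z : ℝ × ℝ | z.1 < z.2} := measurableSet_lt measurable_fst measurable_snd
  have hle : MeasurableSet {z : ℝ × ℝ | z.2 ≤ z.1} := measurableSet_le measurable_snd measurable_fst
  have h1 : MeasurableSet {z : ℝ × ℝ | T < z.2} := measurableSet_lt measurable_const measurable_snd
  have h2 : MeasurableSet {z : ℝ × ℝ | z.2 ≤ T} := measurableSet_le measurable_snd measurable_const
  unfold baseKer
  split_ifs with h
  · exact Measurable.ite (h1.inter hle) he (Measurable.ite (hlt.inter h2) he.neg measurable_const)
  · exact Measurable.ite hlt he.neg measurable_const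

theorem norm_exp_mul_sub (γ : ℂ) (t s : ℝ) :
    ‖Complex.exp (γ * ((t : ℂ) - s))‖ = Real.exp (γ.re * (t - s)) := by
  rw [Complex.norm_exp]
  simp

/-- For `t ≥ T` the branch `t < s ≤ T` is void, so only decaying exponentials remain. The choice `δ
= 0` gives the bound `1`, valid also for `γ = 0`. -/
theorem enorm_baseKer_le_expKer (hγ : δ ≤ |γ.re|) {t : ℝ} (ht : T ≤ t) (s : ℝ) :
    ‖baseKer T γ t s‖ₑ ≤ expKer δ (t - s) := by
  rw [← ofReal_norm, expKer]
  refine ENNReal.ofReal_le_ofReal ?_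
  unfold baseKer
  split_ifs with h1 h2 h3 h4
  · rw [norm_exp_mul_sub, Real.exp_le_exp, abs_of_nonneg (by linarith)]
    rw [abs_of_neg h1] at hγ
    nlinarith
  · linarith [h3.1, h3.2]
  · simpa using (Real.exp_pos _).le
  · rw [norm_neg, norm_exp_mul_sub, Real.exp_le_exp, abs_of_neg (by linarith)]
    rw [abs_of_nonneg (by linarith)] at hγ
    nlinarith
  · simpa using (Real.exp_pos _).le

/-- On `[T, ∞)` a Green integral sees `f` on `(T, ∞)` only; by the next lemma, at `t < T` it sees
later times only. This is the backward Volterra structure. -/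
theorem baseKer_eq_zero {t s : ℝ} (ht : T ≤ t) (hs : s ≤ T) : baseKer T γ t s = 0 := by
  unfold baseKer
  split_ifs with h1 h2 h3 h4
  · linarith [h2.1]
  · linarith [h3.1]
  · rfl
  · linarith
  · rfl

theorem baseKer_eq_zero_of_lt {t s : ℝ} (ht : t < T) (hs : s ≤ t) : baseKer T γ t s = 0 := by
  unfold baseKer
  split_ifs with h1 h2 h3 h4
  · linarith [h2.1]
  · linarith [h3.1]
  · rfl
  · linarith
  · rfl

theorem norm_baseKer_le_of_lt {D : ℝ} (hD : |γ.re| ≤ D) {t s : ℝ} (ht₀ : t₀ ≤ t) (ht : t < T) :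
    ‖baseKer T γ t s‖ ≤ Real.exp (D * (T - t₀)) := by
  have hD0 : 0 ≤ D := (abs_nonneg _).trans hD
  have hDT : 0 ≤ D * (T - t₀) := mul_nonneg hD0 (by linarith)
  unfold baseKer
  split_ifs with h1 h2 h3 h4
  · linarith [h2.1]
  · rw [norm_neg, norm_exp_mul_sub, Real.exp_le_exp]
    rw [abs_of_neg h1] at hD
    nlinarith [h3.1, h3.2]
  · simpa using (Real.exp_pos _).le
  · rw [norm_neg, norm_exp_mul_sub, Real.exp_le_exp]
    nlinarith
  · simpa using (Real.exp_pos _).le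

/-- With base point `t₀` the two kernels can differ only at `s = t₀` and `s = t`, where the
inequalities are strict in one and weak in the other. -/
theorem greenKernel_eq_baseKer (hγ : γ.re ≠ 0) {t s : ℝ} (hs : t₀ < s) (hst : s ≠ t) :
    greenKernel γ t s = baseKer t₀ γ t s := by
  unfold greenKernel baseKer
  rcases lt_or_gt_of_ne hγ with h | h
  · rw [Real.sign_of_neg h, if_pos h]
    by_cases hs' : s ≤ t
    · rw [if_pos (by linarith [lt_of_le_of_ne hs' hst]), if_pos ⟨hs, hs'⟩]
      simp
    · rw [if_neg (by linarith), if_neg (fun h => hs' h.2), if_neg (fun h => by linarith [h.2])]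
  · rw [Real.sign_of_pos h, if_neg (by linarith : ¬ γ.re < 0)]
    by_cases hs' : t < s
    · rw [if_pos (by linarith), if_pos hs']
      simp
    · rw [if_neg (by linarith), if_neg hs']

theorem greenKernel_mul_ae_eq (hγ : γ.re ≠ 0) (f : ℝ → ℂ) (t : ℝ) :
    (fun s => greenKernel γ t s * f s) =ᵐ[volume.restrict (Ici t₀)]
      fun s => baseKer t₀ γ t s * f s := by
  have h1 : ∀ᵐ s : ℝ ∂volume.restrict (Ici t₀), s ≠ t₀ :=
    ae_restrict_of_ae (by simp [ae_iff, measure_singleton])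
  have h2 : ∀ᵐ s : ℝ ∂volume.restrict (Ici t₀), s ≠ t :=
    ae_restrict_of_ae (by simp [ae_iff, measure_singleton])
  filter_upwards [h1, h2, ae_restrict_mem measurableSet_Ici] with s h1 h2 h3
  rw [greenKernel_eq_baseKer hγ (lt_of_le_of_ne h3 h1.symm) h2]

theorem scalarGreen_eq_greenInt (hγ : γ.re ≠ 0) (f : ℝ → ℂ) (t : ℝ) :
    scalarGreen t₀ γ f t = greenInt t₀ t₀ γ f t :=
  integral_congr_ae (greenKernel_mul_ae_eq hγ f t)

theorem intervalIntegrable_of_memLp (hq : 1 ≤ q)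
    (hf : MemLp f (ENNReal.ofReal q) (volume.restrict (Ici t₀))) {b : ℝ} (hb : t₀ ≤ b) :
    IntervalIntegrable f volume t₀ b := by
  rw [intervalIntegrable_iff_integrableOn_Icc_of_le hb]
  have h := hf.mono_measure (Measure.restrict_mono_set volume
    (Icc_subset_Ici_self : Icc t₀ b ⊆ Ici t₀))
  exact h.integrable (by simpa using hq)

theorem enorm_greenInt_le (hγ : δ ≤ |γ.re|) {t : ℝ} (ht : T ≤ t) (f : ℝ → ℂ) :
    ‖greenInt t₀ T γ f t‖ₑ ≤ ∫⁻ s in Ici t₀, expKer δ (t - s) * ‖f s‖ₑ := by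
  refine (enorm_integral_le_lintegral_enorm _).trans (lintegral_mono fun s => ?_)
  rw [enorm_mul]
  exact mul_le_mul' (enorm_baseKer_le_expKer hγ ht s) le_rfl

theorem measurable_baseKer_right (T : ℝ) (γ : ℂ) (t : ℝ) : Measurable (baseKer T γ t) :=
  (measurable_baseKer T γ).comp (measurable_const.prodMk measurable_id)

theorem integrable_baseKer_mul (hγ : γ.re ≠ 0) (hq : 1 ≤ q)
    (hf : MemLp f (ENNReal.ofReal q) (volume.restrict (Ici t₀))) {t : ℝ} (ht : T ≤ t) :
    IntegrableOn (fun s => baseKer T γ t s * f s) (Ici t₀) := by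
  refine ⟨(measurable_baseKer_right T γ t).aestronglyMeasurable.mul hf.1, ?_⟩
  obtain ⟨M, hM, h⟩ := exists_lintegral_expKer_mul_enorm_le (abs_pos.2 hγ) hq hf
  refine lt_of_le_of_lt ((lintegral_mono fun s => ?_).trans (h t)) hM.lt_top
  rw [enorm_mul]
  exact mul_le_mul' (enorm_baseKer_le_expKer le_rfl ht s) le_rfl

/-- The integrability that makes `greenInt t₀ T γ f` converge: local integrability of `f`, and
integrability of `exp (-γ s) f s` if the integral extends to infinity. -/
structure GreenIntegrable (t₀ : ℝ) (γ : ℂ) (f : ℝ → ℂ) : Prop where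
  loc : ∀ b, t₀ ≤ b → IntervalIntegrable f volume t₀ b
  tail : ¬ γ.re < 0 → IntegrableOn (fun s : ℝ => Complex.exp (-(γ * s)) * f s) (Ici t₀)

theorem GreenIntegrable.of_memLp (hγ : γ.re ≠ 0) (hq : 1 ≤ q)
    (hf : MemLp f (ENNReal.ofReal q) (volume.restrict (Ici t₀))) : GreenIntegrable t₀ γ f where
  loc _ hb := intervalIntegrable_of_memLp hq hf hb
  tail h := by
    have h1 := (integrable_baseKer_mul hγ hq hf (le_refl t₀)).const_mul
      (-Complex.exp (-(γ * t₀)))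
    refine h1.congr ?_
    have h2 : ∀ᵐ s : ℝ ∂volume.restrict (Ici t₀), s ≠ t₀ :=
      ae_restrict_of_ae (by simp [ae_iff, measure_singleton])
    filter_upwards [h2, ae_restrict_mem measurableSet_Ici] with s hs hs'
    rw [baseKer, if_neg h, if_pos (lt_of_le_of_ne hs' hs.symm), ← mul_assoc, neg_mul_neg,
      ← Complex.exp_add]
    congr 2
    ring

theorem GreenIntegrable.of_integrable_zero (hf : IntegrableOn f (Ici t₀)) :
    GreenIntegrable t₀ 0 f where
  loc b hb := by
    rw [intervalIntegrable_iff_integrableOn_Icc_of_le hb]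
    exact hf.mono_set Icc_subset_Ici_self
  tail _ := by simpa using hf

theorem intervalIntegrable_exp_mul (γ : ℂ) {a b : ℝ} (hf : IntervalIntegrable f volume a b) :
    IntervalIntegrable (fun s : ℝ => Complex.exp (-(γ * s)) * f s) volume a b :=
  hf.continuousOn_mul (Continuous.continuousOn (by fun_prop))

/-- Variation of constants. -/
theorem GreenIntegrable.exists_greenInt_eq (hT : t₀ ≤ T) (hf : GreenIntegrable t₀ γ f) :
    ∃ c : ℂ, ∀ t, t₀ ≤ t → greenInt t₀ T γ f t =
      Complex.exp (γ * t) * (c + ∫ s in t₀..t, Complex.exp (-(γ * s)) * f s) := by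
  have hexp : ∀ t s : ℝ, Complex.exp (γ * ((t : ℂ) - s)) * f s =
      Complex.exp (γ * t) * (Complex.exp (-(γ * s)) * f s) := fun t s => by
    rw [← mul_assoc, ← Complex.exp_add]
    congr 2
    ring
  have hi : ∀ b, t₀ ≤ b →
      IntervalIntegrable (fun s : ℝ => Complex.exp (-(γ * s)) * f s) volume t₀ b :=
    fun b hb => intervalIntegrable_exp_mul γ (hf.loc b hb)
  by_cases h : γ.re < 0
  -- This constant makes the primitive of `exp (-γ s) f s` start at `T`.
  · refine ⟨-∫ s in t₀..T, Complex.exp (-(γ * s)) * f s, fun t ht => ?_⟩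
    rw [neg_add_eq_sub, intervalIntegral.integral_interval_sub_left (hi t ht) (hi T hT),
      ← intervalIntegral.integral_const_mul]
    simp only [← hexp]
    rcases le_or_gt T t with hTt | hTt
    · rw [intervalIntegral.integral_of_le hTt, greenInt,
        ← inter_eq_self_of_subset_right (Ioc_subset_Icc_self.trans
          (Icc_subset_Ici_self.trans (Ici_subset_Ici.2 hT)) : Ioc T t ⊆ Ici t₀),
        ← setIntegral_indicator measurableSet_Ioc]
      refine integral_congr_ae (Eventually.of_forall fun s => ?_)
      simp only [baseKer, if_pos h, indicator, mem_Ioc]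
      split_ifs with h1 h2
      · rfl
      · linarith [h2.1]
      · simp
    · rw [intervalIntegral.integral_of_ge hTt.le, greenInt, ← integral_neg,
        ← inter_eq_self_of_subset_right (Ioc_subset_Icc_self.trans
          (Icc_subset_Ici_self.trans (Ici_subset_Ici.2 ht)) : Ioc t T ⊆ Ici t₀),
        ← setIntegral_indicator measurableSet_Ioc]
      refine integral_congr_ae (Eventually.of_forall fun s => ?_)
      simp only [baseKer, if_pos h, indicator, mem_Ioc]
      split_ifs with h1 h2 h2
      · linarith [h1.1]
      · linarith [h1.1]
      · simp
      · simp
  -- This constant turns the integral from `t₀` to `t` into minus the tail from `t` to infinity.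
  · refine ⟨-∫ s in Ioi t₀, Complex.exp (-(γ * s)) * f s, fun t ht => ?_⟩
    have hI := (hf.tail h).mono_set (Ioi_subset_Ici_self (a := t₀))
    rw [← intervalIntegral.integral_interval_add_Ioi hI (hI.mono_set (Ioi_subset_Ioi ht)),
      neg_add_rev, neg_add_cancel_right, mul_neg, ← integral_const_mul, ← integral_neg]
    simp only [← hexp]
    rw [greenInt, ← inter_eq_self_of_subset_right (Ioi_subset_Ici ht : Ioi t ⊆ Ici t₀),
        ← setIntegral_indicator measurableSet_Ioi]
    refine integral_congr_ae (Eventually.of_forall fun s => ?_)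
    simp only [baseKer, if_neg h, indicator, mem_Ioi]
    split_ifs with h1
    · simp
    · simp

theorem GreenIntegrable.ac_greenInt (hT : t₀ ≤ T) (hf : GreenIntegrable t₀ γ f) (b : ℝ)
    (hb : t₀ ≤ b) : AbsolutelyContinuousOnInterval (greenInt t₀ T γ f) t₀ b := by
  obtain ⟨c, hc⟩ := hf.exists_greenInt_eq hT
  have h1 : AbsolutelyContinuousOnInterval (fun t : ℝ => Complex.exp (γ * t)) t₀ b := by
    have : ContDiff ℝ 1 (fun t : ℝ => Complex.exp (γ * t)) :=
      (contDiff_const.mul Complex.ofRealCLM.contDiff).cexp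
    exact this.contDiffOn.absolutelyContinuousOnInterval
  have h2 := absolutelyContinuousOnInterval_integral (intervalIntegrable_exp_mul γ (hf.loc b hb))
  refine (h1.complex_mul ((absolutelyContinuousOnInterval_const c t₀ b).add h2)).congr
    fun t ht => ?_
  rw [uIcc_of_le hb] at ht
  exact (hc t ht.1).symm

theorem GreenIntegrable.ae_hasDerivWithinAt_greenInt (hT : t₀ ≤ T) (hf : GreenIntegrable t₀ γ f) :
    ∀ᵐ t ∂volume.restrict (Ici t₀), HasDerivWithinAt (greenInt t₀ T γ f)
      (γ * greenInt t₀ T γ f t + f t) (Ici t₀) t := by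
  obtain ⟨c, hc⟩ := hf.exists_greenInt_eq hT
  filter_upwards [ae_hasDerivAt_integral fun b hb => intervalIntegrable_exp_mul γ (hf.loc b hb),
    ae_restrict_mem measurableSet_Ici] with t ht ht'
  have h1 : HasDerivAt (fun t : ℝ => Complex.exp (γ * t)) (Complex.exp (γ * t) * γ) t := by
    have := ((hasDerivAt_id t).ofReal_comp.const_mul γ).cexp
    simpa using this
  have h2 := (h1.mul (ht.const_add c)).hasDerivWithinAt (s := Ici t₀)
  refine (h2.congr (fun s hs => hc s hs) (hc t ht')).congr_deriv ?_
  rw [hc t ht', ← mul_assoc (Complex.exp (γ * t)) (Complex.exp _), ← Complex.exp_add]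
  simp
  ring

theorem GreenIntegrable.continuousOn_greenInt (hT : t₀ ≤ T) (hf : GreenIntegrable t₀ γ f) :
    ContinuousOn (greenInt t₀ T γ f) (Ici t₀) :=
  continuousOn_Ici_of_ac (hf.ac_greenInt hT)

theorem memLp_greenInt (hγ : γ.re ≠ 0) (hq : 1 ≤ q)
    (hf : MemLp f (ENNReal.ofReal q) (volume.restrict (Ici t₀))) :
    MemLp (greenInt t₀ t₀ γ f) (ENNReal.ofReal q) (volume.restrict (Ici t₀)) := by
  have hq0 : 0 < q := by linarith
  refine ⟨((GreenIntegrable.of_memLp hγ hq hf).continuousOn_greenInt le_rfl).aestronglyMeasurable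
    measurableSet_Ici, ?_⟩
  rw [eLpNorm_lt_top_iff_lintegral_rpow_enorm_lt_top (by simpa using hq0) (by simp),
    ENNReal.toReal_ofReal hq0.le]
  refine lt_of_le_of_lt (setLIntegral_mono' measurableSet_Ici fun t ht => ?_)
    (lintegral_rpow_lintegral_expKer_ne_top (abs_pos.2 hγ) hq hf).lt_top
  exact ENNReal.rpow_le_rpow (enorm_greenInt_le le_rfl ht f) hq0.le

theorem memLp_top_greenInt (hγ : γ.re ≠ 0) (hq : 1 ≤ q)
    (hf : MemLp f (ENNReal.ofReal q) (volume.restrict (Ici t₀))) :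
    MemLp (greenInt t₀ t₀ γ f) ∞ (volume.restrict (Ici t₀)) := by
  obtain ⟨M, hM, h⟩ := exists_lintegral_expKer_mul_enorm_le (abs_pos.2 hγ) hq hf
  refine memLp_top_of_bound (((GreenIntegrable.of_memLp hγ hq hf).continuousOn_greenInt
    le_rfl).aestronglyMeasurable measurableSet_Ici) M.toReal ?_
  filter_upwards [ae_restrict_mem measurableSet_Ici] with t ht
  have := (enorm_greenInt_le le_rfl ht f).trans (h t)
  rw [← toReal_enorm]
  exact ENNReal.toReal_mono hM this

theorem tendsto_greenInt (hγ : γ.re ≠ 0) (hq : 1 ≤ q)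
    (hf : MemLp f (ENNReal.ofReal q) (volume.restrict (Ici t₀))) :
    Tendsto (greenInt t₀ T γ f) atTop (𝓝 0) := by
  rw [tendsto_zero_iff_enorm_tendsto_zero]
  refine tendsto_of_tendsto_of_tendsto_of_le_of_le' tendsto_const_nhds
    (tendsto_lintegral_expKer_mul_enorm (abs_pos.2 hγ) hq hf)
    (Eventually.of_forall fun _ => zero_le) ?_
  filter_upwards [eventually_ge_atTop T] with t ht
  exact enorm_greenInt_le le_rfl ht f

/-- For `γ = 0` the Green integral is minus the tail of `∫ f`, so `f ∈ L¹` takes the place of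
exponential decay. -/
theorem tendsto_greenInt_zero (hf : IntegrableOn f (Ici t₀)) :
    Tendsto (greenInt t₀ T 0 f) atTop (𝓝 0) := by
  have := tendsto_integral_filter_of_dominated_convergence (l := atTop)
    (μ := volume.restrict (Ici t₀)) (F := fun t s => baseKer T 0 t s * f s) (f := fun _ => 0)
    (fun s => ‖f s‖) (Eventually.of_forall fun t =>
      (measurable_baseKer_right T 0 t).aestronglyMeasurable.mul hf.1)
    (Eventually.of_forall fun t => Eventually.of_forall fun s => ?_) hf.norm
    (Eventually.of_forall fun s => ?_)
  · rw [integral_zero] at this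
    exact this
  · rw [norm_mul]
    have h : ‖baseKer T 0 t s‖ ≤ 1 := by
      unfold baseKer
      split_ifs <;> simp_all
    exact mul_le_of_le_one_left (norm_nonneg _) h
  · refine tendsto_const_nhds.congr' ?_
    filter_upwards [eventually_ge_atTop s] with t ht
    simp [baseKer, not_lt.2 ht]

end PoincarePerron

/-! ### Neumann series in weighted `L¹`, and the weight. -/

namespace PoincarePerron

open scoped ENNReal

/-- Schur test in `L¹` with a weight: an integral operator that contracts the weighted `L¹` norm
has a resolvent. -/
theorem exists_integrable_eq_add_integral {α : Type*} [MeasurableSpace α] {μ : Measure α}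
    [SFinite μ] {κ : α → α → ℂ} (hκ : AEStronglyMeasurable (fun z : α × α => κ z.1 z.2) (μ.prod μ))
    {w : α → ℝ≥0∞} (hw : AEMeasurable w μ) (hw1 : ∀ᵐ t ∂μ, 1 ≤ w t) {W : ℝ≥0∞} (hW : W ≠ ∞)
    (hwW : ∀ᵐ t ∂μ, w t ≤ W)
    (hκw : ∀ᵐ s ∂μ, ∫⁻ t, w t * ‖κ t s‖ₑ ∂μ ≤ 2⁻¹ * w s)
    {R : α → ℂ} (hR : Integrable R μ) :
    ∃ f : α → ℂ, Integrable f μ ∧ ∀ᵐ t ∂μ, f t = R t + ∫ s, κ t s * f s ∂μ := by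
  -- The terms of the Neumann series: `F 0 = R`, and each term is the integral operator applied to
  -- the previous one.
  set F : ℕ → α → ℂ := fun k => Nat.rec R (fun _ g t => ∫ s, κ t s * g s ∂μ) k with hF
  have hF0 : F 0 = R := rfl
  have hFs : ∀ k t, F (k + 1) t = ∫ s, κ t s * F k s ∂μ := fun k t => rfl
  have hprod : ∀ {g : α → ℂ}, AEStronglyMeasurable g μ →
      AEStronglyMeasurable (fun z : α × α => κ z.1 z.2 * g z.2) (μ.prod μ) :=
    fun hg => hκ.mul hg.comp_snd
  have hFm : ∀ k, AEStronglyMeasurable (F k) μ := by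
    intro k
    induction k with
    | zero => exact hR.1
    | succ k ih => exact (hprod ih).integral_prod_right'
  set A := ∫⁻ t, w t * ‖R t‖ₑ ∂μ with hA
  have hAfin : A ≠ ∞ := by
    refine ne_top_of_le_ne_top (ENNReal.mul_ne_top hW hR.2.ne) ?_
    rw [← lintegral_const_mul' _ _ hW]
    refine lintegral_mono_ae ?_
    filter_upwards [hwW] with t ht
    exact mul_le_mul' ht le_rfl
  -- By Tonelli and the column bound `hκw`, the weighted norm is at least halved at each step.
  have hN : ∀ k, ∫⁻ t, w t * ∫⁻ s, ‖κ t s * F k s‖ₑ ∂μ ∂μ ≤ 2⁻¹ * ∫⁻ t, w t * ‖F k t‖ₑ ∂μ := by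
    intro k
    have hm : AEMeasurable (fun z : α × α => w z.1 * ‖κ z.1 z.2 * F k z.2‖ₑ) (μ.prod μ) :=
      hw.comp_fst.mul (hprod (hFm k)).enorm
    have h1 : ∀ᵐ t ∂μ, w t * ∫⁻ s, ‖κ t s * F k s‖ₑ ∂μ =
        ∫⁻ s, w t * ‖κ t s * F k s‖ₑ ∂μ := by
      filter_upwards [(hprod (hFm k)).prodMk_left] with t ht
      rw [lintegral_const_mul'' _ ht.enorm]
    rw [lintegral_congr_ae h1, lintegral_lintegral_swap hm,
      ← lintegral_const_mul' _ _ (by simp)]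
    refine lintegral_mono_ae ?_
    filter_upwards [hκw] with s hs
    calc ∫⁻ t, w t * ‖κ t s * F k s‖ₑ ∂μ
        = (∫⁻ t, w t * ‖κ t s‖ₑ ∂μ) * ‖F k s‖ₑ := by
          rw [← lintegral_mul_const' _ _ enorm_ne_top]
          simp only [enorm_mul, mul_assoc]
      _ ≤ (2⁻¹ * w s) * ‖F k s‖ₑ := mul_le_mul' hs le_rfl
      _ = _ := mul_assoc _ _ _
  have hFw : ∀ k, ∫⁻ t, w t * ‖F k t‖ₑ ∂μ ≤ 2⁻¹ ^ k * A := by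
    intro k
    induction k with
    | zero => simp [hF0, hA]
    | succ k ih =>
      refine (lintegral_mono fun t => ?_).trans ((hN k).trans ?_)
      · exact mul_le_mul' le_rfl ((hFs k t).symm ▸ enorm_integral_le_lintegral_enorm _)
      · rw [pow_succ', mul_assoc]
        exact mul_le_mul' le_rfl ih
  have hgeo : ∑' k, 2⁻¹ ^ k * A ≠ ∞ := by
    rw [ENNReal.tsum_mul_right, ENNReal.tsum_geometric]
    refine ENNReal.mul_ne_top ?_ hAfin
    simp
  -- Because `w ≥ 1`, summability in the weighted norm gives absolute convergence in `L¹`; the upper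
  -- bound on `w` served to make the first norm finite.
  have hle : ∀ {g : α → ℝ≥0∞}, ∫⁻ t, g t ∂μ ≤ ∫⁻ t, w t * g t ∂μ := by
    intro g
    refine lintegral_mono_ae ?_
    filter_upwards [hw1] with t ht
    simpa using mul_le_mul' ht (le_refl (g t))
  have hsumF : ∫⁻ t, ∑' k, ‖F k t‖ₑ ∂μ ≠ ∞ := by
    rw [lintegral_tsum fun k => (hFm k).enorm]
    exact ne_top_of_le_ne_top hgeo (ENNReal.tsum_le_tsum fun k => hle.trans (hFw k))
  have hKm : ∀ k, AEMeasurable (fun t => ∫⁻ s, ‖κ t s * F k s‖ₑ ∂μ) μ := fun k =>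
    (hprod (hFm k)).enorm.lintegral_prod_right'
  have hsumK : ∫⁻ t, ∑' k, ∫⁻ s, ‖κ t s * F k s‖ₑ ∂μ ∂μ ≠ ∞ := by
    rw [lintegral_tsum hKm]
    refine ne_top_of_le_ne_top hgeo (ENNReal.tsum_le_tsum fun k => hle.trans ((hN k).trans ?_))
    refine le_trans ?_ (hFw k)
    exact mul_le_of_le_one_left zero_le (by simp)
  have hae := ae_lt_top' (AEMeasurable.tsum fun k => (hFm k).enorm) hsumF
  have hsummable : ∀ᵐ t ∂μ, Summable fun k => F k t := by
    filter_upwards [hae] with t ht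
    have h1 : Summable fun k => ‖F k t‖ := by
      have h2 := ENNReal.summable_toReal ht.ne
      simpa only [toReal_enorm] using h2
    exact h1.of_norm
  refine ⟨fun t => ∑' k, F k t, ⟨?_, ?_⟩, ?_⟩
  · refine aestronglyMeasurable_of_tendsto_ae atTop
      (f := fun (N : ℕ) t => ∑ k ∈ Finset.range N, F k t)
      (fun N => Finset.aestronglyMeasurable_fun_sum _ fun k _ => hFm k) ?_
    filter_upwards [hsummable] with t ht
    exact ht.hasSum.tendsto_sum_nat
  · refine lt_of_le_of_lt (lintegral_mono_ae ?_) hsumF.lt_top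
    filter_upwards with t
    exact enorm_tsum_le_tsum_enorm
  · have hmk : ∀ᵐ t ∂μ, ∀ k, AEStronglyMeasurable (fun s => κ t s * F k s) μ :=
      ae_all_iff.2 fun k => (hprod (hFm k)).prodMk_left
    filter_upwards [hsummable, ae_lt_top' (AEMeasurable.tsum hKm) hsumK, hmk] with t h1 h2 h3
    rw [h1.tsum_eq_zero_add, hF0]
    congr 1
    simp only [hFs, ← tsum_mul_left]
    exact (integral_tsum h3 h2.ne).symm

theorem tendsto_lintegral_Ici {t₀ : ℝ} {h : ℝ → ℝ≥0∞}
    (hh : AEMeasurable h (volume.restrict (Ici t₀))) (hfin : ∫⁻ s in Ici t₀, h s ≠ ∞) :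
    Tendsto (fun T => ∫⁻ s in Ici T, h s) atTop (𝓝 0) := by
  have := tendsto_lintegral_filter_of_dominated_convergence' (l := atTop)
    (μ := volume.restrict (Ici t₀)) (F := fun T => (Ici T).indicator h) (f := fun _ => 0) h
    (Eventually.of_forall fun t => hh.indicator measurableSet_Ici)
    (Eventually.of_forall fun t => Eventually.of_forall fun s => indicator_le_self _ _ _)
    hfin (Eventually.of_forall fun s => ?_)
  · rw [lintegral_zero] at this
    refine this.congr' ?_
    filter_upwards [eventually_ge_atTop t₀] with T hT
    rw [setLIntegral_indicator measurableSet_Ici,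
      inter_eq_self_of_subset_left (Ici_subset_Ici.2 hT)]
  · refine tendsto_const_nhds.congr' ?_
    filter_upwards [eventually_gt_atTop s] with T hT
    simp [hT]

/-- The column bound for an `L^q` coefficient: the integration runs over the variable of `f`, and
the result is uniform in `s`. Hölder bounds it by the `L^q` norm of `f` on `[T, ∞)`. -/
theorem eventually_lintegral_Ici_expKer_mul_le {t₀ δ q : ℝ} {f : ℝ → ℂ} (hδ : 0 < δ) (hq : 1 ≤ q)
    (hf : MemLp f (ENNReal.ofReal q) (volume.restrict (Ici t₀))) {η : ℝ≥0∞} (hη : 0 < η) :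
    ∀ᶠ T in atTop, ∀ s, ∫⁻ t in Ici T, expKer δ (t - s) * ‖f t‖ₑ ≤ η := by
  have hq0 : 0 < q := by linarith
  have h1 := tendsto_lintegral_Ici (hf.1.enorm.pow_const q) (lintegral_enorm_rpow_ne_top hq hf)
  have hC : (∫⁻ x, expKer δ x) ^ (q - 1) ≠ ∞ :=
    ENNReal.rpow_ne_top_of_nonneg (by linarith) (lintegral_expKer_lt_top hδ).ne
  have h2 := (ENNReal.Tendsto.const_mul h1 (Or.inr hC)).ennrpow_const (1 / q)
  rw [mul_zero, ENNReal.zero_rpow_of_pos (by positivity)] at h2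
  filter_upwards [(tendsto_order.1 h2).2 η hη, eventually_ge_atTop t₀] with T hT hT₀ s
  refine le_trans ?_ hT.le
  have hm : AEMeasurable (fun s => ‖f s‖ₑ) (volume.restrict (Ici T)) :=
    hf.1.enorm.mono_measure (Measure.restrict_mono_set volume (Ici_subset_Ici.2 hT₀))
  rw [one_div, ENNReal.le_rpow_inv_iff hq0]
  have e : ∀ t, expKer δ (t - s) = expKer δ (s - t) := fun t => by
    rw [← expKer_neg, neg_sub]
  simp only [e]
  refine (lintegral_expKer_mul_rpow_le δ s hq (Ici T) hm).trans ?_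
  refine mul_le_mul' le_rfl (lintegral_mono fun t => ?_)
  simpa using mul_le_mul' (expKer_le_one hδ.le (s - t)) (le_refl (‖f t‖ₑ ^ q))

/-- An exponential weight that is constant beyond `T`. -/
noncomputable def expWeight (t₀ T c : ℝ) (Q : ℝ → ℝ) (t : ℝ) : ℝ :=
  Real.exp (c * ∫ s in t₀..min t T, Q s)

section expWeight

variable {t₀ T c : ℝ} {Q : ℝ → ℝ}

theorem monotoneOn_integral (hQ : ∀ t, 0 ≤ Q t)
    (hQi : ∀ b, t₀ ≤ b → IntervalIntegrable Q volume t₀ b) :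
    MonotoneOn (fun t => ∫ s in t₀..t, Q s) (Ici t₀) := fun _ ha b hb hab =>
  intervalIntegral.integral_mono_interval le_rfl ha hab (Eventually.of_forall hQ) (hQi b hb)

theorem monotoneOn_expWeight (hT : t₀ ≤ T) (hc : 0 ≤ c) (hQ : ∀ t, 0 ≤ Q t)
    (hQi : ∀ b, t₀ ≤ b → IntervalIntegrable Q volume t₀ b) :
    MonotoneOn (expWeight t₀ T c Q) (Ici t₀) := fun a ha b hb hab => by
  refine Real.exp_le_exp.2 (mul_le_mul_of_nonneg_left ?_ hc)
  exact monotoneOn_integral hQ hQi (le_min ha hT) (le_min hb hT) (min_le_min_right T hab)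

theorem expWeight_eq_of_ge {t : ℝ} (ht : T ≤ t) : expWeight t₀ T c Q t = expWeight t₀ T c Q T := by
  simp [expWeight, ht]

theorem one_le_expWeight (hT : t₀ ≤ T) (hc : 0 ≤ c) (hQ : ∀ t, 0 ≤ Q t)
    (hQi : ∀ b, t₀ ≤ b → IntervalIntegrable Q volume t₀ b) {t : ℝ} (ht : t₀ ≤ t) :
    1 ≤ expWeight t₀ T c Q t := by
  have := monotoneOn_expWeight hT hc hQ hQi (self_mem_Ici (a := t₀)) ht ht
  simpa [expWeight, hT] using this

/-- Before `min s T` the integrand is the derivative of the weight, so the integral is at most the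
value of the weight at the right end. -/
theorem lintegral_expWeight_mul_le (hc : 0 ≤ c) (hQ : ∀ t, 0 ≤ Q t)
    (hQi : ∀ b, t₀ ≤ b → IntervalIntegrable Q volume t₀ b) {s : ℝ} (hs : t₀ ≤ min s T) :
    ∫⁻ t in Ico t₀ (min s T), ENNReal.ofReal (expWeight t₀ T c Q t) * ENNReal.ofReal (c * Q t) ≤
      ENNReal.ofReal (expWeight t₀ T c Q s) := by
  set b := min s T with hb
  set h : ℝ → ℝ := fun t => Real.exp (c * ∫ s in t₀..t, Q s) with hh
  have hmono : MonotoneOn h (uIcc t₀ b) := by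
    rw [uIcc_of_le hs]
    intro x hx y hy hxy
    exact Real.exp_le_exp.2 (mul_le_mul_of_nonneg_left
      (monotoneOn_integral hQ hQi hx.1 hy.1 hxy) hc)
  have hderiv : ∀ᵐ t, t ∈ uIcc t₀ b → deriv h t = h t * (c * Q t) := by
    filter_upwards [(hQi b hs).ae_hasDerivAt_integral] with t ht hmem
    exact ((ht hmem t₀ (by simp)).const_mul c).exp.deriv
  -- For a monotone function the integral of the derivative is at most the increment, and only this
  -- inequality is needed.
  have h1 := hmono.intervalIntegral_deriv_mem_uIcc
  have h2 := hmono.intervalIntegrable_deriv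
  rw [uIcc_of_le (by linarith [hmono (by simp) (by simp) hs] : 0 ≤ h b - h t₀)] at h1
  rw [intervalIntegrable_iff_integrableOn_Ico_of_le hs] at h2
  rw [uIcc_of_le hs] at hderiv
  have e : ∀ᵐ t ∂volume.restrict (Ico t₀ b),
      ENNReal.ofReal (expWeight t₀ T c Q t) * ENNReal.ofReal (c * Q t) =
        ENNReal.ofReal (deriv h t) := by
    rw [ae_restrict_iff' measurableSet_Ico]
    filter_upwards [hderiv] with t ht hmem
    rw [ht (Ico_subset_Icc_self hmem), ENNReal.ofReal_mul (Real.exp_pos _).le, expWeight,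
      min_eq_left (hmem.2.le.trans (min_le_right _ _))]
  have hnn : ∀ᵐ t ∂volume.restrict (Ico t₀ b), 0 ≤ deriv h t := by
    rw [ae_restrict_iff' measurableSet_Ico]
    filter_upwards [hderiv] with t ht hmem
    rw [ht (Ico_subset_Icc_self hmem)]
    exact mul_nonneg (Real.exp_pos _).le (mul_nonneg hc (hQ t))
  rw [lintegral_congr_ae e, ← ofReal_integral_eq_lintegral_ofReal h2 hnn,
    integral_Ico_eq_integral_Ioo, ← integral_Ioc_eq_integral_Ioo,
    ← intervalIntegral.integral_of_le hs]
  refine ENNReal.ofReal_le_ofReal (h1.2.trans ?_)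
  have : 0 ≤ h t₀ := (Real.exp_pos _).le
  change h b - h t₀ ≤ h b
  linarith

end expWeight

end PoincarePerron

/-! ### The perturbed integral equation. -/

namespace PoincarePerron

open scoped ENNReal

theorem norm_baseKer_le {t₀ T D : ℝ} {γ : ℂ} (hD : |γ.re| ≤ D) (hT : t₀ ≤ T) {t : ℝ} (ht : t₀ ≤ t)
    (s : ℝ) : ‖baseKer T γ t s‖ ≤ Real.exp (D * (T - t₀)) := by
  rcases lt_or_ge t T with h | h
  · exact norm_baseKer_le_of_lt hD ht h
  · have h1 := enorm_baseKer_le_expKer (γ := γ) (abs_nonneg _) h s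
    have h2 : ‖baseKer T γ t s‖ₑ ≤ 1 := h1.trans (expKer_le_one le_rfl _)
    have h3 : ‖baseKer T γ t s‖ ≤ 1 := by
      rw [← toReal_enorm]
      simpa using ENNReal.toReal_mono ENNReal.one_ne_top h2
    exact h3.trans (Real.one_le_exp (mul_nonneg ((abs_nonneg _).trans hD) (by linarith)))

theorem integrable_baseKer_mul_of_integrable {t₀ T : ℝ} (γ : ℂ) (hT : t₀ ≤ T) {f : ℝ → ℂ}
    (hf : IntegrableOn f (Ici t₀)) {t : ℝ} (ht : t₀ ≤ t) :
    IntegrableOn (fun s => baseKer T γ t s * f s) (Ici t₀) :=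
  hf.bdd_mul (measurable_baseKer_right T γ t).aestronglyMeasurable
    (Eventually.of_forall (norm_baseKer_le le_rfl hT ht))

variable {ι : Type*} [Fintype ι]

/-- An `L¹` solution `f` of `f = q₀ - ∑ₖ qₖ ∑ⱼ d k j G_{γ j} f` with `q₀ ∈ L¹` and `qₖ ∈ Lᵖ`. -/
theorem exists_integrable_perturbed {t₀ p : ℝ} {n : ℕ} {γ : ι → ℂ} {i₀ : ι}
    (hγ : ∀ j, j ≠ i₀ → (γ j).re ≠ 0) {d : ℕ → ι → ℂ} (hd : ∀ k, k ≠ 0 → d k i₀ = 0)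
    {q : ℕ → ℝ → ℂ} (hp : 1 ≤ p) (hq₀ : IntegrableOn (q 0) (Ici t₀))
    (hq : ∀ k, k ≠ 0 → k < n → MemLp (q k) (ENNReal.ofReal p) (volume.restrict (Ici t₀))) :
    ∃ T, t₀ ≤ T ∧ ∃ f : ℝ → ℂ, IntegrableOn f (Ici t₀) ∧
      ∀ᵐ t ∂volume.restrict (Ici t₀), f t = q 0 t -
        ∑ k ∈ Finset.range n, q k t * ∑ j, d k j * greenInt t₀ T (γ j) f t := by
  classical
  -- The gap between the imaginary axis and the exponents other than `γ i₀`; if there are none, any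
  -- positive number will do.
  obtain ⟨δ, hδ, hδγ⟩ : ∃ δ : ℝ, 0 < δ ∧ ∀ j, j ≠ i₀ → δ ≤ |(γ j).re| := by
    rcases (Finset.univ.erase i₀).eq_empty_or_nonempty with h | h
    · refine ⟨1, one_pos, fun j hj => ?_⟩
      have : j ∈ Finset.univ.erase i₀ := by simp [hj]
      rw [h] at this
      simp at this
    · obtain ⟨j, hj, hmin⟩ := Finset.exists_min_image _ (fun j => |(γ j).re|) h
      exact ⟨|(γ j).re|, abs_pos.2 (hγ j (Finset.ne_of_mem_erase hj)),
        fun k hk => hmin k (by simp [hk])⟩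
  set D : ℝ := ∑ j, |(γ j).re| with hDdef
  have hD : ∀ j, |(γ j).re| ≤ D := fun j =>
    Finset.single_le_sum (f := fun j => |(γ j).re|) (fun _ _ => abs_nonneg _) (Finset.mem_univ j)
  set A : ℝ := ∑ k ∈ Finset.range n, ∑ j, ‖d k j‖ with hA
  have hA0 : 0 ≤ A := Finset.sum_nonneg fun _ _ => Finset.sum_nonneg fun _ _ => norm_nonneg _
  have hAe : ∑ k ∈ Finset.range n, ∑ j, ‖d k j‖ₑ = ENNReal.ofReal A := by
    rw [hA, ENNReal.ofReal_sum_of_nonneg fun _ _ => Finset.sum_nonneg fun _ _ => norm_nonneg _]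
    refine Finset.sum_congr rfl fun k _ => ?_
    rw [ENNReal.ofReal_sum_of_nonneg fun _ _ => norm_nonneg _]
    exact Finset.sum_congr rfl fun j _ => (ofReal_norm _).symm
  set η : ℝ≥0∞ := ENNReal.ofReal (1 / (4 * (A + 1))) with hη
  have hη0 : 0 < η := ENNReal.ofReal_pos.2 (by positivity)
  have hAη : ENNReal.ofReal A * η ≤ 4⁻¹ := by
    rw [hη, ← ENNReal.ofReal_mul hA0, show (4⁻¹ : ℝ≥0∞) = ENNReal.ofReal (1 / 4) by
      rw [one_div, ENNReal.ofReal_inv_of_pos (by norm_num)]; simp]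
    refine ENNReal.ofReal_le_ofReal ?_
    rw [mul_one_div, div_le_div_iff₀ (by positivity) (by norm_num)]
    linarith
  have hqm : ∀ k, k < n → AEStronglyMeasurable (q k) (volume.restrict (Ici t₀)) := fun k hk => by
    by_cases h : k = 0
    · exact h ▸ hq₀.1
    · exact (hq k h hk).1
  obtain ⟨T, hT, hT0, hTk⟩ : ∃ T, t₀ ≤ T ∧ ∫⁻ s in Ici T, ‖q 0 s‖ₑ ≤ η ∧
      ∀ k < n, k ≠ 0 → ∀ s, ∫⁻ t in Ici T, expKer δ (t - s) * ‖q k t‖ₑ ≤ η := by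
    have h1 : ∀ᶠ T in atTop, ∫⁻ s in Ici T, ‖q 0 s‖ₑ < η :=
      (tendsto_order.1 (tendsto_lintegral_Ici hq₀.1.enorm hq₀.2.ne)).2 η hη0
    have h2 : ∀ᶠ T in atTop, ∀ k ∈ Finset.range n, k ≠ 0 →
        ∀ s, ∫⁻ t in Ici T, expKer δ (t - s) * ‖q k t‖ₑ ≤ η := by
      rw [Filter.eventually_all_finset]
      intro k hk
      by_cases h : k = 0
      · exact Eventually.of_forall fun _ h' => absurd h h'
      · filter_upwards [eventually_lintegral_Ici_expKer_mul_le hδ hp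
          (hq k h (Finset.mem_range.1 hk)) hη0] with T hT _ using hT
    obtain ⟨T, ⟨h1, h2⟩, h3⟩ := ((h1.and h2).and (eventually_ge_atTop t₀)).exists
    exact ⟨T, h3, h1.le, fun k hk => h2 k (Finset.mem_range.2 hk)⟩
  set M : ℝ := Real.exp (D * (T - t₀)) with hM
  have hM0 : 0 < M := Real.exp_pos _
  -- The rate of the weight is chosen so that before `T` the kernel is at most `(1/4) c Q(t)` on `t
  -- < s`; hence that part contributes at most a quarter of `w s`.
  set c : ℝ := 4 * (A * M) with hc
  have hc0 : 0 ≤ c := by positivity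
  set Q : ℝ → ℝ := fun t => ∑ k ∈ Finset.range n, ‖q k t‖ with hQ
  have hQ0 : ∀ t, 0 ≤ Q t := fun t => Finset.sum_nonneg fun _ _ => norm_nonneg _
  have hQi : ∀ b, t₀ ≤ b → IntervalIntegrable Q volume t₀ b := fun b hb => by
    have h1 : ∀ k ∈ Finset.range n, IntervalIntegrable (fun t => ‖q k t‖) volume t₀ b := by
      intro k hk
      refine IntervalIntegrable.norm ?_
      by_cases h : k = 0
      · rw [h, intervalIntegrable_iff_integrableOn_Icc_of_le hb]
        exact hq₀.mono_set Icc_subset_Ici_self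
      · exact intervalIntegrable_of_memLp hp (hq k h (Finset.mem_range.1 hk)) hb
    have h2 := IntervalIntegrable.sum (Finset.range n) h1
    have h3 : Q = ∑ k ∈ Finset.range n, fun t => ‖q k t‖ := by
      ext t
      simp [hQ]
    rwa [h3]
  set w : ℝ → ℝ≥0∞ := fun t => ENNReal.ofReal (expWeight t₀ T c Q t) with hw
  have hmono := monotoneOn_expWeight (T := T) hT hc0 hQ0 hQi
  set κ : ℝ → ℝ → ℂ := fun t s =>
    -∑ k ∈ Finset.range n, q k t * ∑ j, d k j * baseKer T (γ j) t s with hκ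
  have hκm : AEStronglyMeasurable (fun z : ℝ × ℝ => κ z.1 z.2)
      ((volume.restrict (Ici t₀)).prod (volume.restrict (Ici t₀))) := by
    refine (Finset.aestronglyMeasurable_fun_sum _ fun k hk => ?_).neg
    refine (hqm k (Finset.mem_range.1 hk)).comp_fst.mul ?_
    refine Finset.aestronglyMeasurable_fun_sum _ fun j _ => ?_
    exact aestronglyMeasurable_const.mul (measurable_baseKer T (γ j)).aestronglyMeasurable
  have hκ_lt : ∀ t s, t₀ ≤ t → t < T → ‖κ t s‖ₑ ≤
      4⁻¹ * (Ioi t).indicator (fun _ => ENNReal.ofReal (c * Q t)) s := by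
    intro t s ht htT
    by_cases hs : t < s
    · rw [indicator_of_mem (by exact hs), ← ofReal_norm,
        show (4⁻¹ : ℝ≥0∞) = ENNReal.ofReal (1 / 4) by
          rw [one_div, ENNReal.ofReal_inv_of_pos (by norm_num)]; simp,
        ← ENNReal.ofReal_mul (by norm_num)]
      refine ENNReal.ofReal_le_ofReal ?_
      rw [hκ, norm_neg]
      calc ‖∑ k ∈ Finset.range n, q k t * ∑ j, d k j * baseKer T (γ j) t s‖
          ≤ ∑ k ∈ Finset.range n, Q t * ∑ j, ‖d k j‖ * M := by
            refine norm_sum_le_of_le _ fun k hk => ?_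
            rw [norm_mul]
            refine mul_le_mul ?_ (norm_sum_le_of_le _ fun j _ => ?_) (norm_nonneg _) (hQ0 t)
            · exact Finset.single_le_sum (f := fun k => ‖q k t‖) (fun _ _ => norm_nonneg _) hk
            · rw [norm_mul]
              exact mul_le_mul_of_nonneg_left (norm_baseKer_le_of_lt (hD j) ht htT) (norm_nonneg _)
        _ = Q t * (A * M) := by
            simp only [← Finset.mul_sum, ← Finset.sum_mul, hA]
        _ = 1 / 4 * (c * Q t) := by rw [hc]; ring
    · rw [indicator_of_notMem (by exact hs)]
      simp [hκ, baseKer_eq_zero_of_lt htT (not_lt.1 hs)]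
  have hκ_ge : ∀ s, ∫⁻ t in Ici T, ‖κ t s‖ₑ ≤ 4⁻¹ := by
    intro s
    have hqm' : ∀ k < n, AEMeasurable (fun t => ‖q k t‖ₑ) (volume.restrict (Ici T)) :=
      fun k hk => (hqm k hk).enorm.mono_measure
        (Measure.restrict_mono_set volume (Ici_subset_Ici.2 hT))
    have hbm : ∀ j, Measurable fun t => ‖baseKer T (γ j) t s‖ₑ := fun j =>
      ((measurable_baseKer T (γ j)).comp (measurable_id.prodMk measurable_const)).enorm
    have hterm : ∀ k < n, ∀ j, ∫⁻ t in Ici T, ‖d k j‖ₑ * (‖q k t‖ₑ * ‖baseKer T (γ j) t s‖ₑ) ≤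
        ‖d k j‖ₑ * η := by
      intro k hk j
      rw [lintegral_const_mul' _ _ enorm_ne_top]
      -- For `k = 0` the kernel is bounded by `1` and `q 0` is integrable. For `k ≠ 0` either `j =
      -- i₀`, where `d k i₀ = 0`, or the kernel decays exponentially.
      by_cases hk0 : k = 0
      · refine mul_le_mul' le_rfl (le_trans (setLIntegral_mono' measurableSet_Ici fun t ht => ?_)
          hT0)
        rw [hk0]
        refine mul_le_of_le_one_right zero_le ?_
        exact (enorm_baseKer_le_expKer (abs_nonneg _) ht s).trans (expKer_le_one le_rfl _)
      · by_cases hj : j = i₀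
        · rw [hj, hd k hk0]
          simp
        · refine mul_le_mul' le_rfl (le_trans (setLIntegral_mono' measurableSet_Ici
            fun t ht => ?_) (hTk k hk hk0 s))
          rw [mul_comm]
          exact mul_le_mul' (enorm_baseKer_le_expKer (hδγ j hj) ht s) le_rfl
    calc ∫⁻ t in Ici T, ‖κ t s‖ₑ
        ≤ ∫⁻ t in Ici T, ∑ k ∈ Finset.range n, ∑ j,
            ‖d k j‖ₑ * (‖q k t‖ₑ * ‖baseKer T (γ j) t s‖ₑ) := by
          refine lintegral_mono fun t => ?_
          simp only [hκ, enorm_neg]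
          refine (enorm_sum_le _ _).trans (Finset.sum_le_sum fun k _ => ?_)
          rw [Finset.mul_sum]
          refine (enorm_sum_le _ _).trans (Finset.sum_le_sum fun j _ => ?_)
          rw [enorm_mul, enorm_mul, mul_left_comm]
      _ = ∑ k ∈ Finset.range n, ∑ j,
            ∫⁻ t in Ici T, ‖d k j‖ₑ * (‖q k t‖ₑ * ‖baseKer T (γ j) t s‖ₑ) := by
          have hm : ∀ k ∈ Finset.range n, ∀ j, AEMeasurable
              (fun t => ‖d k j‖ₑ * (‖q k t‖ₑ * ‖baseKer T (γ j) t s‖ₑ))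
              (volume.restrict (Ici T)) := fun k hk j =>
            ((hqm' k (Finset.mem_range.1 hk)).mul (hbm j).aemeasurable).const_mul _
          rw [lintegral_finsetSum' _ fun k hk => Finset.aemeasurable_fun_sum _ fun j _ => hm k hk j]
          exact Finset.sum_congr rfl fun k hk => lintegral_finsetSum' _ fun j _ => hm k hk j
      _ ≤ ∑ k ∈ Finset.range n, ∑ j, ‖d k j‖ₑ * η :=
          Finset.sum_le_sum fun k hk => Finset.sum_le_sum fun j _ =>
            hterm k (Finset.mem_range.1 hk) j
      _ = ENNReal.ofReal A * η := by rw [← hAe]; simp only [Finset.sum_mul]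
      _ ≤ 4⁻¹ := hAη
  have hκw : ∀ᵐ s ∂volume.restrict (Ici t₀),
      ∫⁻ t in Ici t₀, w t * ‖κ t s‖ₑ ≤ 2⁻¹ * w s := by
    filter_upwards [ae_restrict_mem measurableSet_Ici] with s hs
    have hsplit : ∫⁻ t in Ici t₀, w t * ‖κ t s‖ₑ =
        (∫⁻ t in Ico t₀ T, w t * ‖κ t s‖ₑ) + ∫⁻ t in Ici T, w t * ‖κ t s‖ₑ := by
      rw [← Ico_union_Ici_eq_Ici hT, lintegral_union measurableSet_Ici]
      exact Set.disjoint_left.2 fun x hx hx' => absurd hx.2 (not_lt.2 hx')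
    have h1 : ∫⁻ t in Ico t₀ T, w t * ‖κ t s‖ₑ ≤ 4⁻¹ * w s := by
      calc ∫⁻ t in Ico t₀ T, w t * ‖κ t s‖ₑ
          ≤ ∫⁻ t in Ico t₀ T, (Ico t₀ (min s T)).indicator
              (fun t => 4⁻¹ * (w t * ENNReal.ofReal (c * Q t))) t := by
            refine setLIntegral_mono' measurableSet_Ico fun t ht => ?_
            refine (mul_le_mul' le_rfl (hκ_lt t s ht.1 ht.2)).trans ?_
            by_cases hts : t < s
            · rw [indicator_of_mem (by exact hts),
                indicator_of_mem (by exact ⟨ht.1, lt_min hts ht.2⟩), mul_left_comm]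
            · rw [indicator_of_notMem (by exact hts)]
              simp
        _ = ∫⁻ t in Ico t₀ (min s T), 4⁻¹ * (w t * ENNReal.ofReal (c * Q t)) := by
            rw [setLIntegral_indicator measurableSet_Ico, inter_eq_self_of_subset_left
              (Ico_subset_Ico_right (min_le_right _ _))]
        _ ≤ 4⁻¹ * w s := by
            rw [lintegral_const_mul' _ _ (by simp)]
            exact mul_le_mul' le_rfl (lintegral_expWeight_mul_le hc0 hQ0 hQi (le_min hs hT))
    -- For `s ≤ T` the kernel vanishes; for `s > T` the weight is constant on the range and factors
    -- out. Both regions give a quarter, and the sum is the required half.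
    have h2 : ∫⁻ t in Ici T, w t * ‖κ t s‖ₑ ≤ 4⁻¹ * w s := by
      rcases le_or_gt s T with hsT | hsT
      · refine le_trans (le_of_eq ?_) zero_le
        rw [← lintegral_zero (μ := volume.restrict (Ici T))]
        refine setLIntegral_congr_fun measurableSet_Ici fun t ht => ?_
        simp [hκ, baseKer_eq_zero ht hsT]
      · have e : ∫⁻ t in Ici T, w t * ‖κ t s‖ₑ = w s * ∫⁻ t in Ici T, ‖κ t s‖ₑ := by
          rw [← lintegral_const_mul' _ _ (by simp [hw])]
          refine setLIntegral_congr_fun measurableSet_Ici fun t ht => ?_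
          simp only [hw]
          rw [expWeight_eq_of_ge ht, expWeight_eq_of_ge hsT.le]
        rw [e, mul_comm]
        exact mul_le_mul' (hκ_ge s) le_rfl
    rw [hsplit]
    refine (add_le_add h1 h2).trans (le_of_eq ?_)
    rw [← add_mul]
    congr 1
    rw [← two_mul, show (4 : ℝ≥0∞) = 2 * 2 by norm_num, ENNReal.mul_inv (by simp) (by simp),
      ← mul_assoc, ENNReal.mul_inv_cancel (by simp) (by simp), one_mul]
  obtain ⟨f, hf, hfe⟩ := exists_integrable_eq_add_integral hκm
    ((aemeasurable_restrict_of_monotoneOn measurableSet_Ici hmono).ennreal_ofReal)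
    (by
      filter_upwards [ae_restrict_mem measurableSet_Ici] with t ht
      rw [← ENNReal.ofReal_one]
      exact ENNReal.ofReal_le_ofReal (one_le_expWeight hT hc0 hQ0 hQi ht))
    (W := w T) (by simp [hw])
    (by
      filter_upwards [ae_restrict_mem measurableSet_Ici] with t ht
      rcases le_total t T with h | h
      · exact ENNReal.ofReal_le_ofReal (hmono ht hT h)
      · exact ENNReal.ofReal_le_ofReal (expWeight_eq_of_ge h).le)
    hκw hq₀
  refine ⟨T, hT, f, hf, ?_⟩
  filter_upwards [hfe, ae_restrict_mem measurableSet_Ici] with t ht htt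
  rw [ht, sub_eq_add_neg]
  congr 1
  have hi : ∀ j, IntegrableOn (fun s => baseKer T (γ j) t s * f s) (Ici t₀) := fun j =>
    integrable_baseKer_mul_of_integrable (γ j) hT hf htt
  have e : ∀ s, κ t s * f s =
      -∑ k ∈ Finset.range n, q k t * ∑ j, d k j * (baseKer T (γ j) t s * f s) := by
    intro s
    simp only [hκ, neg_mul, Finset.sum_mul, mul_assoc]
  simp only [e, greenInt]
  rw [integral_neg, integral_finsetSum _ fun k _ =>
    (integrable_finsetSum _ fun j _ => (hi j).const_mul (d k j)).const_mul (q k t)]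
  congr 1
  refine Finset.sum_congr rfl fun k _ => ?_
  rw [integral_const_mul, integral_finsetSum _ fun j _ => (hi j).const_mul (d k j)]
  congr 1
  exact Finset.sum_congr rfl fun j _ => integral_const_mul _ _

end PoincarePerron

/-! ### The calculus of orders. -/

namespace PoincarePerron

open scoped ENNReal

section Order

variable {α : Type*} [MeasurableSpace α] {μ : Measure α} {P : ℝ≥0∞}

/-- Interpolation: `|f|^b ≤ ‖f‖_∞^(b-a) |f|^a`. The exponent `a` may be below `1`, as it is for
functions of order greater than `p`. -/
theorem memLp_of_memLp_top {f : α → ℂ} {a b : ℝ≥0∞} (ha : a ≠ 0) (hf : MemLp f a μ)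
    (hf' : MemLp f ∞ μ) (hab : a ≤ b) : MemLp f b μ := by
  by_cases hb : b = ∞
  · rwa [hb]
  have ha' : a ≠ ∞ := ne_top_of_le_ne_top hb hab
  have hb0 : b ≠ 0 := (lt_of_lt_of_le (pos_iff_ne_zero.2 ha) hab).ne'
  refine ⟨hf.1, ?_⟩
  have h := hf.2
  rw [eLpNorm_lt_top_iff_lintegral_rpow_enorm_lt_top ha ha'] at h
  rw [eLpNorm_lt_top_iff_lintegral_rpow_enorm_lt_top hb0 hb]
  have hC := hf'.2
  rw [eLpNorm_exponent_top] at hC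
  have hle : a.toReal ≤ b.toReal := ENNReal.toReal_mono hb hab
  refine lt_of_le_of_lt (b := ∫⁻ t, eLpNormEssSup f μ ^ (b.toReal - a.toReal) *
    ‖f t‖ₑ ^ a.toReal ∂μ) (lintegral_mono_ae ?_) ?_
  · filter_upwards [ae_le_eLpNormEssSup (f := f) (μ := μ)] with t ht
    calc ‖f t‖ₑ ^ b.toReal = ‖f t‖ₑ ^ ((b.toReal - a.toReal) + a.toReal) := by ring_nf
      _ = ‖f t‖ₑ ^ (b.toReal - a.toReal) * ‖f t‖ₑ ^ a.toReal :=
        ENNReal.rpow_add_of_nonneg _ _ (by linarith) ENNReal.toReal_nonneg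
      _ ≤ _ := mul_le_mul' (ENNReal.rpow_le_rpow ht (by linarith)) le_rfl
  · have hC' : eLpNormEssSup f μ ^ (b.toReal - a.toReal) ≠ ∞ :=
      ENNReal.rpow_ne_top_of_nonneg (by linarith) hC.ne
    rw [lintegral_const_mul' _ _ hC']
    exact ENNReal.mul_lt_top hC'.lt_top h

/-- Functions of order `c`: bounded and in `L ^ (P / c)`. -/
def IsOrder (μ : Measure α) (P : ℝ≥0∞) (c : ℕ) (f : α → ℂ) : Prop :=
  MemLp f (P / c) μ ∧ MemLp f ∞ μ

theorem holderTriple_div (hP : P ≠ 0) (hP' : P ≠ ∞) (c d : ℕ) :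
    ENNReal.HolderTriple (P / c) (P / d) (P / (c + d : ℕ)) := by
  constructor
  rw [ENNReal.inv_div (Or.inr hP') (Or.inr hP), ENNReal.inv_div (Or.inr hP') (Or.inr hP),
    ENNReal.inv_div (Or.inr hP') (Or.inr hP), ← ENNReal.add_div]
  push_cast
  rfl

namespace IsOrder

variable {c d : ℕ} {f g : α → ℂ}

theorem add (hf : IsOrder μ P c f) (hg : IsOrder μ P c g) :
    IsOrder μ P c (fun t => f t + g t) :=
  ⟨hf.1.add hg.1, hf.2.add hg.2⟩

theorem const_mul (a : ℂ) (hf : IsOrder μ P c f) : IsOrder μ P c (fun t => a * f t) :=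
  ⟨hf.1.const_mul a, hf.2.const_mul a⟩

theorem zero : IsOrder μ P c (fun _ => (0 : ℂ)) := ⟨MemLp.zero', MemLp.zero'⟩

theorem sum {ι : Type*} (s : Finset ι) {f : ι → α → ℂ} (hf : ∀ i ∈ s, IsOrder μ P c (f i)) :
    IsOrder μ P c (fun t => ∑ i ∈ s, f i t) :=
  ⟨memLp_finsetSum s fun i hi => (hf i hi).1, memLp_finsetSum s fun i hi => (hf i hi).2⟩

/-- Since `P / 0 = ∞`, order zero means essentially bounded. -/
theorem const (hP : P ≠ 0) (a : ℂ) : IsOrder μ P 0 (fun _ => a) := by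
  have h : MemLp (fun _ : α => a) ∞ μ := memLp_top_const a
  exact ⟨by simpa [ENNReal.div_zero hP] using h, h⟩

theorem mul (hP : P ≠ 0) (hP' : P ≠ ∞) (hf : IsOrder μ P c f) (hg : IsOrder μ P d g) :
    IsOrder μ P (c + d) (fun t => f t * g t) := by
  have := holderTriple_div hP hP' c d
  exact ⟨hg.1.mul' hf.1, hg.2.mul' hf.2⟩

theorem mono (hP : P ≠ 0) (hcd : c ≤ d) (hf : IsOrder μ P d f) : IsOrder μ P c f := by
  refine ⟨memLp_of_memLp_top (ENNReal.div_pos hP (by simp)).ne' hf.1 hf.2 ?_, hf.2⟩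
  exact ENNReal.div_le_div_left (by exact_mod_cast hcd) P

theorem memLp (hP : P ≠ 0) (hc : 1 ≤ c) (hf : IsOrder μ P c f) : MemLp f P μ := by
  simpa using (hf.mono hP hc).1

theorem integrable (hP : P ≠ 0) (hc : P ≤ c) (hf : IsOrder μ P c f) : Integrable f μ := by
  rw [← memLp_one_iff_integrable]
  exact memLp_of_memLp_top (ENNReal.div_pos hP (by simp)).ne' hf.1 hf.2
    (ENNReal.div_le_of_le_mul (by simpa using hc))

/-- The coefficients `r` need not be bounded, so the product gains one order of integrability but no
bound. -/
theorem memLp_mul (hP : P ≠ 0) (hP' : P ≠ ∞) {r : α → ℂ} (hr : MemLp r P μ)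
    (hf : IsOrder μ P c f) : MemLp (fun t => r t * f t) (P / (c + 1 : ℕ)) μ := by
  have := holderTriple_div hP hP' 1 c
  rw [add_comm]
  have hr' : MemLp r (P / (1 : ℕ)) μ := by simpa using hr
  exact hf.1.mul' hr'

theorem integrable_mul (hP1 : 1 ≤ P) (hP' : P ≠ ∞) {r : α → ℂ} (hr : MemLp r P μ)
    (hc : P ≤ (c + 1 : ℕ)) (hf : IsOrder μ P c f) : Integrable (fun t => r t * f t) μ := by
  have hP : P ≠ 0 := (lt_of_lt_of_le one_pos hP1).ne'
  rw [← memLp_one_iff_integrable]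
  -- Hölder with the exponent conjugate to `P`; the condition `P ≤ c + 1` says exactly that `P / c`
  -- does not exceed it, so `f` lies in the conjugate space.
  have : ENNReal.HolderTriple P (1 - P⁻¹)⁻¹ 1 := by
    constructor
    rw [inv_inv, inv_one, add_tsub_cancel_of_le (ENNReal.inv_le_one.2 hP1)]
  refine MemLp.mul' (q := (1 - P⁻¹)⁻¹) (p := P)
    (memLp_of_memLp_top (ENNReal.div_pos hP (by simp)).ne' hf.1 hf.2 ?_) hr
  rw [ENNReal.le_inv_iff_le_inv, ENNReal.inv_div (Or.inr hP') (Or.inr hP), tsub_le_iff_right,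
    ← one_div, ← ENNReal.add_div, ENNReal.le_div_iff_mul_le (Or.inl hP) (Or.inl hP'), one_mul]
  exact_mod_cast hc

end IsOrder

/-- Polynomials in a bookkeeping variable, of bounded degree, whose coefficient of degree `c` is of
order `c`. -/
def gradedSubalgebra (μ : Measure α) (P : ℝ≥0∞) (hP : P ≠ 0) (hP' : P ≠ ∞) :
    Subalgebra ℂ (α → Polynomial ℂ) where
  carrier := {Φ | (∃ N, ∀ t, (Φ t).natDegree ≤ N) ∧ ∀ c, IsOrder μ P c fun t => (Φ t).coeff c}
  mul_mem' := by
    rintro Φ Ψ ⟨⟨N, hN⟩, hΦ⟩ ⟨⟨N', hN'⟩, hΨ⟩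
    refine ⟨⟨N + N', fun t => Polynomial.natDegree_mul_le.trans (add_le_add (hN t) (hN' t))⟩,
      fun c => ?_⟩
    simp only [Pi.mul_apply, Polynomial.coeff_mul]
    refine IsOrder.sum _ fun x hx => ?_
    rw [Finset.HasAntidiagonal.mem_antidiagonal] at hx
    rw [← hx]
    exact (hΦ x.1).mul hP hP' (hΨ x.2)
  add_mem' := by
    rintro Φ Ψ ⟨⟨N, hN⟩, hΦ⟩ ⟨⟨N', hN'⟩, hΨ⟩
    refine ⟨⟨max N N', fun t => (Polynomial.natDegree_add_le _ _).trans
      (max_le_max (hN t) (hN' t))⟩, fun c => ?_⟩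
    simp only [Pi.add_apply, Polynomial.coeff_add]
    exact (hΦ c).add (hΨ c)
  algebraMap_mem' := by
    intro a
    refine ⟨⟨0, fun t => by simp⟩, fun c => ?_⟩
    simp only [Pi.algebraMap_apply, Polynomial.algebraMap_eq, Polynomial.coeff_C]
    split_ifs with h
    · rw [h]
      exact IsOrder.const hP a
    · exact IsOrder.zero

theorem aeval_mem_gradedSubalgebra {σ : Type*} (hP : P ≠ 0) (hP' : P ≠ ∞)
    {x : σ → α → Polynomial ℂ} (hx : ∀ j, x j ∈ gradedSubalgebra μ P hP hP')
    (p : MvPolynomial σ ℂ) :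
    (fun t => MvPolynomial.aeval (fun j => x j t) p) ∈ gradedSubalgebra μ P hP hP' := by
  have h1 : MvPolynomial.aeval x p ∈ gradedSubalgebra μ P hP hP' := by
    have h2 : Algebra.adjoin ℂ (range x) ≤ gradedSubalgebra μ P hP hP' :=
      Algebra.adjoin_le (by rintro _ ⟨j, rfl⟩; exact hx j)
    refine h2 ?_
    rw [Algebra.adjoin_range_eq_range_aeval]
    exact ⟨p, rfl⟩
  convert h1 using 1
  funext t
  exact (MvPolynomial.comp_aeval_apply x (Pi.evalAlgHom ℂ (fun _ : α => Polynomial ℂ) t) p).symm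

end Order

/-! ### Bell polynomials and truncation in the bookkeeping variable. -/

section Bell

open MvPolynomial

theorem bell_zero : bell 0 = 1 := by rw [bell]

theorem bell_succ (i : ℕ) : bell (i + 1) =
    ∑ j ∈ Finset.range (i + 1), C ((i.choose j : ℕ) : ℂ) * bell (i - j) * X j := by
  rw [bell, Finset.sum_range]

theorem bell_succ_sub (i : ℕ) : bell (i + 1) - X i =
    ∑ j ∈ Finset.range i, C ((i.choose j : ℕ) : ℂ) * bell (i - j) * X j := by
  rw [bell_succ, Finset.sum_range_succ]
  simp [bell_zero]

theorem vars_bell (i : ℕ) : ((bell i).vars : Set ℕ) ⊆ Iio i := by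
  induction i using Nat.strong_induction_on with
  | _ i ih =>
    cases i with
    | zero => simp [bell_zero]
    | succ i =>
      intro v hv
      rw [bell_succ] at hv
      obtain ⟨j, hj, hv⟩ := Finset.mem_biUnion.1 (vars_sum_subset _ _ hv)
      rw [Finset.mem_range] at hj
      rcases Finset.mem_union.1 (vars_mul _ _ hv) with h | h
      · rcases Finset.mem_union.1 (vars_mul _ _ h) with h | h
        · rw [vars_C] at h
          exact absurd h (Finset.notMem_empty v)
        · have := ih (i - j) (by omega) h
          exact mem_Iio.2 (by have := mem_Iio.1 this; omega)
      · rw [vars_X, Finset.mem_singleton] at h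
        exact mem_Iio.2 (by omega)

/-- Subtracting `X i` removes the only occurrence of the top variable. Hence the nonlinear terms
never use a derivative of `φ` beyond order `n - 2`. -/
theorem vars_bell_succ_sub (i : ℕ) : ((bell (i + 1) - X i).vars : Set ℕ) ⊆ Iio i := by
  intro v hv
  rw [bell_succ_sub] at hv
  obtain ⟨j, hj, hv⟩ := Finset.mem_biUnion.1 (vars_sum_subset _ _ hv)
  rw [Finset.mem_range] at hj
  rcases Finset.mem_union.1 (vars_mul _ _ hv) with h | h
  · rcases Finset.mem_union.1 (vars_mul _ _ h) with h | h
    · rw [vars_C] at h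
      exact absurd h (Finset.notMem_empty v)
    · have := mem_Iio.1 (vars_bell _ h)
      exact mem_Iio.2 (by omega)
  · rw [vars_X, Finset.mem_singleton] at h
    exact mem_Iio.2 (by omega)

theorem vars_bellPart (k i : ℕ) : ((bellPart k i).vars : Set ℕ) ⊆ Iio i := by
  intro v hv
  refine vars_bell_succ_sub i ?_
  rw [Finset.mem_coe, mem_vars_iff_mem_support] at hv ⊢
  obtain ⟨d, hd, hvd⟩ := hv
  refine ⟨d, ?_, hvd⟩
  rw [bellPart, support_homogeneousComponent] at hd
  exact Finset.mem_of_mem_filter _ hd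

theorem constantCoeff_bell (i : ℕ) : constantCoeff (bell (i + 1)) = 0 := by
  rw [bell_succ]
  simp

theorem totalDegree_bell_le (i : ℕ) : (bell i).totalDegree ≤ i := by
  induction i using Nat.strong_induction_on with
  | _ i ih =>
    cases i with
    | zero => simp [bell_zero]
    | succ i =>
      rw [bell_succ]
      refine totalDegree_finsetSum_le fun j hj => ?_
      rw [Finset.mem_range] at hj
      refine (totalDegree_mul _ _).trans ?_
      have h1 := totalDegree_mul (C ((i.choose j : ℕ) : ℂ)) (bell (i - j))
      have h2 := ih (i - j) (by omega)
      rw [totalDegree_C] at h1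
      rw [totalDegree_X]
      omega

/-- Each summand left after the subtraction is a variable times a `B_{i-j}` with `j < i`, which has
no constant term. -/
theorem bellPart_eq_zero_of_le_one {k : ℕ} (hk : k ≤ 1) (i : ℕ) : bellPart k i = 0 := by
  ext d
  rw [bellPart, coeff_homogeneousComponent, coeff_zero]
  split_ifs with hd
  · rw [bell_succ_sub, coeff_sum]
    refine Finset.sum_eq_zero fun j hj => ?_
    rw [Finset.mem_range] at hj
    rw [mul_assoc, coeff_C_mul, coeff_mul_X']
    split_ifs with hjd
    · have : d - Finsupp.single j 1 = 0 := by
        rw [← Finsupp.degree_eq_zero_iff]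
        have h1 : Finsupp.single j 1 ≤ d := by
          rw [Finsupp.single_le_iff]
          exact Nat.one_le_iff_ne_zero.2 (Finsupp.mem_support_iff.1 hjd)
        have h2 := congrArg Finsupp.degree (tsub_add_cancel_of_le h1)
        rw [map_add, Finsupp.degree_single] at h2
        omega
      rw [this, ← constantCoeff_eq, show i - j = (i - j - 1) + 1 by omega, constantCoeff_bell,
        mul_zero]
    · simp
  · rfl

theorem bell_eq_add_sum_bellPart (i : ℕ) :
    bell (i + 1) = X i + ∑ k ∈ Finset.Icc 2 (i + 1), bellPart k i := by
  have h1 : (bell (i + 1) - X i).totalDegree ≤ i + 1 := by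
    refine (totalDegree_sub _ _).trans (max_le (totalDegree_bell_le _) ?_)
    rw [totalDegree_X]
    omega
  have h2 : bell (i + 1) - X i = ∑ k ∈ Finset.range (i + 2), bellPart k i := by
    conv_lhs => rw [← sum_homogeneousComponent (bell (i + 1) - X i)]
    refine Finset.sum_subset (Finset.range_subset_range.2 (by omega)) fun k _ hk => ?_
    exact homogeneousComponent_eq_zero _ _ (by simpa using hk)
  rw [← sub_eq_iff_eq_add', h2]
  symm
  refine Finset.sum_subset (fun k hk => ?_) fun k _ hk => ?_
  · rw [Finset.mem_Icc] at hk
    rw [Finset.mem_range]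
    omega
  · rename_i hk'
    rw [Finset.mem_range] at hk'
    rw [Finset.mem_Icc] at hk
    exact bellPart_eq_zero_of_le_one (by omega) i

theorem isHomogeneous_bellPart (k i : ℕ) : (bellPart k i).IsHomogeneous k :=
  homogeneousComponent_isHomogeneous _ _

/-- `u` and `v` are divisible by `ε ^ k` and congruent modulo `ε ^ (l + k - 1)`. -/
def CongrOrder (l k : ℕ) (u v : Polynomial ℂ) : Prop :=
  Polynomial.X ^ k ∣ u ∧ Polynomial.X ^ k ∣ v ∧ Polynomial.X ^ (l + k) ∣ Polynomial.X * (u - v)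

namespace CongrOrder

variable {l k k' : ℕ} {u v u' v' : Polynomial ℂ}

theorem refl (l : ℕ) (u : Polynomial ℂ) : CongrOrder l 0 u u := by simp [CongrOrder]

/-- In `u u' - v v' = u (u' - v') + (u - v) v'` the undifferenced factor supplies its own power of
`ε`. Thus each extra factor divisible by `ε` increases the precision by one. -/
theorem mul (h : CongrOrder l k u v) (h' : CongrOrder l k' u' v') :
    CongrOrder l (k + k') (u * u') (v * v') := by
  refine ⟨?_, ?_, ?_⟩
  · rw [pow_add]; exact mul_dvd_mul h.1 h'.1
  · rw [pow_add]; exact mul_dvd_mul h.2.1 h'.2.1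
  · have e : Polynomial.X * (u * u' - v * v') =
        u * (Polynomial.X * (u' - v')) + Polynomial.X * (u - v) * v' := by ring
    rw [e]
    refine dvd_add ?_ ?_
    · rw [show l + (k + k') = k + (l + k') by ring, pow_add]
      exact mul_dvd_mul h.1 h'.2.2
    · rw [← add_assoc, pow_add _ (l + k)]
      exact mul_dvd_mul h.2.2 h'.2.1

theorem pow (h : CongrOrder l 1 u v) (e : ℕ) : CongrOrder l e (u ^ e) (v ^ e) := by
  induction e with
  | zero => simpa using refl l 1
  | succ e ih => simpa only [pow_succ] using ih.mul h

theorem sum {ι : Type*} (s : Finset ι) {u v : ι → Polynomial ℂ}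
    (h : ∀ i ∈ s, CongrOrder l k (u i) (v i)) :
    CongrOrder l k (∑ i ∈ s, u i) (∑ i ∈ s, v i) := by
  refine ⟨Finset.dvd_sum fun i hi => (h i hi).1, Finset.dvd_sum fun i hi => (h i hi).2.1, ?_⟩
  rw [← Finset.sum_sub_distrib, Finset.mul_sum]
  exact Finset.dvd_sum fun i hi => (h i hi).2.2

theorem prod {ι : Type*} (s : Finset ι) {u v : ι → Polynomial ℂ} {k : ι → ℕ}
    (h : ∀ i ∈ s, CongrOrder l (k i) (u i) (v i)) :
    CongrOrder l (∑ i ∈ s, k i) (∏ i ∈ s, u i) (∏ i ∈ s, v i) := by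
  classical
  induction s using Finset.induction_on with
  | empty => simpa using refl l 1
  | insert i s hi ih =>
    rw [Finset.sum_insert hi, Finset.prod_insert hi, Finset.prod_insert hi]
    exact (h i (by simp)).mul (ih fun j hj => h j (by simp [hj]))

theorem aeval {σ : Type*} {x y : σ → Polynomial ℂ} (h : ∀ j, CongrOrder l 1 (x j) (y j))
    {p : MvPolynomial σ ℂ} (hp : p.IsHomogeneous k) :
    CongrOrder l k (aeval x p) (aeval y p) := by
  rw [p.as_sum, map_sum, map_sum]
  refine sum _ fun d hd => ?_
  have hdeg : ∑ i ∈ d.support, d i = k := by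
    by_contra hne
    exact mem_support_iff.1 hd (hp.coeff_eq_zero (by rwa [Finsupp.degree_apply]))
  rw [aeval_monomial, aeval_monomial, ← hdeg]
  have h1 := (refl l (algebraMap ℂ (Polynomial ℂ) (coeff d p))).mul
    (prod d.support fun i _ => (h i).pow (d i))
  rwa [zero_add] at h1

/-- The factor `ε` in `CongrOrder` avoids the truncated subtraction `l + k - 1`; this accounts for
`c + 1`. -/
theorem coeff_eq (h : CongrOrder l k u v) {c : ℕ} (hc : c + 1 < l + k) :
    u.coeff c = v.coeff c := by
  have := (Polynomial.X_pow_dvd_iff.1 h.2.2) (c + 1) hc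
  rw [Polynomial.coeff_X_mul, Polynomial.coeff_sub] at this
  exact sub_eq_zero.1 this

end CongrOrder

end Bell

end PoincarePerron

/-! ### Taylor shift of the coefficients, and divided differences. -/

namespace PoincarePerron

open scoped ENNReal

section Polynomials

variable {n : ℕ} (a : Fin n → ℂ) (r : Fin n → ℝ → ℂ)

theorem degree_pertPoly_lt (t : ℝ) : (pertPoly r t).degree < n := by
  refine (Polynomial.degree_sum_le _ _).trans_lt ((Finset.sup_lt_iff (WithBot.bot_lt_coe n)).2
    fun i _ => (Polynomial.degree_C_mul_X_pow_le _ _).trans_lt ?_)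
  exact WithBot.coe_lt_coe.2 i.2

theorem charPoly_eq_pertPoly : charPoly a = Polynomial.X ^ n + pertPoly (fun i _ => a i) 0 := rfl

theorem monic_charPoly : (charPoly a).Monic := by
  rw [charPoly_eq_pertPoly]
  exact Polynomial.monic_X_pow_add (degree_pertPoly_lt _ _)

theorem natDegree_charPoly : (charPoly a).natDegree = n := by
  rw [charPoly_eq_pertPoly,
    Polynomial.natDegree_add_eq_left_of_degree_lt (by simpa using degree_pertPoly_lt _ _)]
  simp

theorem coeff_pertPoly (t : ℝ) (i : Fin n) : (pertPoly r t).coeff i = r i t := by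
  simp [pertPoly, Polynomial.coeff_X_pow, Fin.val_inj]

theorem coeff_charPoly (i : Fin n) : (charPoly a).coeff i = a i := by
  rw [charPoly_eq_pertPoly, Polynomial.coeff_add, coeff_pertPoly, Polynomial.coeff_X_pow,
    if_neg i.2.ne, zero_add]

theorem eval_hasseDeriv_eq {f : Polynomial ℂ} {n : ℕ} (hf : f.natDegree ≤ n) (lam : ℂ) (l : ℕ) :
    (Polynomial.hasseDeriv l f).eval lam =
      ∑ i ∈ Finset.range (n + 1), (i.choose l : ℂ) * f.coeff i * lam ^ (i - l) := by
  rw [Polynomial.hasseDeriv_apply, Polynomial.sum_over_range' _ (fun i => by simp) (n + 1)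
    (by omega), Polynomial.eval_finsetSum]
  simp

/-- Taylor shift of a differential polynomial. -/
theorem sum_coeff_mul_leibniz {f : Polynomial ℂ} {n : ℕ} (hf : f.natDegree ≤ n) (lam : ℂ)
    (x : ℕ → ℂ) :
    ∑ i ∈ Finset.range (n + 1), f.coeff i *
        ∑ p ∈ Finset.HasAntidiagonal.antidiagonal i, (i.choose p.1 : ℂ) * (lam ^ p.1 * x p.2) =
      ∑ l ∈ Finset.range (n + 1), (Polynomial.hasseDeriv l f).eval lam * x l := by
  simp only [eval_hasseDeriv_eq hf, Finset.sum_mul]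
  rw [Finset.sum_comm]
  refine Finset.sum_congr rfl fun i hi => ?_
  rw [Finset.mem_range] at hi
  rw [← Finset.sum_subset (Finset.range_subset_range.2 (by omega : i + 1 ≤ n + 1))
    (fun l _ hl => by
      rw [Finset.mem_range, not_lt] at hl
      rw [Nat.choose_eq_zero_of_lt (by omega)]
      simp)]
  rw [← Finset.Nat.sum_antidiagonal_swap, Finset.Nat.sum_antidiagonal_eq_sum_range_succ_mk,
    Finset.mul_sum]
  refine Finset.sum_congr rfl fun l hl => ?_
  rw [Finset.mem_range] at hl
  simp only [Prod.swap_prod_mk]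
  rw [Nat.choose_symm (by omega)]
  ring

theorem aTilde_zero (lam : ℂ) : aTilde a lam 0 = (charPoly a).eval lam := by
  simp [aTilde]

theorem aTilde_self (lam : ℂ) : aTilde a lam n = 1 := by
  rw [aTilde, eval_hasseDeriv_eq (natDegree_charPoly a).le, Finset.sum_range_succ,
    Finset.sum_eq_zero fun i hi => by
      rw [Nat.choose_eq_zero_of_lt (Finset.mem_range.1 hi)]; simp]
  have h := monic_charPoly a
  rw [Polynomial.Monic, Polynomial.leadingCoeff, natDegree_charPoly] at h
  simp [h]

theorem sum_aTilde_mul_pow (lam x : ℂ) :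
    ∑ i ∈ Finset.range (n + 1), aTilde a lam i * x ^ i = (charPoly a).eval (x + lam) := by
  rw [← Polynomial.taylor_eval, Polynomial.eval_eq_sum_range' (n := n + 1) (by
    rw [Polynomial.natDegree_taylor, natDegree_charPoly]; omega)]
  simp [Polynomial.taylor_coeff, aTilde]

theorem rTilde_zero (lam : ℂ) (t : ℝ) : rTilde r lam 0 t = (pertPoly r t).eval lam := by
  simp [rTilde]

theorem rTilde_eq_sum (lam : ℂ) (i : ℕ) (t : ℝ) :
    rTilde r lam i t = ∑ k : Fin n, ((k : ℕ).choose i * lam ^ ((k : ℕ) - i)) * r k t := by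
  simp only [rTilde, pertPoly, map_sum, Polynomial.eval_finsetSum]
  refine Finset.sum_congr rfl fun k _ => ?_
  rw [Polynomial.C_mul_X_pow_eq_monomial, Polynomial.hasseDeriv_monomial,
    Polynomial.eval_monomial]
  ring

theorem rTilde_eq_zero {i : ℕ} (hi : n ≤ i) (lam : ℂ) (t : ℝ) : rTilde r lam i t = 0 := by
  rw [rTilde_eq_sum]
  refine Finset.sum_eq_zero fun k _ => ?_
  rw [Nat.choose_eq_zero_of_lt (by omega)]
  simp

theorem memLp_rTilde {P : ℝ≥0∞} {μ : Measure ℝ} (hr : ∀ i, MemLp (r i) P μ) (lam : ℂ) (i : ℕ) :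
    MemLp (rTilde r lam i) P μ := by
  have h := memLp_finsetSum (p := P) (μ := μ) Finset.univ (f := fun (k : Fin n) t =>
    ((k : ℕ).choose i * lam ^ ((k : ℕ) - i)) * r k t) fun k _ => (hr k).const_mul _
  rwa [show rTilde r lam i = _ from funext (rTilde_eq_sum r lam i)]

/-- The divided difference of order `#s - 1` of `(x - c) ^ d`. -/
theorem sum_sub_pow_div_prod {ι : Type*} [DecidableEq ι] {s : Finset ι} {x : ι → ℂ}
    (hx : InjOn x s) (c : ℂ) {d : ℕ} (hd : d < s.card) :
    ∑ j ∈ s, (1 / ∏ k ∈ s.erase j, (x j - x k)) * (x j - c) ^ d =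
      if d = s.card - 1 then 1 else 0 := by
  have hdeg : ((Polynomial.X - Polynomial.C c) ^ d).natDegree = d := by simp
  have hm : ((Polynomial.X - Polynomial.C c) ^ d).Monic := (Polynomial.monic_X_sub_C c).pow d
  -- As `d < #s`, the polynomial `(x - c)^d` is its own Lagrange interpolant, and the sum is its
  -- coefficient of degree `#s - 1`.
  have h := Lagrange.coeff_eq_sum hx (P := (Polynomial.X - Polynomial.C c) ^ d) (by
    rw [Polynomial.degree_eq_natDegree hm.ne_zero, hdeg]
    exact_mod_cast hd)
  have e : ∑ j ∈ s, (1 / ∏ k ∈ s.erase j, (x j - x k)) * (x j - c) ^ d =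
      ((Polynomial.X - Polynomial.C c) ^ d).coeff (s.card - 1) := by
    rw [h]
    refine Finset.sum_congr rfl fun j _ => ?_
    rw [one_div_mul_eq_div]
    simp
  rw [e]
  split_ifs with hds
  · rw [← hds]
    conv_lhs => rw [← hdeg]
    simpa [hdeg] using hm.coeff_natDegree
  · exact Polynomial.coeff_eq_zero_of_natDegree_lt (by rw [hdeg]; omega)

end Polynomials

/-! ### Green operators for products of first-order factors. -/

section GreenJet

variable {ι : Type*} {t₀ T : ℝ} {s : Finset ι} {γ e : ι → ℂ} {N : ℕ} {f : ℝ → ℂ}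

/-- The derivatives of `-∑ⱼ eⱼ G_{γⱼ} f`, where the power sums `∑ⱼ eⱼ γⱼ ^ i` vanish for `i < N`
and equal `1` for `i = N`. -/
noncomputable def greenJet (t₀ T : ℝ) (s : Finset ι) (γ e : ι → ℂ) (N : ℕ) (f : ℝ → ℂ)
    (i : ℕ) (t : ℝ) : ℂ :=
  -∑ j ∈ s, e j * γ j ^ i * greenInt t₀ T (γ j) f t - if i = N + 1 then f t else 0

theorem greenJet_of_le {i : ℕ} (hi : i ≤ N) (t : ℝ) : greenJet t₀ T s γ e N f i t =
    -∑ j ∈ s, e j * γ j ^ i * greenInt t₀ T (γ j) f t := by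
  rw [greenJet, if_neg (by omega), sub_zero]

/-- Each derivative of `G_γ f` is `γ G_γ f + f`. The vanishing power sums cancel `f` through order
`N`, so those entries are continuous and the derivatives below the top are classical; `f` first
appears at order `N + 1`. -/
theorem isJet_greenJet (hT : t₀ ≤ T) (hf : ∀ j ∈ s, GreenIntegrable t₀ (γ j) f)
    (he : ∀ i < N, ∑ j ∈ s, e j * γ j ^ i = 0) (heN : ∑ j ∈ s, e j * γ j ^ N = 1) :
    IsJet t₀ N (greenJet t₀ T s γ e N f) := by
  have hac : ∀ i ≤ N, ∀ b, t₀ ≤ b →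
      AbsolutelyContinuousOnInterval (greenJet t₀ T s γ e N f i) t₀ b := by
    intro i hi b hb
    refine ((absolutelyContinuousOnInterval_sum s fun j hj =>
      (absolutelyContinuousOnInterval_const (e j * γ j ^ i) t₀ b).complex_mul
        ((hf j hj).ac_greenInt hT b hb)).neg).congr fun t _ => ?_
    rw [greenJet_of_le hi]
    rfl
  have hae : ∀ i ≤ N, ∀ᵐ t ∂volume.restrict (Ici t₀), HasDerivWithinAt (greenJet t₀ T s γ e N f i)
      (greenJet t₀ T s γ e N f (i + 1) t) (Ici t₀) t := by
    intro i hi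
    have h : ∀ᵐ t ∂volume.restrict (Ici t₀), ∀ j ∈ s, HasDerivWithinAt (greenInt t₀ T (γ j) f)
        (γ j * greenInt t₀ T (γ j) f t + f t) (Ici t₀) t :=
      (ae_ball_iff s.countable_toSet).2 fun j hj => (hf j hj).ae_hasDerivWithinAt_greenInt hT
    filter_upwards [h] with t ht
    have h1 := (HasDerivWithinAt.fun_sum fun j hj =>
      (ht j hj).const_mul (e j * γ j ^ i)).neg
    refine (h1.congr (fun u _ => greenJet_of_le hi u) (greenJet_of_le hi t)).congr_deriv ?_
    have e1 : ∑ j ∈ s, e j * γ j ^ i * (γ j * greenInt t₀ T (γ j) f t + f t) =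
        ∑ j ∈ s, e j * γ j ^ (i + 1) * greenInt t₀ T (γ j) f t + (∑ j ∈ s, e j * γ j ^ i) * f t := by
      rw [Finset.sum_mul, ← Finset.sum_add_distrib]
      exact Finset.sum_congr rfl fun j _ => by ring
    rw [e1, greenJet]
    rcases hi.lt_or_eq with hi | rfl
    · rw [he i hi, if_neg (by omega)]
      ring
    · rw [heN, if_pos rfl]
      ring
  refine ⟨fun i hi t ht => ?_, hac, hae N le_rfl⟩
  exact hasDerivWithinAt_of_ac (hac i hi.le) (continuousOn_Ici_of_ac (hac (i + 1) hi))
    (hae i hi.le) ht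

end GreenJet

end PoincarePerron

/-! ### The order of `θ_l`. -/

namespace PoincarePerron

open scoped ENNReal

section Jet

variable {t₀ : ℝ} {θ : ℕ → ℝ → ℂ}

theorem coeff_jet (l : ℕ) (t : ℝ) (j c : ℕ) : (jet t₀ θ l t j).coeff c =
    if c < l then iteratedDerivWithin j (θ c) (Ici t₀) t else 0 := by
  simp [jet, Polynomial.coeff_monomial]

theorem natDegree_jet_le (l : ℕ) (t : ℝ) (j : ℕ) : (jet t₀ θ l t j).natDegree ≤ l :=
  Polynomial.natDegree_sum_le_of_forall_le _ _ fun _ hq =>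
    (Polynomial.natDegree_monomial_le _).trans (Finset.mem_range.1 hq).le

theorem iteratedDerivWithin_zero_fun (j : ℕ) (s : Set ℝ) (t : ℝ) :
    iteratedDerivWithin j (0 : ℝ → ℂ) s t = 0 :=
  iteratedDerivWithin_const_zero

theorem X_dvd_jet (hθ : θ 0 = 0) (l : ℕ) (t : ℝ) (j : ℕ) : Polynomial.X ∣ jet t₀ θ l t j := by
  rw [Polynomial.X_dvd_iff, coeff_jet, hθ, iteratedDerivWithin_zero_fun]
  simp

theorem congrOrder_jet (hθ : θ 0 = 0) {l m : ℕ} (hlm : l ≤ m) (t : ℝ) (j : ℕ) :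
    CongrOrder l 1 (jet t₀ θ l t j) (jet t₀ θ m t j) := by
  refine ⟨by simpa using X_dvd_jet hθ l t j, by simpa using X_dvd_jet hθ m t j, ?_⟩
  rw [add_comm, pow_add, pow_one]
  refine mul_dvd_mul dvd_rfl (Polynomial.X_pow_dvd_iff.2 fun c hc => ?_)
  rw [Polynomial.coeff_sub, coeff_jet, coeff_jet, if_pos hc, if_pos (by omega), sub_self]

theorem aeval_congr_vars {A : Type*} [CommSemiring A] [Algebra ℂ A] {x y : ℕ → A} {N : ℕ}
    (hxy : ∀ j < N, x j = y j) {p : MvPolynomial ℕ ℂ} (hp : (p.vars : Set ℕ) ⊆ Iio N) :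
    MvPolynomial.aeval x p = MvPolynomial.aeval y p :=
  MvPolynomial.eval₂Hom_congr' rfl (fun i hi _ => hxy i (mem_Iio.1 (hp hi))) rfl

theorem aeval_jet_mem {μ : Measure ℝ} {P : ℝ≥0∞} (hP : P ≠ 0) (hP' : P ≠ ∞) {l N : ℕ}
    (hθ : ∀ q < l, ∀ j < N, IsOrder μ P q (iteratedDerivWithin j (θ q) (Ici t₀)))
    {p : MvPolynomial ℕ ℂ} (hp : (p.vars : Set ℕ) ⊆ Iio N) :
    (fun t => MvPolynomial.aeval (jet t₀ θ l t) p) ∈ gradedSubalgebra μ P hP hP' := by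
  -- Entries of index at least `N` may be set to zero because `p` does not involve them.
  have h := aeval_mem_gradedSubalgebra (μ := μ) hP hP'
    (x := fun j t => if j < N then jet t₀ θ l t j else 0) (fun j => ?_) p
  · convert h using 2 with t
    exact aeval_congr_vars (fun j hj => by simp [hj]) hp
  · by_cases hj : j < N
    · simp only [hj, if_true]
      refine ⟨⟨l, fun t => natDegree_jet_le l t j⟩, fun c => ?_⟩
      simp only [coeff_jet]
      by_cases hc : c < l
      · simpa only [hc, if_true] using hθ c hc j hj
      · simpa only [hc, if_false] using IsOrder.zero
    · simp only [hj, if_false]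
      exact zero_mem _

theorem isOrder_bellCoeff {μ : Measure ℝ} {P : ℝ≥0∞} (hP : P ≠ 0) (hP' : P ≠ ∞) {l N : ℕ}
    (hθ : ∀ q < l, ∀ j < N, IsOrder μ P q (iteratedDerivWithin j (θ q) (Ici t₀)))
    (k : ℕ) {i : ℕ} (hi : i ≤ N) (c : ℕ) : IsOrder μ P c (bellCoeff t₀ θ l k i c) :=
  (aeval_jet_mem hP hP' hθ ((vars_bellPart k i).trans (Iio_subset_Iio hi))).2 c

end Jet

section Theta

variable {n : ℕ} (a : Fin n → ℂ) (r : Fin n → ℝ → ℂ) (t₀ : ℝ) (root : Fin n → ℂ) (i₀ : Fin n)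

/-- The derivatives of `θ_l`, up to order `n - 1`. -/
noncomputable def thetaJet (l : ℕ) : ℕ → ℝ → ℂ :=
  greenJet t₀ t₀ (Finset.univ.erase i₀) (fun j => root j - root i₀)
    (fun j => 1 / greenGamma root i₀ j) (n - 2)
    (source a r t₀ (root i₀) (theta a r t₀ root i₀) l)

variable {a r t₀ root i₀}

theorem re_sub_ne_zero (hre : Function.Injective fun i => (root i).re) {j : Fin n} (hj : j ≠ i₀) :
    (root j - root i₀).re ≠ 0 := by
  rw [Complex.sub_re, sub_ne_zero]
  exact fun h => hj (hre h)

theorem theta_eq_thetaJet (hre : Function.Injective fun i => (root i).re) (l : ℕ) :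
    theta a r t₀ root i₀ l = thetaJet a r t₀ root i₀ l 0 := by
  funext t
  rw [theta_eq, thetaJet, greenJet_of_le (Nat.zero_le _), greenOp]
  congr 1
  refine Finset.sum_congr rfl fun j hj => ?_
  rw [scalarGreen_eq_greenInt (re_sub_ne_zero hre (Finset.ne_of_mem_erase hj)), pow_zero, mul_one]

theorem theta_zero : theta a r t₀ root i₀ 0 = 0 := by
  funext t
  rw [theta_eq, greenOp]
  simp [source, scalarGreen]

/-- A divided difference at the `n - 1` roots other than `root i₀`; it makes `thetaJet` a sequence
of derivatives up to order `n - 2`. -/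
theorem sum_greenGamma (hn : 2 ≤ n) (hre : Function.Injective fun i => (root i).re) {i : ℕ}
    (hi : i ≤ n - 2) :
    ∑ j ∈ Finset.univ.erase i₀, 1 / greenGamma root i₀ j * (root j - root i₀) ^ i =
      if i = n - 2 then 1 else 0 := by
  have hinj : InjOn root (Finset.univ.erase i₀ : Finset (Fin n)) :=
    (fun x _ y _ h => hre (congrArg Complex.re h))
  have hcard : (Finset.univ.erase i₀ : Finset (Fin n)).card = n - 1 := by simp
  have h := sum_sub_pow_div_prod hinj (root i₀) (d := i) (by rw [hcard]; omega)
  rw [hcard, show n - 1 - 1 = n - 2 by omega] at h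
  exact h

variable {p : ℝ}

theorem isJet_thetaJet (hn : 2 ≤ n) (hre : Function.Injective fun i => (root i).re) {l : ℕ} {q : ℝ}
    (hq : 1 ≤ q) (hS : MemLp (source a r t₀ (root i₀) (theta a r t₀ root i₀) l)
      (ENNReal.ofReal q) (volume.restrict (Ici t₀))) :
    IsJet t₀ (n - 2) (thetaJet a r t₀ root i₀ l) := by
  refine isJet_greenJet le_rfl (fun j hj => GreenIntegrable.of_memLp
    (re_sub_ne_zero hre (Finset.ne_of_mem_erase hj)) hq hS) (fun i hi => ?_) ?_
  · rw [sum_greenGamma hn hre hi.le, if_neg hi.ne]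
  · rw [sum_greenGamma hn hre le_rfl, if_pos rfl]

theorem tendsto_thetaJet (hre : Function.Injective fun i => (root i).re) {l : ℕ} {q : ℝ}
    (hq : 1 ≤ q) (hS : MemLp (source a r t₀ (root i₀) (theta a r t₀ root i₀) l)
      (ENNReal.ofReal q) (volume.restrict (Ici t₀))) {i : ℕ} (hi : i ≤ n - 2) :
    Tendsto (thetaJet a r t₀ root i₀ l i) atTop (𝓝 0) := by
  have h := (tendsto_finsetSum (Finset.univ.erase i₀) fun j hj =>
    (tendsto_greenInt (T := t₀) (re_sub_ne_zero hre (Finset.ne_of_mem_erase hj)) hq hS).const_mul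
      (1 / greenGamma root i₀ j * (root j - root i₀) ^ i)).neg
  simp only [mul_zero, Finset.sum_const_zero, neg_zero] at h
  exact h.congr fun t => (greenJet_of_le hi t).symm

theorem ofReal_div_natCast (p : ℝ) {l : ℕ} (hl : 1 ≤ l) :
    ENNReal.ofReal (p / l) = ENNReal.ofReal p / l := by
  rw [ENNReal.ofReal_div_of_pos (by exact_mod_cast hl), ENNReal.ofReal_natCast]

theorem isOrder_thetaJet (hre : Function.Injective fun i => (root i).re) {l : ℕ} (hl : 1 ≤ l)
    (hlp : (l : ℝ) < p) (hS : MemLp (source a r t₀ (root i₀) (theta a r t₀ root i₀) l)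
      (ENNReal.ofReal (p / l)) (volume.restrict (Ici t₀))) {i : ℕ} (hi : i ≤ n - 2) :
    IsOrder (volume.restrict (Ici t₀)) (ENNReal.ofReal p) l (thetaJet a r t₀ root i₀ l i) := by
  have hq : 1 ≤ p / l := by
    rw [le_div_iff₀ (by exact_mod_cast hl)]
    linarith
  have e : thetaJet a r t₀ root i₀ l i = fun t => (-1) * ∑ j ∈ Finset.univ.erase i₀,
      (1 / greenGamma root i₀ j * (root j - root i₀) ^ i) * greenInt t₀ t₀ (root j - root i₀)
        (source a r t₀ (root i₀) (theta a r t₀ root i₀) l) t := by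
    funext t
    rw [thetaJet, greenJet_of_le hi, neg_one_mul]
  rw [e]
  refine (IsOrder.sum _ fun j hj => IsOrder.const_mul _ ⟨?_, ?_⟩).const_mul _
  · rw [← ofReal_div_natCast p hl]
    exact memLp_greenInt (re_sub_ne_zero hre (Finset.ne_of_mem_erase hj)) hq hS
  · exact memLp_top_greenInt (re_sub_ne_zero hre (Finset.ne_of_mem_erase hj)) hq hS

theorem IsOrder.congr_Ici {c : ℕ} {P : ℝ≥0∞} {f g : ℝ → ℂ}
    (hf : IsOrder (volume.restrict (Ici t₀)) P c f) (h : EqOn f g (Ici t₀)) :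
    IsOrder (volume.restrict (Ici t₀)) P c g := by
  have : f =ᵐ[volume.restrict (Ici t₀)] g := ae_restrict_of_forall_mem measurableSet_Ici h
  exact ⟨(memLp_congr_ae this).1 hf.1, (memLp_congr_ae this).1 hf.2⟩

/-- The order of `S_l` and of the derivatives of `θ_l`. -/
theorem memLp_source_and_isOrder (hn : 2 ≤ n) (hre : Function.Injective fun i => (root i).re)
    (hr : ∀ i, MemLp (r i) (ENNReal.ofReal p) (volume.restrict (Ici t₀))) {l : ℕ}
    (hlp : (l : ℝ) < p) :
    (1 ≤ l → MemLp (source a r t₀ (root i₀) (theta a r t₀ root i₀) l)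
      (ENNReal.ofReal (p / l)) (volume.restrict (Ici t₀))) ∧
    ∀ j < n - 1, IsOrder (volume.restrict (Ici t₀)) (ENNReal.ofReal p) l
      (iteratedDerivWithin j (theta a r t₀ root i₀ l) (Ici t₀)) := by
  -- Both claims go through one induction: `S_l` is built from derivatives of earlier `θ_q`, and
  -- `θ_l` inherits its order from `S_l`.
  induction l using Nat.strong_induction_on with
  | _ l ih =>
    have hp0 : 0 < p := lt_of_le_of_lt (Nat.cast_nonneg l) hlp
    have hP : ENNReal.ofReal p ≠ 0 := by simpa using hp0
    have hP' : ENNReal.ofReal p ≠ ∞ := ENNReal.ofReal_ne_top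
    have ih' : ∀ q < l, ∀ j < n - 1, IsOrder (volume.restrict (Ici t₀)) (ENNReal.ofReal p) q
        (iteratedDerivWithin j (theta a r t₀ root i₀ q) (Ici t₀)) := fun q hq =>
      (ih q hq (lt_trans (by exact_mod_cast hq) hlp)).2
    have hS : 1 ≤ l → MemLp (source a r t₀ (root i₀) (theta a r t₀ root i₀) l)
        (ENNReal.ofReal (p / l)) (volume.restrict (Ici t₀)) := by
      intro hl
      match l, hl with
      | 1, _ =>
        have h := memLp_rTilde r hr (root i₀) 0
        simp only [Nat.cast_one, div_one]
        have e : source a r t₀ (root i₀) (theta a r t₀ root i₀) 1 = rTilde r (root i₀) 0 :=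
          funext fun t => (rTilde_zero r (root i₀) t).symm
        rwa [e]
      | l + 2, _ =>
        -- Every term has total order `l + 2`: the linear part is `r̃` times order `l + 1`, and the
        -- Bell terms are constants times order `l + 2` or `r̃` times order `l + 1`.
        rw [ofReal_div_natCast p (by omega)]
        have hlin : MemLp (linPart r t₀ (root i₀) (theta a r t₀ root i₀ (l + 1)))
            (ENNReal.ofReal p / (l + 2 : ℕ)) (volume.restrict (Ici t₀)) :=
          memLp_finsetSum _ fun k hk => by
            rw [Finset.mem_Icc] at hk
            exact (ih' (l + 1) (by omega) (k - 1) (by omega)).memLp_mul hP hP'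
              (memLp_rTilde r hr _ k)
        refine hlin.add (memLp_finsetSum _ fun k hk => memLp_finsetSum _ fun i hi => ?_)
        rw [Finset.mem_Icc] at hi
        have hb := isOrder_bellCoeff hP hP' ih' k (i := i - 1) (by omega)
        exact ((hb (l + 2)).1.const_mul _).add
          ((hb (l + 1)).memLp_mul hP hP' (memLp_rTilde r hr _ i))
    refine ⟨hS, fun j hj => ?_⟩
    by_cases hl : l = 0
    · rw [hl, theta_zero]
      convert IsOrder.zero using 1
      funext t
      exact iteratedDerivWithin_zero_fun j _ t
    · have hl1 : 1 ≤ l := by omega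
      have hq : 1 ≤ p / l := by
        rw [le_div_iff₀ (by exact_mod_cast hl1)]
        linarith
      refine (isOrder_thetaJet hre hl1 hlp (hS hl1) (i := j) (by omega)).congr_Ici fun t ht => ?_
      rw [theta_eq_thetaJet hre]
      exact ((isJet_thetaJet hn hre hq (hS hl1)).iteratedDerivWithin_eq (by omega) ht).symm

end Theta

end PoincarePerron

/-! ### Integrability of the residual. -/

namespace PoincarePerron

open scoped ENNReal

section Graded

variable {α : Type*} [MeasurableSpace α] {μ : Measure α} {P : ℝ≥0∞} {hP : P ≠ 0} {hP' : P ≠ ∞}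
  {Φ : α → Polynomial ℂ} {M : ℕ}

/-- Setting `ε = 1` adds up all coefficients. The degree bound is uniform in `t`, so the remainder
is a fixed finite sum of terms of order at least `M`. -/
theorem exists_eval_one_sub_eq_sum (hΦ : Φ ∈ gradedSubalgebra μ P hP hP') (M : ℕ) :
    ∃ N, ∀ t, (Φ t).eval 1 - ∑ c ∈ Finset.range M, (Φ t).coeff c =
      ∑ c ∈ Finset.Ico M (M + N), (Φ t).coeff c := by
  obtain ⟨⟨N, hN⟩, -⟩ := hΦ
  refine ⟨N + 1, fun t => ?_⟩
  rw [Polynomial.eval_eq_sum_range' (n := M + (N + 1)) (by have := hN t; omega),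
    Finset.sum_Ico_eq_sub _ (by omega)]
  simp

theorem integrable_eval_one_sub (hΦ : Φ ∈ gradedSubalgebra μ P hP hP') (hM : P ≤ M) :
    Integrable (fun t => (Φ t).eval 1 - ∑ c ∈ Finset.range M, (Φ t).coeff c) μ := by
  obtain ⟨N, hN⟩ := exists_eval_one_sub_eq_sum hΦ M
  simp only [hN]
  refine integrable_finsetSum _ fun c hc => (hΦ.2 c).integrable hP (hM.trans ?_)
  exact_mod_cast (Finset.mem_Ico.1 hc).1

theorem integrable_mul_eval_one_sub (hΦ : Φ ∈ gradedSubalgebra μ P hP hP') (hP1 : 1 ≤ P)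
    (hM : P ≤ (M + 1 : ℕ)) {r : α → ℂ} (hr : MemLp r P μ) :
    Integrable (fun t => r t * ((Φ t).eval 1 - ∑ c ∈ Finset.range M, (Φ t).coeff c)) μ := by
  obtain ⟨N, hN⟩ := exists_eval_one_sub_eq_sum hΦ M
  simp only [hN, Finset.mul_sum]
  refine integrable_finsetSum _ fun c hc => (hΦ.2 c).integrable_mul hP1 hP' hr (hM.trans ?_)
  exact_mod_cast Nat.succ_le_succ (Finset.mem_Ico.1 hc).1

end Graded

variable {n : ℕ} {a : Fin n → ℂ} {r : Fin n → ℝ → ℂ} {t₀ : ℝ} {root : Fin n → ℂ} {i₀ : Fin n}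
  {p : ℝ} {m : ℕ}

theorem one_le_div_of_lt {l : ℕ} (hl : 1 ≤ l) (hlp : (l : ℝ) < p) : 1 ≤ p / l := by
  rw [le_div_iff₀ (by exact_mod_cast hl)]
  linarith

theorem iteratedDerivWithin_theta (hn : 2 ≤ n) (hre : Function.Injective fun i => (root i).re)
    (hr : ∀ i, MemLp (r i) (ENNReal.ofReal p) (volume.restrict (Ici t₀))) {l : ℕ} (hl : 1 ≤ l)
    (hlp : (l : ℝ) < p) {j : ℕ} (hj : j < n - 1) {t : ℝ} (ht : t₀ ≤ t) :
    iteratedDerivWithin j (theta a r t₀ root i₀ l) (Ici t₀) t = thetaJet a r t₀ root i₀ l j t := by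
  rw [theta_eq_thetaJet hre]
  exact (isJet_thetaJet hn hre (one_le_div_of_lt hl hlp)
    ((memLp_source_and_isOrder hn hre hr hlp).1 hl)).iteratedDerivWithin_eq (by omega) ht

/-- The linear constant-coefficient part of the equation for `θ_l`. -/
theorem sum_aTilde_mul_thetaJet (hn : 2 ≤ n) (hroot : ∀ i, (charPoly a).IsRoot (root i))
    (hre : Function.Injective fun i => (root i).re) (l : ℕ) (t : ℝ) :
    ∑ i ∈ Finset.range n, aTilde a (root i₀) (i + 1) * thetaJet a r t₀ root i₀ l i t =
      -source a r t₀ (root i₀) (theta a r t₀ root i₀) l t := by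
  have h0 : aTilde a (root i₀) 0 = 0 := by
    rw [aTilde_zero]
    exact hroot i₀
  -- Since `ã_0 = 0`, the nonzero `γ_j` are roots of the shifted polynomial divided by its variable.
  have hγ : ∀ j ∈ Finset.univ.erase i₀,
      ∑ i ∈ Finset.range n, aTilde a (root i₀) (i + 1) * (root j - root i₀) ^ i = 0 := by
    intro j hj
    have h1 := sum_aTilde_mul_pow a (root i₀) (root j - root i₀)
    rw [sub_add_cancel, show (charPoly a).eval (root j) = 0 from hroot j,
      Finset.sum_range_succ', h0, zero_mul, add_zero] at h1
    have hne : root j - root i₀ ≠ 0 := fun h =>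
      re_sub_ne_zero hre (Finset.ne_of_mem_erase hj) (by rw [h, Complex.zero_re])
    refine (mul_eq_zero.1 ?_).resolve_left hne
    rw [Finset.mul_sum, ← h1]
    exact Finset.sum_congr rfl fun i _ => by ring
  simp only [thetaJet, greenJet, mul_sub, Finset.sum_sub_distrib, mul_ite, mul_zero]
  rw [show n - 2 + 1 = n - 1 by omega, Finset.sum_ite_eq',
    if_pos (Finset.mem_range.2 (by omega)), show n - 1 + 1 = n by omega, aTilde_self, one_mul,
    sub_eq_neg_self]
  simp only [mul_neg, Finset.sum_neg_distrib, neg_eq_zero, Finset.mul_sum]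
  rw [Finset.sum_comm]
  refine Finset.sum_eq_zero fun j hj => ?_
  calc _ = (1 / greenGamma root i₀ j * greenInt t₀ t₀ (root j - root i₀)
        (source a r t₀ (root i₀) (theta a r t₀ root i₀) l) t) *
        ∑ i ∈ Finset.range n, aTilde a (root i₀) (i + 1) * (root j - root i₀) ^ i := by
        rw [Finset.mul_sum]
        exact Finset.sum_congr rfl fun i _ => by ring
    _ = 0 := by rw [hγ j hj, mul_zero]

theorem sum_rTilde_mul_thetaJet (hn : 2 ≤ n) (hre : Function.Injective fun i => (root i).re)
    (hr : ∀ i, MemLp (r i) (ENNReal.ofReal p) (volume.restrict (Ici t₀))) {l : ℕ} (hl : 1 ≤ l)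
    (hlp : (l : ℝ) < p) {t : ℝ} (ht : t₀ ≤ t) :
    ∑ i ∈ Finset.range n, rTilde r (root i₀) (i + 1) t * thetaJet a r t₀ root i₀ l i t =
      linPart r t₀ (root i₀) (theta a r t₀ root i₀ l) t := by
  obtain ⟨n, rfl⟩ : ∃ k, n = k + 1 := ⟨n - 1, by omega⟩
  -- The top entry, of order `n - 1`, would contain the source; it drops out because `r̃_n = 0`.
  rw [Finset.sum_range_succ, rTilde_eq_zero r le_rfl, zero_mul, add_zero, linPart,
    Nat.add_sub_cancel, Finset.range_eq_Ico]
  have h := Finset.sum_Ico_add'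
    (fun i => rTilde r (root i₀) i t * thetaJet a r t₀ root i₀ l (i - 1) t) 0 n 1
  simp only [Nat.add_sub_cancel] at h
  rw [h]
  refine Finset.sum_congr (by ext; simp) fun k hk => ?_
  rw [Finset.mem_Icc] at hk
  rw [iteratedDerivWithin_theta hn hre hr hl hlp (by omega) ht]

theorem linPart_zero (lam : ℂ) (t : ℝ) : linPart r t₀ lam 0 t = 0 := by
  simp [linPart]

theorem source_one (lam : ℂ) (θ : ℕ → ℝ → ℂ) (t : ℝ) :
    source a r t₀ lam θ 1 t = rTilde r lam 0 t :=
  (rTilde_zero r lam t).symm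

theorem source_add_two (lam : ℂ) (θ : ℕ → ℝ → ℂ) (l : ℕ) (t : ℝ) :
    source a r t₀ lam θ (l + 2) t = linPart r t₀ lam (θ (l + 1)) t +
      ∑ k ∈ Finset.Icc 2 n, ∑ i ∈ Finset.Icc k n,
        (aTilde a lam i * bellCoeff t₀ θ (l + 2) k (i - 1) (l + 2) t
          + rTilde r lam i t * bellCoeff t₀ θ (l + 2) k (i - 1) (l + 1) t) :=
  rfl

/-- All `S_l` with `l ≤ m`, `l ≥ 1`, by one formula. -/
theorem source_succ_eq {l : ℕ} (hlm : l < m) (t : ℝ) :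
    source a r t₀ (root i₀) (theta a r t₀ root i₀) (l + 1) t =
      (if l = 0 then rTilde r (root i₀) 0 t else 0) +
        linPart r t₀ (root i₀) (theta a r t₀ root i₀ l) t +
        ∑ k ∈ Finset.Icc 2 n, ∑ i ∈ Finset.Icc k n,
          (aTilde a (root i₀) i *
              bellCoeff t₀ (theta a r t₀ root i₀) (m + 1) k (i - 1) (l + 1) t +
            rTilde r (root i₀) i t *
              bellCoeff t₀ (theta a r t₀ root i₀) (m + 1) k (i - 1) l t) := by
  -- Lengthening the truncation from `l + 1` to `m + 1` affects only coefficients of index at least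
  -- `l + k`, which exceeds `l + 1` because `k ≥ 2`.
  have hc : ∀ k ∈ Finset.Icc 2 n, ∀ i, CongrOrder (l + 1) k
      (MvPolynomial.aeval (jet t₀ (theta a r t₀ root i₀) (l + 1) t) (bellPart k (i - 1)))
      (MvPolynomial.aeval (jet t₀ (theta a r t₀ root i₀) (m + 1) t) (bellPart k (i - 1))) :=
    fun k _ i => CongrOrder.aeval (fun j => congrOrder_jet theta_zero (by omega) t j)
      (isHomogeneous_bellPart k (i - 1))
  rcases l with _ | l
  · have h0 : ∀ k ∈ Finset.Icc 2 n, ∀ i ∈ Finset.Icc k n,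
        aTilde a (root i₀) i *
              bellCoeff t₀ (theta a r t₀ root i₀) (m + 1) k (i - 1) (0 + 1) t +
            rTilde r (root i₀) i t *
              bellCoeff t₀ (theta a r t₀ root i₀) (m + 1) k (i - 1) 0 t = 0 := by
      intro k hk i _
      have h := Polynomial.X_pow_dvd_iff.1 (hc k hk i).2.1
      rw [Finset.mem_Icc] at hk
      rw [bellCoeff, bellCoeff, h _ (by omega), h _ (by omega), mul_zero, mul_zero, add_zero]
    rw [if_pos rfl, theta_zero, linPart_zero, add_zero,
      Finset.sum_eq_zero fun k hk => Finset.sum_eq_zero (h0 k hk), add_zero, zero_add, source_one]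
  · rw [if_neg (by omega), zero_add, source_add_two, add_right_inj]
    refine Finset.sum_congr rfl fun k hk => Finset.sum_congr rfl fun i _ => ?_
    have h := hc k hk i
    rw [Finset.mem_Icc] at hk
    simp only [bellCoeff]
    rw [h.coeff_eq (by omega), h.coeff_eq (by omega)]

variable (a r t₀ root i₀) in
/-- The derivatives of `φ = θ_1 + ⋯ + θ_m`, up to order `n - 1`. -/
noncomputable def phiJet (m i : ℕ) (t : ℝ) : ℂ :=
  ∑ l ∈ Finset.range m, thetaJet a r t₀ root i₀ (l + 1) i t

variable (a r t₀ root i₀) in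
/-- What remains of the equation after inserting `exp (λ t + ∫ φ)`. -/
noncomputable def residual (m : ℕ) (t : ℝ) : ℂ :=
  ∑ i ∈ Finset.range (n + 1), (aTilde a (root i₀) i + rTilde r (root i₀) i t) *
    MvPolynomial.aeval (fun j => phiJet a r t₀ root i₀ m j t) (bell i)

theorem eval_one_aeval_jet (hn : 2 ≤ n) (hre : Function.Injective fun i => (root i).re)
    (hr : ∀ i, MemLp (r i) (ENNReal.ofReal p) (volume.restrict (Ici t₀)))
    (hmp : (m : ℝ) < p) {t : ℝ} (ht : t₀ ≤ t) {f : MvPolynomial ℕ ℂ}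
    (hf : (f.vars : Set ℕ) ⊆ Iio (n - 1)) :
    (MvPolynomial.aeval (jet t₀ (theta a r t₀ root i₀) (m + 1) t) f).eval 1 =
      MvPolynomial.aeval (fun j => phiJet a r t₀ root i₀ m j t) f := by
  rw [← Polynomial.coe_aeval_eq_eval, MvPolynomial.comp_aeval_apply]
  refine aeval_congr_vars (fun j hj => ?_) hf
  rw [Polynomial.coe_aeval_eq_eval, jet, Polynomial.eval_finsetSum, Finset.sum_range_succ', theta_zero,
    iteratedDerivWithin_zero_fun, phiJet]
  simp only [Polynomial.eval_monomial, one_pow, mul_one, add_zero]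
  refine Finset.sum_congr rfl fun l hl => ?_
  refine iteratedDerivWithin_theta hn hre hr (by omega) (lt_of_le_of_lt ?_ hmp) hj ht
  exact_mod_cast Finset.mem_range.1 hl

/-- Adding the equations for `θ_1, …, θ_m` cancels everything through order `m`. Since `r̃` itself
counts as order one, the Bell coefficients left start at index `m + 1` beside `ã` and at index `m`
beside `r̃`. -/
theorem residual_eq (hn : 2 ≤ n) (hroot : ∀ i, (charPoly a).IsRoot (root i))
    (hre : Function.Injective fun i => (root i).re)
    (hr : ∀ i, MemLp (r i) (ENNReal.ofReal p) (volume.restrict (Ici t₀)))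
    (hm : 1 ≤ m) (hmp : (m : ℝ) < p) {t : ℝ} (ht : t₀ ≤ t) :
    residual a r t₀ root i₀ m t = linPart r t₀ (root i₀) (theta a r t₀ root i₀ m) t +
      ∑ k ∈ Finset.Icc 2 n, ∑ i ∈ Finset.Icc k n, (aTilde a (root i₀) i *
        ((MvPolynomial.aeval (jet t₀ (theta a r t₀ root i₀) (m + 1) t)
            (bellPart k (i - 1))).eval 1 - ∑ c ∈ Finset.range (m + 1),
          bellCoeff t₀ (theta a r t₀ root i₀) (m + 1) k (i - 1) c t) +
        rTilde r (root i₀) i t *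
        ((MvPolynomial.aeval (jet t₀ (theta a r t₀ root i₀) (m + 1) t)
            (bellPart k (i - 1))).eval 1 - ∑ c ∈ Finset.range m,
          bellCoeff t₀ (theta a r t₀ root i₀) (m + 1) k (i - 1) c t)) := by
  set A := aTilde a (root i₀) with hA
  set B := fun i => rTilde r (root i₀) i t with hB
  set H := fun k i => (MvPolynomial.aeval (jet t₀ (theta a r t₀ root i₀) (m + 1) t)
            (bellPart k (i - 1))).eval 1 with hH
  set K := fun k i c => bellCoeff t₀ (theta a r t₀ root i₀) (m + 1) k (i - 1) c t with hK
  set Φ := fun j => phiJet a r t₀ root i₀ m j t with hΦ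
  set Lp := fun l => linPart r t₀ (root i₀) (theta a r t₀ root i₀ l) t with hLp
  have h0 : A 0 = 0 := by
    rw [hA, aTilde_zero]
    exact hroot i₀
  have hlt : ∀ l ∈ Finset.range m, ((l + 1 : ℕ) : ℝ) < p := fun l hl =>
    lt_of_le_of_lt (by exact_mod_cast Finset.mem_range.1 hl) hmp
  have hbell : ∀ i ∈ Finset.range n, MvPolynomial.aeval Φ (bell (i + 1)) =
      Φ i + ∑ k ∈ Finset.Icc 2 (i + 1), H k (i + 1) := by
    intro i hi
    rw [Finset.mem_range] at hi
    rw [bell_eq_add_sum_bellPart, map_add, map_sum, MvPolynomial.aeval_X]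
    congr 1
    refine Finset.sum_congr rfl fun k _ => ?_
    exact (eval_one_aeval_jet hn hre hr hmp ht
      ((vars_bellPart k i).trans (Iio_subset_Iio (by omega)))).symm
  have hAΦ : ∑ i ∈ Finset.range n, A (i + 1) * Φ i =
      -∑ l ∈ Finset.range m, source a r t₀ (root i₀) (theta a r t₀ root i₀) (l + 1) t := by
    simp only [hΦ, phiJet, Finset.mul_sum]
    rw [Finset.sum_comm, ← Finset.sum_neg_distrib]
    exact Finset.sum_congr rfl fun l _ => sum_aTilde_mul_thetaJet hn hroot hre (l + 1) t
  have hBΦ : ∑ i ∈ Finset.range n, B (i + 1) * Φ i = ∑ l ∈ Finset.range m, Lp (l + 1) := by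
    simp only [hΦ, phiJet, Finset.mul_sum]
    rw [Finset.sum_comm]
    exact Finset.sum_congr rfl fun l hl =>
      sum_rTilde_mul_thetaJet hn hre hr (by omega) (hlt l hl) ht
  -- The residual contains `L(θ_1), …, L(θ_m)`, the sources only `L(θ_0) = 0` up to `L(θ_{m-1})`;
  -- the difference is `L(θ_m)`.
  have hLL : ∑ l ∈ Finset.range m, Lp (l + 1) - ∑ l ∈ Finset.range m, Lp l = Lp m := by
    rw [← Finset.sum_sub_distrib, Finset.sum_range_sub]
    simp only [hLp, theta_zero, linPart_zero, sub_zero]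
  have hKz : ∀ k ∈ Finset.Icc 2 n, ∀ i, K k i 0 = 0 := by
    intro k hk i
    have h := (CongrOrder.aeval (l := m + 1) (fun j => congrOrder_jet (t₀ := t₀)
      (θ := theta a r t₀ root i₀) theta_zero le_rfl t j) (isHomogeneous_bellPart k (i - 1))).1
    exact Polynomial.X_pow_dvd_iff.1 h 0 (by have := (Finset.mem_Icc.1 hk).1; omega)
  have hsrc : ∑ l ∈ Finset.range m, source a r t₀ (root i₀) (theta a r t₀ root i₀) (l + 1) t =
      B 0 + ∑ l ∈ Finset.range m, Lp l + ∑ k ∈ Finset.Icc 2 n, ∑ i ∈ Finset.Icc k n,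
        (A i * ∑ c ∈ Finset.range (m + 1), K k i c + B i * ∑ c ∈ Finset.range m, K k i c) := by
    rw [Finset.sum_congr rfl fun l hl => source_succ_eq (Finset.mem_range.1 hl) t,
      Finset.sum_add_distrib, Finset.sum_add_distrib, Finset.sum_ite_eq',
      if_pos (Finset.mem_range.2 (by omega))]
    congr 1
    rw [Finset.sum_comm]
    refine Finset.sum_congr rfl fun k hk => ?_
    rw [Finset.sum_comm]
    refine Finset.sum_congr rfl fun i _ => ?_
    rw [Finset.sum_range_succ', hKz k hk, add_zero, Finset.mul_sum, Finset.mul_sum,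
      ← Finset.sum_add_distrib]
  have hswap : ∑ i ∈ Finset.range n, (A (i + 1) + B (i + 1)) *
      ∑ k ∈ Finset.Icc 2 (i + 1), H k (i + 1) =
      ∑ k ∈ Finset.Icc 2 n, ∑ i ∈ Finset.Icc k n, (A i + B i) * H k i := by
    rw [Finset.range_eq_Ico, Finset.sum_Ico_add'
      (fun i => (A i + B i) * ∑ k ∈ Finset.Icc 2 i, H k i) 0 n 1]
    simp only [Finset.mul_sum]
    refine Finset.sum_comm' fun i k => ?_
    simp only [Finset.mem_Ico, Finset.mem_Icc]
    omega
  have hres : residual a r t₀ root i₀ m t = B 0 + (∑ i ∈ Finset.range n, A (i + 1) * Φ i +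
      ∑ i ∈ Finset.range n, B (i + 1) * Φ i) +
      ∑ k ∈ Finset.Icc 2 n, ∑ i ∈ Finset.Icc k n, (A i + B i) * H k i := by
    rw [residual, Finset.sum_range_succ', ← hswap, bell_zero, map_one, mul_one, ← hA, h0, zero_add,
      add_comm, add_assoc, ← Finset.sum_add_distrib, ← Finset.sum_add_distrib]
    congr 1
    refine Finset.sum_congr rfl fun i hi => ?_
    rw [hbell i hi]
    ring
  have hfin : ∑ k ∈ Finset.Icc 2 n, ∑ i ∈ Finset.Icc k n,
      (A i * (H k i - ∑ c ∈ Finset.range (m + 1), K k i c) +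
        B i * (H k i - ∑ c ∈ Finset.range m, K k i c)) =
      ∑ k ∈ Finset.Icc 2 n, ∑ i ∈ Finset.Icc k n, (A i + B i) * H k i -
      ∑ k ∈ Finset.Icc 2 n, ∑ i ∈ Finset.Icc k n,
        (A i * ∑ c ∈ Finset.range (m + 1), K k i c + B i * ∑ c ∈ Finset.range m, K k i c) := by
    simp only [← Finset.sum_sub_distrib]
    exact Finset.sum_congr rfl fun k _ => Finset.sum_congr rfl fun i _ => by ring
  change _ = Lp m + ∑ k ∈ Finset.Icc 2 n, ∑ i ∈ Finset.Icc k n,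
      (A i * (H k i - ∑ c ∈ Finset.range (m + 1), K k i c) +
        B i * (H k i - ∑ c ∈ Finset.range m, K k i c))
  rw [hres, hAΦ, hBΦ, hsrc, hfin, ← hLL]
  ring

theorem integrable_residual (hn : 2 ≤ n) (hroot : ∀ i, (charPoly a).IsRoot (root i))
    (hre : Function.Injective fun i => (root i).re)
    (hr : ∀ i, MemLp (r i) (ENNReal.ofReal p) (volume.restrict (Ici t₀)))
    (hm : 1 ≤ m) (hmp : (m : ℝ) < p) (hpm : p ≤ m + 1) :
    IntegrableOn (residual a r t₀ root i₀ m) (Ici t₀) := by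
  have hm1 : (1 : ℝ) ≤ m := by exact_mod_cast hm
  have hP : ENNReal.ofReal p ≠ 0 := by simp; linarith
  have hP' : ENNReal.ofReal p ≠ ∞ := ENNReal.ofReal_ne_top
  have hP1 : 1 ≤ ENNReal.ofReal p := by simp; linarith
  have hPm : ENNReal.ofReal p ≤ (m + 1 : ℕ) := by
    rw [← ENNReal.ofReal_natCast]
    exact ENNReal.ofReal_le_ofReal (by push_cast; exact hpm)
  have hord : ∀ q < m + 1, ∀ j < n - 1, IsOrder (volume.restrict (Ici t₀)) (ENNReal.ofReal p) q
      (iteratedDerivWithin j (theta a r t₀ root i₀ q) (Ici t₀)) := fun q hq =>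
    (memLp_source_and_isOrder hn hre hr
      (lt_of_le_of_lt (by exact_mod_cast Nat.lt_succ_iff.1 hq) hmp)).2
  have hlin : IntegrableOn (linPart r t₀ (root i₀) (theta a r t₀ root i₀ m)) (Ici t₀) :=
    integrable_finsetSum _ fun k hk => by
      rw [Finset.mem_Icc] at hk
      exact (hord m (by omega) (k - 1) (by omega)).integrable_mul hP1 hP'
        (memLp_rTilde r hr _ k) hPm
  have hmem : ∀ k, ∀ i ≤ n, (fun t => MvPolynomial.aeval
      (jet t₀ (theta a r t₀ root i₀) (m + 1) t) (bellPart k (i - 1))) ∈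
        gradedSubalgebra (volume.restrict (Ici t₀)) (ENNReal.ofReal p) hP hP' := fun k i hi =>
    aeval_jet_mem hP hP' hord ((vars_bellPart k (i - 1)).trans (Iio_subset_Iio (by omega)))
  have hsum : IntegrableOn _ (Ici t₀) := hlin.add (integrable_finsetSum (Finset.Icc 2 n) fun k _ =>
    integrable_finsetSum (Finset.Icc k n) fun i hi =>
      ((integrable_eval_one_sub (hmem k i (Finset.mem_Icc.1 hi).2) hPm).const_mul
        (aTilde a (root i₀) i)).add
      (integrable_mul_eval_one_sub (hmem k i (Finset.mem_Icc.1 hi).2) hP1 hPm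
        (memLp_rTilde r hr (root i₀) i)))
  refine hsum.congr_fun (fun t ht => ?_) measurableSet_Ici
  rw [residual_eq hn hroot hre hr hm hmp ht]
  rfl

end PoincarePerron

/-! ### Bell polynomials as derivatives of exponentials. -/

namespace PoincarePerron

open scoped ENNReal

section Bell

variable {φ : ℕ → ℝ → ℂ} {N : ℕ}

theorem aeval_bell_succ (x : ℕ → ℂ) (i : ℕ) : MvPolynomial.aeval x (bell (i + 1)) =
    ∑ j ∈ Finset.range (i + 1), (i.choose j : ℂ) * MvPolynomial.aeval x (bell (i - j)) * x j := by
  rw [bell_succ, map_sum]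
  exact Finset.sum_congr rfl fun j _ => by simp

theorem tendsto_aeval_bell (hφ : ∀ j < N, Tendsto (φ j) atTop (𝓝 0)) {i : ℕ} (hi : i ≤ N) :
    Tendsto (fun t => MvPolynomial.aeval (fun j => φ j t) (bell i)) atTop
      (𝓝 (if i = 0 then 1 else 0)) := by
  induction i using Nat.strong_induction_on with
  | _ i ih =>
    rcases i with _ | i
    · simp [bell_zero]
    · simp only [aeval_bell_succ]
      rw [if_neg (by omega), ← Finset.sum_const_zero (s := Finset.range (i + 1))]
      refine tendsto_finsetSum _ fun j hj => ?_
      have h := ((ih (i - j) (by omega) (by omega)).const_mul (i.choose j : ℂ)).mul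
        (hφ j (by rw [Finset.mem_range] at hj; omega))
      rwa [mul_zero] at h

theorem isOrder_aeval_bell {μ : Measure ℝ} {P : ℝ≥0∞} (hP : P ≠ 0) (hP' : P ≠ ∞)
    (hφ : ∀ j < N, IsOrder μ P 1 (φ j)) {i : ℕ} (hi : i ≤ N) :
    IsOrder μ P (if i = 0 then 0 else 1)
      (fun t => MvPolynomial.aeval (fun j => φ j t) (bell i)) := by
  induction i using Nat.strong_induction_on with
  | _ i ih =>
    rcases i with _ | i
    · simp only [bell_zero, map_one]
      exact IsOrder.const hP 1
    · simp only [aeval_bell_succ]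
      rw [if_neg (by omega)]
      refine IsOrder.sum _ fun j hj => ?_
      have h := (((ih (i - j) (by omega) (by omega)).mono hP (Nat.zero_le _)).const_mul
        (i.choose j : ℂ)).mul hP hP' (hφ j (by rw [Finset.mem_range] at hj; omega))
      rwa [zero_add] at h

end Bell

section ExpJet

variable {t₀ : ℝ} {φ : ℕ → ℝ → ℂ} {N : ℕ}

/-- The derivatives of `exp (∫ φ 0)`, where `φ` is the sequence of derivatives of `φ 0`. -/
noncomputable def expJet (t₀ : ℝ) (φ : ℕ → ℝ → ℂ) (i : ℕ) (t : ℝ) : ℂ :=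
  Complex.exp (∫ s in t₀..t, φ 0 s) * MvPolynomial.aeval (fun j => φ j t) (bell i)

theorem expJet_zero (t₀ : ℝ) (φ : ℕ → ℝ → ℂ) (t : ℝ) :
    expJet t₀ φ 0 t = Complex.exp (∫ s in t₀..t, φ 0 s) := by
  rw [expJet, bell_zero, map_one, mul_one]

/-- The recursion of the Bell polynomials is the Leibniz rule applied to `E' = φ E`. -/
theorem expJet_succ (t₀ : ℝ) (φ : ℕ → ℝ → ℂ) (i : ℕ) :
    expJet t₀ φ (i + 1) = leibniz φ (expJet t₀ φ) i := by
  funext t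
  rw [expJet, leibniz, aeval_bell_succ, Finset.mul_sum,
    Finset.Nat.sum_antidiagonal_eq_sum_range_succ
      (fun k l => (i.choose k : ℂ) * (φ k t * expJet t₀ φ l t))]
  refine Finset.sum_congr rfl fun j _ => ?_
  rw [expJet]
  ring

theorem IsJet.expJet (hφ : IsJet t₀ N φ) : IsJet t₀ (N + 1) (expJet t₀ φ) := by
  have hc : ContinuousOn (φ 0) (Ici t₀) := hφ.continuousOn (Nat.zero_le _)
  have hint : ∀ b, t₀ ≤ b → IntervalIntegrable (φ 0) volume t₀ b := fun b hb =>
    (hc.mono (by rw [uIcc_of_le hb]; exact Icc_subset_Ici_self)).intervalIntegrable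
  have hE0 : PoincarePerron.expJet t₀ φ 0 = fun t => Complex.exp (∫ s in t₀..t, φ 0 s) :=
    funext (expJet_zero t₀ φ)
  have hE1 : PoincarePerron.expJet t₀ φ 1 =
      fun t => Complex.exp (∫ s in t₀..t, φ 0 s) * φ 0 t := by
    funext t
    rw [PoincarePerron.expJet, aeval_bell_succ]
    simp [bell_zero]
  have hd0 : ∀ t, t₀ ≤ t → HasDerivWithinAt (PoincarePerron.expJet t₀ φ 0)
      (PoincarePerron.expJet t₀ φ 1 t) (Ici t₀) t := by
    intro t ht
    rw [hE0, hE1]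
    refine HasDerivWithinAt.cexp (hasDerivWithinAt_of_ac
      (fun b hb => absolutelyContinuousOnInterval_integral (hint b hb)) hc ?_ ht)
    filter_upwards [ae_hasDerivAt_integral hint] with s hs using hs.hasDerivWithinAt
  have hcE0 : ContinuousOn (PoincarePerron.expJet t₀ φ 0) (Ici t₀) := fun t ht =>
    (hd0 t ht).continuousWithinAt
  have hcE1 : ContinuousOn (PoincarePerron.expJet t₀ φ 1) (Ici t₀) := by
    rw [hE1]
    rw [hE0] at hcE0
    exact hcE0.mul hc
  have hd : ∀ i < N + 1, ∀ t, t₀ ≤ t → HasDerivWithinAt (PoincarePerron.expJet t₀ φ i)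
      (PoincarePerron.expJet t₀ φ (i + 1) t) (Ici t₀) t := by
    intro i hi t ht
    induction i using Nat.strong_induction_on with
    | _ i ih =>
      rcases i with _ | i
      · exact hd0 t ht
      · rw [expJet_succ t₀ φ i, expJet_succ t₀ φ (i + 1)]
        exact hasDerivWithinAt_leibniz (fun k hk => hφ.deriv k (by omega) t ht)
          (fun k hk => ih k (by omega) (by omega))
  refine ⟨hd, fun i hi b hb => ?_, ?_⟩
  · induction i using Nat.strong_induction_on with
    | _ i ih =>
      rcases i with _ | i
      · have hi1 : ∀ x, t₀ ≤ x →
            IntervalIntegrable (PoincarePerron.expJet t₀ φ 1) volume t₀ x := fun x hx =>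
          (hcE1.mono (by rw [uIcc_of_le hx]; exact Icc_subset_Ici_self)).intervalIntegrable
        refine ((absolutelyContinuousOnInterval_const (PoincarePerron.expJet t₀ φ 0 t₀) t₀ b).add
          (absolutelyContinuousOnInterval_integral (hi1 b hb))).congr fun x hx => ?_
        rw [uIcc_of_le hb] at hx
        have h := intervalIntegral.integral_eq_sub_of_hasDeriv_right_of_le hx.1
          (hcE0.mono Icc_subset_Ici_self) (fun y hy =>
            (hd0 y hy.1.le).mono (Ioi_subset_Ici hy.1.le)) (hi1 x hx.1)
        simp [h]
      · rw [expJet_succ]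
        refine absolutelyContinuousOnInterval_sum _ fun q hq => ?_
        rw [Finset.HasAntidiagonal.mem_antidiagonal] at hq
        exact (absolutelyContinuousOnInterval_const _ _ _).complex_mul
          ((hφ.ac _ (by omega) b hb).complex_mul (ih _ (by omega) (by omega)))
  · filter_upwards [hφ.ae_deriv, ae_restrict_mem measurableSet_Ici] with t h1 ht
    rw [expJet_succ t₀ φ N, expJet_succ t₀ φ (N + 1)]
    refine hasDerivWithinAt_leibniz (fun k hk => ?_) (fun k hk => hd k (by omega) t ht)
    rcases hk.lt_or_eq with hk | rfl
    exacts [hφ.deriv k hk t ht, h1]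

/-- The derivatives of `exp (λ (t - t₀))`. -/
noncomputable def cexpJet (t₀ : ℝ) (lam : ℂ) (i : ℕ) (t : ℝ) : ℂ :=
  lam ^ i * Complex.exp (lam * ((t : ℂ) - (t₀ : ℂ)))

theorem isJet_cexpJet (t₀ : ℝ) (lam : ℂ) (N : ℕ) : IsJet t₀ N (cexpJet t₀ lam) := by
  have hd : ∀ i t, HasDerivAt (cexpJet t₀ lam i) (cexpJet t₀ lam (i + 1) t) t := by
    intro i t
    have h := (((((hasDerivAt_id t).ofReal_comp).sub_const (t₀ : ℂ)).const_mul lam).cexp).const_mul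
      (lam ^ i)
    refine h.congr_deriv ?_
    simp only [cexpJet, id, Complex.ofReal_one]
    ring
  refine ⟨fun i _ t _ => (hd i t).hasDerivWithinAt, fun i _ b _ => ?_,
    Eventually.of_forall fun t => (hd N t).hasDerivWithinAt⟩
  refine ContDiffOn.absolutelyContinuousOnInterval (ContDiff.contDiffOn ?_)
  exact contDiff_const.mul (Complex.contDiff_exp.comp (contDiff_const.mul
    (Complex.ofRealCLM.contDiff.sub contDiff_const)))

end ExpJet

section Limit

theorem tendsto_leibniz {v b : ℕ → ℝ → ℂ} {V B : ℕ → ℂ} {N : ℕ}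
    (hv : ∀ k ≤ N, Tendsto (v k) atTop (𝓝 (V k))) (hb : ∀ k ≤ N, Tendsto (b k) atTop (𝓝 (B k))) :
    Tendsto (leibniz v b N) atTop
      (𝓝 (∑ p ∈ Finset.HasAntidiagonal.antidiagonal N, (N.choose p.1 : ℂ) * (V p.1 * B p.2))) := by
  refine tendsto_finsetSum _ fun p hp => ?_
  rw [Finset.HasAntidiagonal.mem_antidiagonal] at hp
  exact ((hv _ (by omega)).mul (hb _ (by omega))).const_mul _

theorem sum_antidiagonal_choose_mul_ite (V : ℕ → ℂ) (N : ℕ) :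
    ∑ p ∈ Finset.HasAntidiagonal.antidiagonal N,
      (N.choose p.1 : ℂ) * (V p.1 * if p.2 = 0 then 1 else 0) = V N := by
  rw [Finset.sum_eq_single_of_mem (N, 0) (by simp)]
  · simp
  · rintro ⟨i, j⟩ hp hne
    rw [Finset.HasAntidiagonal.mem_antidiagonal] at hp
    have : j ≠ 0 := fun h => hne (by simp only at hp; simp; omega)
    simp [this]

end Limit

end PoincarePerron

/-! ### The equation for the amplitude. -/

namespace PoincarePerron

open scoped ENNReal

theorem sum_mul_leibniz (A : ℕ → ℂ) (v b : ℕ → ℝ → ℂ) (n : ℕ) (t : ℝ) :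
    ∑ l ∈ Finset.range (n + 1), A l * leibniz v b l t =
      ∑ k ∈ Finset.range (n + 1),
        (∑ l ∈ Finset.Icc k n, A l * ((l.choose k : ℂ) * b (l - k) t)) * v k t := by
  have e : ∀ l, A l * leibniz v b l t = ∑ k ∈ Finset.range (l + 1),
      A l * ((l.choose k : ℂ) * b (l - k) t) * v k t := by
    intro l
    rw [leibniz, Finset.Nat.sum_antidiagonal_eq_sum_range_succ
      (fun i j => (l.choose i : ℂ) * (v i t * b j t)), Finset.mul_sum]
    exact Finset.sum_congr rfl fun k _ => by ring
  simp only [e, Finset.sum_mul]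
  refine Finset.sum_comm' fun l k => ?_
  simp only [Finset.mem_range, Finset.mem_Icc]
  omega

section Phi

variable {n : ℕ} {a : Fin n → ℂ} {r : Fin n → ℝ → ℂ} {t₀ : ℝ} {root : Fin n → ℂ} {i₀ : Fin n}
  {p : ℝ} {m : ℕ}

theorem isJet_phiJet (hn : 2 ≤ n) (hre : Function.Injective fun i => (root i).re)
    (hr : ∀ i, MemLp (r i) (ENNReal.ofReal p) (volume.restrict (Ici t₀))) (hmp : (m : ℝ) < p) :
    IsJet t₀ (n - 2) (phiJet a r t₀ root i₀ m) := by
  refine IsJet.sum (Finset.range m) (F := fun l => thetaJet a r t₀ root i₀ (l + 1)) fun l hl => ?_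
  have hlp : ((l + 1 : ℕ) : ℝ) < p :=
    lt_of_le_of_lt (by exact_mod_cast Finset.mem_range.1 hl) hmp
  exact isJet_thetaJet hn hre (one_le_div_of_lt (by omega) hlp)
    ((memLp_source_and_isOrder hn hre hr hlp).1 (by omega))

theorem tendsto_phiJet (hn : 2 ≤ n) (hre : Function.Injective fun i => (root i).re)
    (hr : ∀ i, MemLp (r i) (ENNReal.ofReal p) (volume.restrict (Ici t₀))) (hmp : (m : ℝ) < p)
    {i : ℕ} (hi : i < n - 1) : Tendsto (phiJet a r t₀ root i₀ m i) atTop (𝓝 0) := by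
  rw [← Finset.sum_const_zero (s := Finset.range m)]
  refine tendsto_finsetSum _ fun l hl => ?_
  have hlp : ((l + 1 : ℕ) : ℝ) < p :=
    lt_of_le_of_lt (by exact_mod_cast Finset.mem_range.1 hl) hmp
  exact tendsto_thetaJet hre (one_le_div_of_lt (by omega) hlp)
    ((memLp_source_and_isOrder hn hre hr hlp).1 (by omega)) (by omega)

theorem isOrder_phiJet (hn : 2 ≤ n) (hre : Function.Injective fun i => (root i).re)
    (hr : ∀ i, MemLp (r i) (ENNReal.ofReal p) (volume.restrict (Ici t₀))) (hmp : (m : ℝ) < p)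
    (hp : 0 < p) {i : ℕ} (hi : i < n - 1) :
    IsOrder (volume.restrict (Ici t₀)) (ENNReal.ofReal p) 1 (phiJet a r t₀ root i₀ m i) := by
  refine IsOrder.sum _ fun l hl => ?_
  have hlp : ((l + 1 : ℕ) : ℝ) < p :=
    lt_of_le_of_lt (by exact_mod_cast Finset.mem_range.1 hl) hmp
  exact (isOrder_thetaJet hre (by omega) hlp
    ((memLp_source_and_isOrder hn hre hr hlp).1 (by omega)) (by omega)).mono (by simpa using hp)
      (by omega)

variable (a r t₀ root i₀ m) in
/-- The value at `φ = θ_1 + ⋯ + θ_m` of the `i`-th complete Bell polynomial, that is,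
`exp (-∫ φ)` times the `i`-th derivative of `exp (∫ φ)`. -/
noncomputable def bellVal (i : ℕ) (t : ℝ) : ℂ :=
  MvPolynomial.aeval (fun j => phiJet a r t₀ root i₀ m j t) (bell i)

variable (a r t₀ root i₀ m) in
/-- The coefficient of `v^(k)` in the equation for `v = y exp (-λ t - ∫ φ)`. -/
noncomputable def conjCoeff (k : ℕ) (t : ℝ) : ℂ :=
  ∑ l ∈ Finset.Icc k n, (aTilde a (root i₀) l + rTilde r (root i₀) l t) *
    ((l.choose k : ℂ) * bellVal a r t₀ root i₀ m (l - k) t)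

theorem bellVal_zero (t : ℝ) : bellVal a r t₀ root i₀ m 0 t = 1 := by
  rw [bellVal, bell_zero, map_one]

theorem conjCoeff_zero (t : ℝ) : conjCoeff a r t₀ root i₀ m 0 t = residual a r t₀ root i₀ m t := by
  rw [conjCoeff, residual, ← Nat.range_succ_eq_Icc_zero]
  refine Finset.sum_congr rfl fun l _ => ?_
  rw [Nat.choose_zero_right, Nat.cast_one, one_mul, Nat.sub_zero, bellVal]

theorem conjCoeff_self (t : ℝ) : conjCoeff a r t₀ root i₀ m n t = 1 := by
  rw [conjCoeff, Finset.Icc_self, Finset.sum_singleton, aTilde_self, rTilde_eq_zero r le_rfl,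
    Nat.sub_self, bellVal_zero]
  simp

/-- The term `l = k` contributes `ã_k + r̃_k`, since `B_0 = 1`. As `k ≥ 1`, the other Bell indices
lie between `1` and `n - 1`, so only derivatives of `φ` up to order `n - 2` occur, and these have
order one. -/
theorem memLp_conjCoeff_sub (hn : 2 ≤ n) (hre : Function.Injective fun i => (root i).re)
    (hr : ∀ i, MemLp (r i) (ENNReal.ofReal p) (volume.restrict (Ici t₀))) (hmp : (m : ℝ) < p)
    (hp : 0 < p) {k : ℕ} (hk : k ≠ 0) (hkn : k < n) :
    MemLp (fun t => conjCoeff a r t₀ root i₀ m k t - aTilde a (root i₀) k) (ENNReal.ofReal p)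
      (volume.restrict (Ici t₀)) := by
  have hP : ENNReal.ofReal p ≠ 0 := by simpa using hp
  have hP' : ENNReal.ofReal p ≠ ∞ := ENNReal.ofReal_ne_top
  have hb : ∀ i ≤ n - 1, IsOrder (volume.restrict (Ici t₀)) (ENNReal.ofReal p)
      (if i = 0 then 0 else 1) (bellVal a r t₀ root i₀ m i) := fun i hi =>
    isOrder_aeval_bell hP hP' (fun j hj => isOrder_phiJet hn hre hr hmp hp hj) hi
  have e : (fun t => conjCoeff a r t₀ root i₀ m k t - aTilde a (root i₀) k) = fun t =>
      rTilde r (root i₀) k t + ∑ l ∈ Finset.Icc (k + 1) n,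
        (aTilde a (root i₀) l * ((l.choose k : ℂ) * bellVal a r t₀ root i₀ m (l - k) t) +
          (l.choose k : ℂ) * (rTilde r (root i₀) l t * bellVal a r t₀ root i₀ m (l - k) t)) := by
    funext t
    rw [conjCoeff, ← Finset.add_sum_Ioc_eq_sum_Icc hkn.le, Nat.choose_self, Nat.sub_self,
      bellVal_zero, Finset.Icc_add_one_left_eq_Ioc]
    simp only [add_mul, Nat.cast_one, mul_one, mul_left_comm (rTilde _ _ _ _)]
    ring
  rw [e]
  refine (memLp_rTilde r hr _ k).add (memLp_finsetSum _ fun l hl => ?_)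
  rw [Finset.mem_Icc] at hl
  have hbl := hb (l - k) (by omega)
  rw [if_neg (by omega)] at hbl
  refine (((hbl.memLp hP le_rfl).const_mul _).const_mul _).add (MemLp.const_mul ?_ _)
  have h := (hbl.mono hP (Nat.zero_le 1)).memLp_mul hP hP' (memLp_rTilde r hr (root i₀) l)
  simpa using h

/-- The linear part of the equation for `v`, on a combination of Green integrals. -/
theorem sum_aTilde_mul_greenJet (hn : 2 ≤ n) (hroot : ∀ i, (charPoly a).IsRoot (root i))
    (T : ℝ) (c : Fin n → ℂ) (f : ℝ → ℂ) (t : ℝ) :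
    ∑ k ∈ Finset.range (n + 1), aTilde a (root i₀) k *
      greenJet t₀ T Finset.univ (fun j => root j - root i₀) c (n - 1) f k t = -f t := by
  have hγ : ∀ j, ∑ i ∈ Finset.range (n + 1), aTilde a (root i₀) i * (root j - root i₀) ^ i = 0 := by
    intro j
    rw [sum_aTilde_mul_pow, sub_add_cancel]
    exact hroot j
  simp only [greenJet, mul_sub, Finset.sum_sub_distrib, mul_ite, mul_zero]
  rw [show n - 1 + 1 = n by omega, Finset.sum_ite_eq', if_pos (Finset.mem_range.2 (by omega)),
    aTilde_self, one_mul, sub_eq_neg_self]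
  simp only [mul_neg, Finset.sum_neg_distrib, neg_eq_zero, Finset.mul_sum]
  rw [Finset.sum_comm]
  refine Finset.sum_eq_zero fun j _ => ?_
  calc _ = (c j * greenInt t₀ T (root j - root i₀) f t) *
        ∑ i ∈ Finset.range (n + 1), aTilde a (root i₀) i * (root j - root i₀) ^ i := by
        rw [Finset.mul_sum]
        exact Finset.sum_congr rfl fun i _ => by ring
    _ = 0 := by rw [hγ j, mul_zero]

/-- The amplitude `v = y exp (-λ t - ∫ φ)` of the solution. -/
theorem exists_amplitude (hn : 2 ≤ n) (hroot : ∀ i, (charPoly a).IsRoot (root i))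
    (hre : Function.Injective fun i => (root i).re)
    (hr : ∀ i, MemLp (r i) (ENNReal.ofReal p) (volume.restrict (Ici t₀)))
    (hm : 1 ≤ m) (hmp : (m : ℝ) < p) (hpm : p ≤ m + 1) :
    ∃ v : ℕ → ℝ → ℂ, IsJet t₀ (n - 1) v ∧
      (∀ k ≤ n - 1, Tendsto (v k) atTop (𝓝 (if k = 0 then 1 else 0))) ∧
      ∀ᵐ t ∂volume.restrict (Ici t₀), ∑ k ∈ Finset.range (n + 1),
        conjCoeff a r t₀ root i₀ m k t * v k t = 0 := by
  have hm1 : (1 : ℝ) ≤ m := by exact_mod_cast hm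
  have hinj : InjOn root (Finset.univ : Finset (Fin n)) :=
    fun x _ y _ h => hre (congrArg Complex.re h)
  set γ : Fin n → ℂ := fun j => root j - root i₀ with hγdef
  set c : Fin n → ℂ := fun j => 1 / ∏ k ∈ Finset.univ.erase j, (root j - root k) with hc
  have hγ : ∀ j, j ≠ i₀ → (γ j).re ≠ 0 := fun j hj => re_sub_ne_zero hre hj
  have hγ0 : γ i₀ = 0 := sub_self _
  have hcγ : ∀ i ≤ n - 1, ∑ j, c j * γ j ^ i = if i = n - 1 then 1 else 0 := by
    intro i hi
    have h := sum_sub_pow_div_prod hinj (root i₀) (d := i) (by rw [Finset.card_fin]; omega)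
    rwa [Finset.card_fin] at h
  set q : ℕ → ℝ → ℂ := fun k t => conjCoeff a r t₀ root i₀ m k t - aTilde a (root i₀) k with hq
  have hA0 : aTilde a (root i₀) 0 = 0 := by
    rw [aTilde_zero]
    exact hroot i₀
  have hq0 : q 0 = residual a r t₀ root i₀ m := by
    funext t
    simp only [hq]
    rw [← conjCoeff_zero, hA0, sub_zero]
  -- The equation for `f` that results from inserting `v = 1 - ∑ c_j G_{γ_j} f`; differentiating `k`
  -- times multiplies `c_j` by `γ_j ^ k`, which vanishes at `j = i₀` for `k ≥ 1`.
  obtain ⟨T, hT, f, hf, hfe⟩ := exists_integrable_perturbed (t₀ := t₀) (p := p) (n := n) (q := q)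
    (d := fun k j => c j * γ j ^ k) hγ (fun k hk => by simp [hγ0, hk]) (by linarith)
    (by rw [hq0]; exact integrable_residual hn hroot hre hr hm hmp hpm)
    (fun k hk hkn => memLp_conjCoeff_sub hn hre hr hmp (by linarith) hk hkn)
  have hf1 : MemLp f (ENNReal.ofReal 1) (volume.restrict (Ici t₀)) := by
    rw [ENNReal.ofReal_one, memLp_one_iff_integrable]
    exact hf
  have hG : IsJet t₀ (n - 1) (greenJet t₀ T Finset.univ γ c (n - 1) f) := by
    refine isJet_greenJet hT (fun j _ => ?_) (fun i hi => ?_) ?_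
    · by_cases hj : j = i₀
      · rw [hj, hγ0]
        exact GreenIntegrable.of_integrable_zero hf
      · exact GreenIntegrable.of_memLp (hγ j hj) le_rfl hf1
    · rw [hcγ i hi.le, if_neg hi.ne]
    · rw [hcγ _ le_rfl, if_pos rfl]
  have hGt : ∀ k ≤ n - 1, Tendsto (greenJet t₀ T Finset.univ γ c (n - 1) f k) atTop (𝓝 0) := by
    intro k hk
    have h := (tendsto_finsetSum Finset.univ fun j _ => Tendsto.const_mul (c j * γ j ^ k)
      (show Tendsto (greenInt t₀ T (γ j) f) atTop (𝓝 0) by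
        by_cases hj : j = i₀
        · rw [hj, hγ0]
          exact tendsto_greenInt_zero hf
        · exact tendsto_greenInt (hγ j hj) le_rfl hf1)).neg
    simp only [mul_zero, Finset.sum_const_zero, neg_zero] at h
    exact h.congr fun t => (greenJet_of_le hk t).symm
  refine ⟨fun k t => (if k = 0 then 1 else 0) + greenJet t₀ T Finset.univ γ c (n - 1) f k t,
    ⟨fun i hi t ht => ?_, fun i hi b hb => ?_, ?_⟩, fun k hk => ?_, ?_⟩
  · simpa using (hG.deriv i hi t ht).const_add (if i = 0 then 1 else 0)
  · exact (absolutelyContinuousOnInterval_const _ _ _).add (hG.ac i hi b hb)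
  · filter_upwards [hG.ae_deriv] with t ht
    simpa using ht.const_add (if n - 1 = 0 then 1 else 0)
  · simpa using (hGt k hk).const_add (if k = 0 then 1 else 0)
  · filter_upwards [hfe] with t ht
    have hsplit : ∀ k x, conjCoeff a r t₀ root i₀ m k t * x =
        q k t * x + aTilde a (root i₀) k * x := fun k x => by
      simp only [hq]
      ring
    -- The leading coefficient stays `1`, so the perturbation does not contain `v^(n)`, the one
    -- derivative in which `f` appears explicitly.
    have hqn : q n t = 0 := by
      simp only [hq]
      rw [conjCoeff_self, aTilde_self, sub_self]
    simp only [hsplit]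
    rw [Finset.sum_add_distrib]
    have h1 : ∑ k ∈ Finset.range (n + 1), aTilde a (root i₀) k *
        ((if k = 0 then 1 else 0) + greenJet t₀ T Finset.univ γ c (n - 1) f k t) = -f t := by
      simp only [mul_add, Finset.sum_add_distrib]
      rw [sum_aTilde_mul_greenJet hn hroot]
      simp [hA0]
    have h2 : ∑ k ∈ Finset.range (n + 1), q k t *
        ((if k = 0 then 1 else 0) + greenJet t₀ T Finset.univ γ c (n - 1) f k t) = f t := by
      rw [Finset.sum_range_succ, hqn, zero_mul, add_zero, ht]
      simp only [mul_add, Finset.sum_add_distrib]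
      rw [sub_eq_add_neg, ← Finset.sum_neg_distrib]
      congr 1
      · rw [Finset.sum_eq_single_of_mem 0 (Finset.mem_range.2 (by omega)) fun k _ hk => by simp [hk]]
        simp
      · refine Finset.sum_congr rfl fun k hk => ?_
        rw [Finset.mem_range] at hk
        rw [greenJet_of_le (by omega), mul_neg]
    rw [h1, h2, add_neg_cancel]

end Phi

end PoincarePerron

/-! ### Assembly of the solution. -/

namespace PoincarePerron

open scoped ENNReal

variable {n : ℕ} {a : Fin n → ℂ} {r : Fin n → ℝ → ℂ} {t₀ : ℝ} {root : Fin n → ℂ} {i₀ : Fin n}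
  {p : ℝ} {m : ℕ}

theorem IsJet.isSolution {Y : ℕ → ℝ → ℂ} (hn : 1 ≤ n) (hY : IsJet t₀ (n - 1) Y)
    (h : ∀ᵐ t ∂volume.restrict (Ici t₀),
      ∑ i ∈ Finset.range (n + 1), (charPoly a + pertPoly r t).coeff i * Y i t = 0) :
    IsSolution a r t₀ (Y 0) := by
  refine ⟨hY.contDiffOn, fun T hT => (hY.ac _ le_rfl T hT).congr ?_, ?_⟩
  · rw [uIcc_of_le hT]
    exact (hY.iteratedDerivWithin_eq le_rfl).symm.mono Icc_subset_Ici_self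
  · have hY' := hY.ae_iteratedDerivWithin_succ_eq
    rw [Nat.sub_add_cancel hn] at hY'
    filter_upwards [h, hY', ae_restrict_mem measurableSet_Ici] with t h1 h2 ht
    have hcn : (charPoly a + pertPoly r t).coeff n = 1 := by
      have hc := (monic_charPoly a).coeff_natDegree
      rw [natDegree_charPoly] at hc
      rw [Polynomial.coeff_add, hc, Polynomial.coeff_eq_zero_of_degree_lt (degree_pertPoly_lt r t),
        add_zero]
    rw [Finset.sum_range_succ, hcn, one_mul, add_comm, Finset.sum_range] at h1
    rw [h2, ← h1]
    congr 1
    refine Finset.sum_congr rfl fun i _ => ?_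
    rw [Polynomial.coeff_add, coeff_charPoly, coeff_pertPoly,
      hY.iteratedDerivWithin_eq (by have := i.2; omega) ht]

theorem sum_coeff_mul_leibniz_cexpJet (w : ℕ → ℝ → ℂ) (lam : ℂ) (t : ℝ) :
    ∑ i ∈ Finset.range (n + 1), (charPoly a + pertPoly r t).coeff i *
        leibniz (cexpJet t₀ lam) w i t =
      Complex.exp (lam * ((t : ℂ) - (t₀ : ℂ))) *
        ∑ l ∈ Finset.range (n + 1), (aTilde a lam l + rTilde r lam l t) * w l t := by
  have hdeg : (charPoly a + pertPoly r t).natDegree ≤ n :=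
    Polynomial.natDegree_add_le_of_degree_le (natDegree_charPoly a).le
      (Polynomial.natDegree_le_of_degree_le (degree_pertPoly_lt r t).le)
  have h := sum_coeff_mul_leibniz hdeg lam fun l => w l t
  simp only [map_add, Polynomial.eval_add] at h
  rw [show ∑ l ∈ Finset.range (n + 1), (aTilde a lam l + rTilde r lam l t) * w l t = _ from h.symm,
    Finset.mul_sum]
  refine Finset.sum_congr rfl fun i _ => ?_
  rw [leibniz, mul_left_comm, Finset.mul_sum _ _ (Complex.exp _)]
  congr 1
  refine Finset.sum_congr rfl fun q _ => ?_
  rw [cexpJet]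
  ring

theorem exists_solution (hn : 2 ≤ n) (hroot : ∀ i, (charPoly a).IsRoot (root i))
    (hre : Function.Injective fun i => (root i).re)
    (hr : ∀ i, MemLp (r i) (ENNReal.ofReal p) (volume.restrict (Ici t₀)))
    (hm : 1 ≤ m) (hmp : (m : ℝ) < p) (hpm : p ≤ m + 1) :
    ∃ y : ℝ → ℂ, IsSolution a r t₀ y ∧
      (∀ i : ℕ, 1 ≤ i → i ≤ n - 1 →
        Tendsto (fun t => iteratedDerivWithin i y (Ici t₀) t / y t) atTop (𝓝 (root i₀ ^ i))) ∧
      ∃ ε : ℝ → ℂ, Tendsto ε atTop (𝓝 0) ∧ ∀ t, t₀ ≤ t →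
        y t = (1 + ε t) * Complex.exp (root i₀ * ((t : ℂ) - (t₀ : ℂ))) *
          Complex.exp (∫ s in t₀..t, phiJet a r t₀ root i₀ m 0 s) := by
  obtain ⟨v, hv, hvt, hve⟩ := exists_amplitude (i₀ := i₀) hn hroot hre hr hm hmp hpm
  set φ := phiJet a r t₀ root i₀ m with hφ
  have hE : IsJet t₀ (n - 1) (expJet t₀ φ) := by
    have h := (isJet_phiJet (a := a) (i₀ := i₀) hn hre hr hmp).expJet
    rwa [show n - 2 + 1 = n - 1 by omega] at h
  set b := bellVal a r t₀ root i₀ m with hb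
  set E : ℝ → ℂ := fun t => Complex.exp (∫ s in t₀..t, φ 0 s) with hEdef
  set Λ : ℝ → ℂ := fun t => Complex.exp (root i₀ * ((t : ℂ) - (t₀ : ℂ))) with hΛ
  set Y := leibniz (cexpJet t₀ (root i₀)) (leibniz v (expJet t₀ φ)) with hYdef
  have hY : IsJet t₀ (n - 1) Y := (isJet_cexpJet t₀ (root i₀) (n - 1)).leibniz (hv.leibniz hE)
  have hW : ∀ i t, leibniz v (expJet t₀ φ) i t = E t * leibniz v b i t := by
    intro i t
    rw [leibniz, leibniz, Finset.mul_sum]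
    refine Finset.sum_congr rfl fun q _ => ?_
    rw [show expJet t₀ φ q.2 t = E t * b q.2 t from rfl]
    ring
  have hYZ : ∀ i t, Y i t = (Λ t * E t) *
      leibniz (fun k _ => root i₀ ^ k) (leibniz v b) i t := by
    intro i t
    rw [hYdef, leibniz, leibniz, Finset.mul_sum]
    refine Finset.sum_congr rfl fun q _ => ?_
    rw [hW, show cexpJet t₀ (root i₀) q.1 t = root i₀ ^ q.1 * Λ t from rfl]
    ring
  have hbt : ∀ i ≤ n - 1, Tendsto (b i) atTop (𝓝 (if i = 0 then 1 else 0)) := fun i hi =>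
    tendsto_aeval_bell (fun j hj => tendsto_phiJet hn hre hr hmp hj) hi
  -- Once the nonvanishing factor `Λ E` is removed, only the Leibniz term with all derivatives on
  -- `exp (λ (t - t₀))` survives in the limit.
  have hZt : ∀ i ≤ n - 1, Tendsto (leibniz (fun k _ => root i₀ ^ k) (leibniz v b) i) atTop
      (𝓝 (root i₀ ^ i)) := by
    intro i hi
    have hvb : ∀ k ≤ i, Tendsto (leibniz v b k) atTop (𝓝 (if k = 0 then 1 else 0)) := by
      intro k hk
      have h := tendsto_leibniz (v := v) (b := b) (V := fun k => if k = 0 then 1 else 0)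
        (B := fun k => if k = 0 then 1 else 0) (N := k) (fun j hj => hvt j (by omega))
        fun j hj => hbt j (by omega)
      rwa [sum_antidiagonal_choose_mul_ite (fun k => if k = 0 then 1 else 0) k] at h
    have h := tendsto_leibniz (v := fun k _ => root i₀ ^ k) (V := fun k => root i₀ ^ k)
      (B := fun k => if k = 0 then 1 else 0) (N := i) (fun k _ => tendsto_const_nhds) hvb
    rwa [sum_antidiagonal_choose_mul_ite (fun k => root i₀ ^ k) i] at h
  have hZ0 : ∀ t, leibniz (fun k _ => root i₀ ^ k) (leibniz v b) 0 t = v 0 t := by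
    intro t
    simp [leibniz, hb, bellVal_zero]
  refine ⟨Y 0, hY.isSolution (by omega) ?_, fun i _ hi => ?_, fun t => v 0 t - 1, ?_, fun t _ => ?_⟩
  · filter_upwards [hve] with t ht
    rw [hYdef, sum_coeff_mul_leibniz_cexpJet]
    simp only [hW, mul_left_comm _ (E t)]
    rw [← Finset.mul_sum, sum_mul_leibniz]
    rw [show ∑ k ∈ Finset.range (n + 1), (∑ l ∈ Finset.Icc k n,
      (aTilde a (root i₀) l + rTilde r (root i₀) l t) * ((l.choose k : ℂ) * b (l - k) t)) * v k t = 0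
      from ht, mul_zero, mul_zero]
  · have h0 : Tendsto (v 0) atTop (𝓝 1) := by simpa using hvt 0 (Nat.zero_le _)
    have h := (hZt i hi).div h0 one_ne_zero
    rw [div_one] at h
    refine h.congr' ?_
    filter_upwards [eventually_ge_atTop t₀] with t ht
    rw [hY.iteratedDerivWithin_eq hi ht, hYZ, hYZ 0, hZ0,
      mul_div_mul_left _ _ (mul_ne_zero (Complex.exp_ne_zero _) (Complex.exp_ne_zero _))]
    rfl
  · simpa using (hvt 0 (Nat.zero_le _)).sub_const 1
  · rw [hYZ, hZ0]
    ring

end PoincarePerron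

theorem mainTheorem9 {n : ℕ} (hn : 2 ≤ n) (a : Fin n → ℂ) (root : Fin n → ℂ)
    (hroot : ∀ i, (PoincarePerron.charPoly a).IsRoot (root i))
    (hre : Function.Injective fun i => (root i).re) (i₀ : Fin n)
    (t₀ : ℝ) (r : Fin n → ℝ → ℂ) (m : ℕ) (hm : 2 ≤ m) (p : ℝ) (hmp : (m : ℝ) < p)
    (hpm : p ≤ (m : ℝ) + 1)
    (hr : ∀ i, MemLp (r i) (ENNReal.ofReal p) (volume.restrict (Ici t₀))) :
    (∀ l : ℕ, 1 ≤ l → l ≤ m →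
      (∀ j, j ≠ i₀ → ∀ t, t₀ ≤ t →
        IntegrableOn (fun s => PoincarePerron.greenKernel (root j - root i₀) t s *
          PoincarePerron.source a r t₀ (root i₀)
            (PoincarePerron.theta a r t₀ root i₀) l s) (Ici t₀)) ∧
      ContDiffOn ℝ ((n - 2 : ℕ) : WithTop ℕ∞)
        (PoincarePerron.theta a r t₀ root i₀ l) (Ici t₀) ∧
      MemLp (PoincarePerron.theta a r t₀ root i₀ l) (ENNReal.ofReal (p / l))
        (volume.restrict (Ici t₀))) ∧
    ∃ y : ℝ → ℂ, PoincarePerron.IsSolution a r t₀ y ∧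
      (∀ i : ℕ, 1 ≤ i → i ≤ n - 1 →
        Tendsto (fun t => iteratedDerivWithin i y (Ici t₀) t / y t) atTop
          (𝓝 (root i₀ ^ i))) ∧
      ∃ ε : ℝ → ℂ, Tendsto ε atTop (𝓝 0) ∧ ∀ t, t₀ ≤ t →
        y t = (1 + ε t) * Complex.exp (root i₀ * ((t : ℂ) - (t₀ : ℂ))) *
          Complex.exp (∫ s in t₀..t,
            ∑ l ∈ Finset.Icc 1 m, PoincarePerron.theta a r t₀ root i₀ l s) := by
  have hm1 : 1 ≤ m := by omega
  refine ⟨fun l hl hlm => ?_, ?_⟩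
  · have hlp : (l : ℝ) < p := lt_of_le_of_lt (by exact_mod_cast hlm) hmp
    have hq := PoincarePerron.one_le_div_of_lt hl hlp
    obtain ⟨hS, hθ⟩ := PoincarePerron.memLp_source_and_isOrder (a := a) (i₀ := i₀) hn hre hr hlp
    refine ⟨fun j hj t ht => ?_, ?_, ?_⟩
    · have hγ := PoincarePerron.re_sub_ne_zero hre hj
      exact (PoincarePerron.integrable_baseKer_mul hγ hq (hS hl) ht).congr
        (PoincarePerron.greenKernel_mul_ae_eq hγ _ t).symm
    · rw [PoincarePerron.theta_eq_thetaJet hre]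
      exact (PoincarePerron.isJet_thetaJet hn hre hq (hS hl)).contDiffOn
    · have h := (hθ 0 (by omega)).1
      rwa [iteratedDerivWithin_zero, ← PoincarePerron.ofReal_div_natCast p hl] at h
  · have hφ : ∀ s, ∑ l ∈ Finset.Icc 1 m, PoincarePerron.theta a r t₀ root i₀ l s =
        PoincarePerron.phiJet a r t₀ root i₀ m 0 s := by
      intro s
      rw [PoincarePerron.phiJet, ← Finset.Ico_add_one_right_eq_Icc, Finset.sum_Ico_eq_sum_range,
        Nat.add_sub_cancel]
      refine Finset.sum_congr rfl fun l _ => ?_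
      rw [add_comm 1 l, PoincarePerron.theta_eq_thetaJet hre]
    simp only [hφ]
    exact PoincarePerron.exists_solution hn hroot hre hr hm1 hmp hpm
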